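/- Let $m\ge 1$ and let $1\le l_1\le\dots\le l_m$ be integers, with $l_2\ge 2$ if $m\ge 2$. Let $G=\Theta(l_1,\dots,l_m)$ be a generalized theta graph, i.e. a (simple) graph consisting of two distinct vertices joined by $m$ internally disjoint paths of lengths $l_1,\dots,l_m$. The total graph $T(G)$ is the graph with vertex set $V(G)\cup E(G)$ in which two elements are adjacent if and only if they are adjacent or incident in $G$. A $k$-assignment $L$ for a finite graph $H$ gives each vertex $v$ of $H$ a set $L(v)$ of exactly $k$ colors. The graph $H$ is $k$-choosable if for every $k$-assignment $L$ it has a proper coloring $f$ with $f(v)\in L(v)$ for all $v\in V(H)$, and $\chi_\ell(H)$ is the least $k$ for which $H$ is $k$-choosable. The graph $H$ is equitably $k$-choosable if for every $k$-assignment $L$ such an $f$ can be chosen which, in addition, uses no color more than $\lceil |V(H)|/k\rceil$ times. Then $T(G)$ is equitably $k$-choosable for every integer $k\ge m+2$. Hence the List Equitable Total Coloring Conjecture holds for $G$: $T(G)$ is equitably $k$-choosable for every integer $k\ge\max\{\chi_\ell(T(G)),\,\Delta(G)+2\}$, where $\Delta(G)$ is the maximum degree of $G$. -/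

import Mathlib

namespace ListEquitable

universe u

section Coloring

variable {V : Type u}

/-- A `k`-assignment for a graph on `V`, with colors from `C`: every list has exactly `k` colors. -/
def IsAssignment {C : Type} (L : V → Finset C) (k : ℕ) : Prop :=
  ∀ v, (L v).card = k

/-- `f` is a proper `L`-coloring of `G` (properness is part of `SimpleGraph.Coloring`). -/
def IsListColoring (G : SimpleGraph V) {C : Type} (L : V → Finset C) (f : G.Coloring C) : Prop :=
  ∀ v, f v ∈ L v

/-- `G` is `k`-choosable: it has a proper `L`-coloring for every `k`-assignment `L`. -/
def IsChoosable (G : SimpleGraph V) (k : ℕ) : Prop :=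
  ∀ (C : Type) (L : V → Finset C), IsAssignment L k →
    ∃ f : G.Coloring C, IsListColoring G L f

/-- The list chromatic number: the least `k` for which `G` is `k`-choosable
(`⊤` if there is none, which does not happen for finite graphs). -/
noncomputable def listChromaticNumber (G : SimpleGraph V) : ℕ∞ :=
  ⨅ k ∈ {k : ℕ | IsChoosable G k}, (k : ℕ∞)

/-- `f` is an equitable `L`-coloring of the finite graph `G`, where `L` is a `k`-assignment:
a proper `L`-coloring using no color more than `⌈|V(G)| / k⌉` times. -/
def IsEquitableListColoring [Finite V] (G : SimpleGraph V) (k : ℕ) {C : Type}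
    (L : V → Finset C) (f : G.Coloring C) : Prop :=
  IsListColoring G L f ∧ ∀ c : C, {v | f v = c}.ncard ≤ ⌈(Nat.card V : ℚ) / (k : ℚ)⌉₊

/-- `G` is equitably `k`-choosable: it has an equitable `L`-coloring for every
`k`-assignment `L`. -/
def IsEquitablyChoosable [Finite V] (G : SimpleGraph V) (k : ℕ) : Prop :=
  ∀ (C : Type) (L : V → Finset C), IsAssignment L k →
    ∃ f : G.Coloring C, IsEquitableListColoring G k L f

end Coloring

section TotalGraph

variable {V : Type u}

/-- The total graph `T(G)`: its vertices are the vertices and the edges of `G`, two of them being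
adjacent when they are adjacent vertices, distinct edges with a common end, or a vertex and an edge
incident with it. -/
def totalGraph (G : SimpleGraph V) : SimpleGraph (V ⊕ G.edgeSet) where
  Adj
    | .inl v, .inl w => G.Adj v w
    | .inl v, .inr e => v ∈ (e : Sym2 V)
    | .inr e, .inl v => v ∈ (e : Sym2 V)
    | .inr e, .inr f => G.lineGraph.Adj e f
  symm := ⟨by
    rintro (v | e) (w | f) h
    · exact h.symm
    · exact h
    · exact h
    · exact G.lineGraph.adj_symm h⟩
  loopless := ⟨by
    rintro (v | e) h
    · exact G.loopless.irrefl v h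
    · exact G.lineGraph.loopless.irrefl e h⟩

/-- The assertion of the List Equitable Total Coloring Conjecture for the graph `G`: the total graph
`T(G)` is equitably `k`-choosable for each `k ≥ max {χ_ℓ(T(G)), Δ(G) + 2}`. -/
def SatisfiesLETCC [Fintype V] (G : SimpleGraph V) [DecidableRel G.Adj] : Prop :=
  ∀ k : ℕ, max (listChromaticNumber (totalGraph G)) ((G.maxDegree + 2 : ℕ) : ℕ∞) ≤ (k : ℕ∞) →
    IsEquitablyChoosable (totalGraph G) k

end TotalGraph

section Theta

/-- The vertices of `Θ(l₁, …, l_m)`: the two common ends `u` and `w` of the paths, and the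
`l i - 1` internal vertices of the `i`-th path. -/
inductive ThetaVertex {m : ℕ} (l : Fin m → ℕ) : Type
  | u : ThetaVertex l
  | w : ThetaVertex l
  | inner (i : Fin m) (j : Fin (l i - 1)) : ThetaVertex l

/-- The vertex at distance `j` from `u` along the `i`-th path, for `0 ≤ j ≤ l i`: it is `u` for
`j = 0`, the `j`-th internal vertex (index `j - 1`) for `0 < j < l i`, and `w` for `j = l i`. -/
def thetaPath {m : ℕ} (l : Fin m → ℕ) (i : Fin m) (j : ℕ) : ThetaVertex l :=
  if j = 0 then .u
  else if h : j - 1 < l i - 1 then .inner i ⟨j - 1, h⟩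
  else .w

/-- The standard graph consisting of two vertices `u`, `w` joined by `m` internally disjoint paths
of lengths `l₁, …, l_m`: its edges join consecutive vertices of these paths. -/
def thetaGraph {m : ℕ} (l : Fin m → ℕ) : SimpleGraph (ThetaVertex l) :=
  SimpleGraph.fromEdgeSet
    {e | ∃ (i : Fin m) (j : ℕ), j < l i ∧ e = s(thetaPath l i j, thetaPath l i (j + 1))}

/-- `G` belongs to the isomorphism class `Θ(l₁, …, l_m)`. -/
def IsTheta {V : Type u} (G : SimpleGraph V) {m : ℕ} (l : Fin m → ℕ) : Prop :=
  Nonempty (G ≃g thetaGraph l)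

end Theta

end ListEquitable

namespace ThetaTotal

open scoped Classical

section Greedy

variable {α : Type*} [DecidableEq α] {C : Type}

/-- The sets `A`, `P` and `B` can be coloured properly from the lists `L`, so that each colour occurs
at most `μ` times on `A`, and at most once on `P` and on `B`. -/
def Can (H : SimpleGraph α) (L : α → Finset C) (A : Finset α) (μ : ℕ) (P B : Finset α) : Prop :=
  ∃ c : α → C, (∀ x ∈ A ∪ P ∪ B, c x ∈ L x) ∧
    (∀ x ∈ A ∪ P ∪ B, ∀ y ∈ A ∪ P ∪ B, H.Adj x y → c x ≠ c y) ∧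
    Set.InjOn c P ∧ Set.InjOn c B ∧ ∀ col, (A.filter (fun x => c x = col)).card ≤ μ

variable {H : SimpleGraph α} {L : α → Finset C} {A P B : Finset α} {μ : ℕ}

theorem can_empty [Nonempty C] : Can H L ∅ 0 ∅ ∅ :=
  ⟨fun _ => Classical.arbitrary C, by simp, by simp, by simp, by simp, by simp⟩

theorem Can.swap (h : Can H L A μ P B) : Can H L A μ B P := by
  obtain ⟨c, h1, h2, h3, h4, h5⟩ := h
  have e : A ∪ B ∪ P = A ∪ P ∪ B := by rw [Finset.union_assoc, Finset.union_comm B, Finset.union_assoc]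
  exact ⟨c, by rwa [e], by rwa [e], h4, h3, h5⟩

theorem Can.close (h : Can H L A μ P B) : Can H L (A ∪ B) (μ + 1) P ∅ := by
  obtain ⟨c, h1, h2, h3, h4, h5⟩ := h
  have e : A ∪ B ∪ P ∪ ∅ = A ∪ P ∪ B := by
    rw [Finset.union_empty, Finset.union_assoc, Finset.union_comm B, Finset.union_assoc]
  refine ⟨c, by rwa [e], by rwa [e], h3, by simp, fun col => ?_⟩
  rw [Finset.filter_union]
  refine (Finset.card_union_le _ _).trans (Nat.add_le_add (h5 col) ?_)
  refine Finset.card_le_one.2 fun x hx y hy => ?_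
  rw [Finset.mem_filter] at hx hy
  exact h4 hx.1 hy.1 (hx.2.trans hy.2.symm)

theorem Can.mono {ν : ℕ} (h : Can H L A μ P B) (hν : μ ≤ ν) : Can H L A ν P B := by
  obtain ⟨c, h1, h2, h3, h4, h5⟩ := h
  exact ⟨c, h1, h2, h3, h4, fun col => (h5 col).trans hν⟩

theorem Can.subset_list {L' : α → Finset C} (h : Can H L' A μ P B) (hL : ∀ x, L' x ⊆ L x) :
    Can H L A μ P B := by
  obtain ⟨c, h1, h2, h3, h4, h5⟩ := h
  exact ⟨c, fun x hx => hL x (h1 x hx), h2, h3, h4, h5⟩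

theorem Can.step (h : Can H L A μ P B) (x : α) (hx : x ∉ A ∪ P ∪ B) (D : Finset α)
    (hA : ∀ y ∈ A ∪ P, H.Adj x y → y ∈ D ∨ Disjoint (L x) (L y))
    (hB : ∀ y ∈ B, y ∈ D ∨ Disjoint (L x) (L y)) (hD : D.card < (L x).card) :
    Can H L A μ P (insert x B) := by
  obtain ⟨c, h1, h2, h3, h4, h5⟩ := h
  obtain ⟨col, hcol, hcD⟩ : ∃ col ∈ L x, col ∉ D.image c := by
    by_contra! hcon
    exact absurd ((Finset.card_le_card hcon).trans Finset.card_image_le) (by omega)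
  have key : ∀ y ∈ A ∪ P ∪ B, (y ∈ D ∨ Disjoint (L x) (L y)) → c y ≠ col := by
    rintro y hy (hyD | hyd) rfl
    · exact hcD (Finset.mem_image_of_mem c hyD)
    · exact Finset.disjoint_left.1 hyd hcol (h1 y hy)
  have hne : ∀ y ∈ A ∪ P ∪ B, y ≠ x := fun y hy h => hx (h ▸ hy)
  have e : A ∪ P ∪ insert x B = insert x (A ∪ P ∪ B) := by simp
  have hAP : ∀ y ∈ A ∪ P ∪ B, H.Adj x y → c y ≠ col := by
    intro y hy hadj
    rcases Finset.mem_union.1 hy with h | h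
    · exact key y hy (hA y h hadj)
    · exact key y hy (hB y h)
  have hup : ∀ y, y ≠ x → Function.update c x col y = c y := fun y hy => Function.update_of_ne hy _ _
  have hself : Function.update c x col x = col := Function.update_self _ _ _
  refine ⟨Function.update c x col, ?_, ?_, ?_, ?_, ?_⟩
  · rw [e]
    intro y hy
    rcases Finset.mem_insert.1 hy with rfl | hy
    · rwa [hself]
    · rw [hup y (hne y hy)]; exact h1 y hy
  · rw [e]
    intro y hy z hz hadj
    rw [Finset.mem_insert] at hy hz
    rcases hy with rfl | hy <;> rcases hz with rfl | hz
    · exact absurd hadj (H.loopless.irrefl _)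
    · rw [hself, hup z (hne z hz)]; exact (hAP z hz hadj).symm
    · rw [hself, hup y (hne y hy)]; exact hAP y hy hadj.symm
    · rw [hup y (hne y hy), hup z (hne z hz)]; exact h2 y hy z hz hadj
  · refine h3.congr fun y hy => ?_
    exact (hup y (hne y (by simp [Finset.mem_coe.1 hy]))).symm
  · intro y hy z hz hyz
    rw [Finset.mem_coe, Finset.mem_insert] at hy hz
    rcases hy with rfl | hy <;> rcases hz with rfl | hz
    · rfl
    · rw [hself, hup z (hne z (by simp [hz]))] at hyz
      exact absurd hyz.symm (key z (by simp [hz]) (hB z hz))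
    · rw [hself, hup y (hne y (by simp [hy]))] at hyz
      exact absurd hyz (key y (by simp [hy]) (hB y hy))
    · rw [hup y (hne y (by simp [hy])), hup z (hne z (by simp [hz]))] at hyz
      exact h4 hy hz hyz
  · intro col'
    refine le_trans (le_of_eq ?_) (h5 col')
    congr 1
    refine Finset.filter_congr fun y hy => ?_
    rw [hup y (hne y (by simp [hy]))]

/-- At most `d` elements of `A` are adjacent to `x`. -/
def Cost (H : SimpleGraph α) (A : Finset α) (x : α) (d : ℕ) : Prop :=
  ∃ D : Finset α, D.card ≤ d ∧ ∀ y ∈ A, H.Adj x y → y ∈ D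

omit [DecidableEq α] in
theorem Cost.mono {d d' : ℕ} {x : α} (h : Cost H A x d) (hd : d ≤ d') : Cost H A x d' := by
  obtain ⟨D, h1, h2⟩ := h
  exact ⟨D, h1.trans hd, h2⟩

theorem Can.phase {k d : ℕ} (h : Can H L A μ P B) (B' : Finset α) (hB' : Disjoint B' (A ∪ P ∪ B))
    (hL : ∀ x ∈ B', k ≤ (L x).card) (hc : ∀ x ∈ B', Cost H (A ∪ P) x d)
    (hk : ∀ x ∈ B', d + B.card + B'.card ≤ k) : Can H L A μ P (B ∪ B') := by
  induction B' using Finset.induction_on generalizing k d with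
  | empty => simpa using h
  | insert x S hx ih =>
    rw [Finset.disjoint_insert_left] at hB'
    have hcard := Finset.card_insert_of_notMem hx
    have h1 := ih hB'.2 (fun y hy => hL y (Finset.mem_insert_of_mem hy))
      (fun y hy => hc y (Finset.mem_insert_of_mem hy)) (fun y hy => by
        have := hk y (Finset.mem_insert_of_mem hy); omega)
    rw [Finset.union_insert]
    obtain ⟨D, hD, hDA⟩ := hc x (Finset.mem_insert_self _ _)
    have := hk x (Finset.mem_insert_self _ _)
    have := hL x (Finset.mem_insert_self _ _)
    refine h1.step x ?_ (D ∪ (B ∪ S)) ?_ ?_ ?_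
    · have := hB'.1
      simp only [Finset.mem_union, not_or] at this ⊢
      tauto
    · intro y hy hadj
      exact Or.inl (Finset.mem_union_left _ (hDA y hy hadj))
    · intro y hy
      exact Or.inl (Finset.mem_union_right _ hy)
    · have h1 := Finset.card_union_le D (B ∪ S)
      have h2 := Finset.card_union_le B S
      omega

end Greedy

/-- Names for the vertices and edges of generalized theta graphs: the ends `u`, `w` and the `j`-th
element `s i j` strictly between `u` and `w` on the `i`-th path. -/
inductive Nd : Type
  | u : Nd
  | w : Nd
  | s (i j : ℕ) : Nd

open Nd

/-- The element at position `j` of the `i`-th path, which has `n i` elements between `u` and `w`. -/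
def pos (n : ℕ → ℕ) (i j : ℕ) : Nd := if j = 0 then u else if j ≤ n i then s i j else w

@[simp] theorem pos_zero (n : ℕ → ℕ) (i : ℕ) : pos n i 0 = u := by simp [pos]

theorem pos_eq_s {n : ℕ → ℕ} {i j : ℕ} (h : 1 ≤ j) (h' : j ≤ n i) : pos n i j = s i j := by
  rw [pos, if_neg (by omega), if_pos h']

theorem pos_eq_w {n : ℕ → ℕ} {i j : ℕ} (h : n i < j) : pos n i j = w := by
  rw [pos, if_neg (by omega), if_neg (by omega)]

theorem pos_eq_s_iff {n : ℕ → ℕ} {i j i' j' : ℕ} :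
    pos n i j = s i' j' ↔ i = i' ∧ j = j' ∧ 1 ≤ j ∧ j ≤ n i := by
  unfold pos
  split_ifs with h1 h2
  · simp; omega
  · simp only [s.injEq]; omega
  · simp; omega

theorem pos_eq_u_iff {n : ℕ → ℕ} {i j : ℕ} : pos n i j = u ↔ j = 0 := by
  unfold pos
  split_ifs with h1 h2 <;> simp [h1]

theorem pos_eq_w_iff {n : ℕ → ℕ} {i j : ℕ} : pos n i j = w ↔ j ≠ 0 ∧ n i < j := by
  unfold pos
  split_ifs with h1 h2 <;> simp <;> omega

/-- The relation containing adjacency in the total graph of a generalized theta graph. -/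
def NdRel (n : ℕ → ℕ) (x y : Nd) : Prop :=
  (∃ i a b, a ≠ b ∧ a ≤ b + 2 ∧ b ≤ a + 2 ∧ a ≤ n i + 1 ∧ b ≤ n i + 1 ∧
    x = pos n i a ∧ y = pos n i b) ∨
  (∃ i j, i ≠ j ∧ x = s i 1 ∧ y = s j 1) ∨ (∃ i j, i ≠ j ∧ x = s i (n i) ∧ y = s j (n j))

/-- The graph of the relation `NdRel`. -/
def ndGraph (n : ℕ → ℕ) : SimpleGraph Nd where
  Adj x y := x ≠ y ∧ NdRel n x y
  symm := ⟨by
    rintro x y ⟨h, h1⟩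
    refine ⟨h.symm, ?_⟩
    rcases h1 with ⟨i, a, b, h1, h2, h3, h4, h5, h6, h7⟩ | ⟨i, j, h1, h2, h3⟩ | ⟨i, j, h1, h2, h3⟩
    · exact Or.inl ⟨i, b, a, h1.symm, h3, h2, h5, h4, h7, h6⟩
    · exact Or.inr (Or.inl ⟨j, i, h1.symm, h3, h2⟩)
    · exact Or.inr (Or.inr ⟨j, i, h1.symm, h3, h2⟩)⟩
  loopless := ⟨fun x h => h.1 rfl⟩

theorem ndGraph_adj_s {n : ℕ → ℕ} {i j : ℕ} {y : Nd} (h : (ndGraph n).Adj (s i j) y) :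
    (∃ b, b ≠ j ∧ b ≤ j + 2 ∧ j ≤ b + 2 ∧ b ≤ n i + 1 ∧ y = pos n i b) ∨
    (j = 1 ∧ ∃ i', i' ≠ i ∧ y = s i' 1) ∨ (j = n i ∧ ∃ i', i' ≠ i ∧ y = s i' (n i')) := by
  rcases h.2 with ⟨i', a, b, h1, h2, h3, h4, h5, h6, h7⟩ | ⟨i', j', h1, h2, h3⟩ | ⟨i', j', h1, h2, h3⟩
  · obtain ⟨rfl, rfl, -, -⟩ := pos_eq_s_iff.1 h6.symm
    exact Or.inl ⟨b, h1.symm, h3, h2, h5, h7⟩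
  · rw [s.injEq] at h2
    exact Or.inr (Or.inl ⟨h2.2, j', by rw [h2.1]; exact h1.symm, h3⟩)
  · rw [s.injEq] at h2
    obtain ⟨rfl, h2⟩ := h2
    exact Or.inr (Or.inr ⟨h2, j', h1.symm, h3⟩)

theorem ndGraph_adj_w {n : ℕ → ℕ} {y : Nd} (h : (ndGraph n).Adj w y) :
    ∃ i b, b + 1 = n i ∧ y = pos n i b ∨ (b = n i ∧ y = pos n i b) := by
  rcases h.2 with ⟨i, a, b, h1, h2, h3, h4, h5, h6, h7⟩ | ⟨i', j', h1, h2, h3⟩ | ⟨i', j', h1, h2, h3⟩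
  · have := pos_eq_w_iff.1 h6.symm
    refine ⟨i, b, ?_⟩
    rcases (by omega : b + 1 = n i ∨ b = n i) with h | h
    · exact Or.inl ⟨h, h7⟩
    · exact Or.inr ⟨h, h7⟩
  · cases h2
  · cases h2

/-- The elements of the paths in `T` whose positions lie in the intervals `(lo i, hi i]`. -/
noncomputable def R (T : Finset ℕ) (lo hi : ℕ → ℕ) : Finset Nd :=
  T.biUnion fun i => (Finset.Ioc (lo i) (hi i)).image (s i)

section R

variable {T T' : Finset ℕ} {lo mid hi : ℕ → ℕ}

@[simp] theorem mem_R {i j : ℕ} : s i j ∈ R T lo hi ↔ i ∈ T ∧ lo i < j ∧ j ≤ hi i := by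
  simp only [R, Finset.mem_biUnion, Finset.mem_image, Finset.mem_Ioc, s.injEq]
  constructor
  · rintro ⟨i', h, j', h', rfl, rfl⟩
    exact ⟨h, h'⟩
  · rintro ⟨h, h'⟩
    exact ⟨i, h, j, h', rfl, rfl⟩

@[simp] theorem u_notMem_R : u ∉ R T lo hi := by simp [R]

@[simp] theorem w_notMem_R : w ∉ R T lo hi := by simp [R]

theorem exists_of_mem_R {x : Nd} (h : x ∈ R T lo hi) :
    ∃ i j, x = s i j ∧ i ∈ T ∧ lo i < j ∧ j ≤ hi i := by
  cases x with
  | u => simp at h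
  | w => simp at h
  | s i j => exact ⟨i, j, rfl, mem_R.1 h⟩

theorem card_R : (R T lo hi).card = ∑ i ∈ T, (hi i - lo i) := by
  rw [R, Finset.card_biUnion]
  · refine Finset.sum_congr rfl fun i _ => ?_
    rw [Finset.card_image_of_injective _ (fun a b h => by simpa using h), Nat.card_Ioc]
  · intro i _ j _ hij
    rw [Function.onFun, Finset.disjoint_left]
    intro x hx hx'
    obtain ⟨a, -, rfl⟩ := Finset.mem_image.1 hx
    obtain ⟨b, -, hb⟩ := Finset.mem_image.1 hx'
    exact hij (by simpa using (by simpa using hb : j = i ∧ _).1.symm)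

theorem card_R_le {T : Finset ℕ} {lo hi : ℕ → ℕ} {d : ℕ} (h : ∀ i ∈ T, hi i - lo i ≤ d) :
    (R T lo hi).card ≤ T.card * d := by
  rw [card_R]
  exact (Finset.sum_le_card_nsmul _ _ _ h).trans (by simp)

end R

section Cost

variable {n : ℕ → ℕ} {A : Finset Nd} {i j : ℕ}

theorem cost_inner (h1 : j ≠ 1) (h2 : j ≠ n i) (D : Finset ℕ)
    (hD : ∀ b, b ≠ j → b ≤ j + 2 → j ≤ b + 2 → b ≤ n i + 1 → pos n i b ∈ A → b ∈ D) :
    Cost (ndGraph n) A (s i j) D.card := by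
  refine ⟨D.image (pos n i), Finset.card_image_le, fun y hy hadj => ?_⟩
  rcases ndGraph_adj_s hadj with ⟨b, hb1, hb2, hb3, hb4, rfl⟩ | h | h
  · exact Finset.mem_image_of_mem _ (hD b hb1 hb2 hb3 hb4 hy)
  · exact absurd h.1 h1
  · exact absurd h.1 h2

theorem cost_first (h2 : 1 ≠ n i) (D E : Finset ℕ)
    (hD : ∀ b, b ≠ 1 → b ≤ 3 → b ≤ n i + 1 → pos n i b ∈ A → b ∈ D)
    (hE : ∀ i', i' ≠ i → s i' 1 ∈ A → i' ∈ E) :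
    Cost (ndGraph n) A (s i 1) (D.card + E.card) := by
  refine ⟨D.image (pos n i) ∪ E.image (fun i' => s i' 1), (Finset.card_union_le _ _).trans
    (Nat.add_le_add Finset.card_image_le Finset.card_image_le), fun y hy hadj => ?_⟩
  rcases ndGraph_adj_s hadj with ⟨b, hb1, hb2, hb3, hb4, rfl⟩ | ⟨-, i', h, rfl⟩ | h
  · exact Finset.mem_union_left _ (Finset.mem_image_of_mem _ (hD b hb1 hb2 hb4 hy))
  · exact Finset.mem_union_right _ (Finset.mem_image_of_mem _ (hE _ h hy))
  · exact absurd h.1 h2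

theorem cost_last (h1 : n i ≠ 1) (D E : Finset ℕ)
    (hD : ∀ b, b ≠ n i → n i ≤ b + 2 → b ≤ n i + 1 → pos n i b ∈ A → b ∈ D)
    (hE : ∀ i', i' ≠ i → s i' (n i') ∈ A → i' ∈ E) :
    Cost (ndGraph n) A (s i (n i)) (D.card + E.card) := by
  refine ⟨D.image (pos n i) ∪ E.image (fun i' => s i' (n i')), (Finset.card_union_le _ _).trans
    (Nat.add_le_add Finset.card_image_le Finset.card_image_le), fun y hy hadj => ?_⟩
  rcases ndGraph_adj_s hadj with ⟨b, hb1, hb2, hb3, hb4, rfl⟩ | h | ⟨-, i', h, rfl⟩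
  · exact Finset.mem_union_left _ (Finset.mem_image_of_mem _ (hD b hb1 hb3 hb4 hy))
  · exact absurd h.1 h1
  · exact Finset.mem_union_right _ (Finset.mem_image_of_mem _ (hE _ h hy))

/-- An element without coloured elements to its right has at most two coloured neighbours. -/
theorem cost_left (h1 : j ≠ 1) (h2 : j < n i)
    (hA : ∀ b, j < b → b ≤ n i + 1 → pos n i b ∉ A) : Cost (ndGraph n) A (s i j) 2 := by
  refine (cost_inner h1 h2.ne {j - 1, j - 2} fun b hb1 hb2 hb3 hb4 hb => ?_).mono Finset.card_le_two
  have : ¬ j < b := fun h => hA b h hb4 hb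
  simp only [Finset.mem_insert, Finset.mem_singleton]
  omega

end Cost

section Fill

/-- The total length of the intervals `(lo i, hi i]` of length at most two. -/
def short (T : Finset ℕ) (lo hi : ℕ → ℕ) : ℕ :=
  ∑ i ∈ T, if hi i - lo i ≤ 2 then hi i - lo i else 0

variable {T : Finset ℕ} {hi : ℕ → ℕ}

theorem sum_update {T : Finset ℕ} {i : ℕ} (hi' : i ∈ T) (f g : ℕ → ℕ)
    (h : ∀ j ∈ T, j ≠ i → f j = g j) : ∑ j ∈ T, f j + g i = ∑ j ∈ T, g j + f i := by
  have e : ∑ j ∈ T.erase i, f j = ∑ j ∈ T.erase i, g j :=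
    Finset.sum_congr rfl (fun j hj => h j (Finset.mem_of_mem_erase hj) (Finset.ne_of_mem_erase hj))
  rw [← Finset.add_sum_erase T f hi', ← Finset.add_sum_erase T g hi', e]
  ring

theorem exists_advance {lo : ℕ → ℕ} (hlo : ∀ i ∈ T, lo i ≤ hi i) (h : 1 ≤ ∑ i ∈ T, (hi i - lo i)) :
    ∃ lo', (∀ i ∈ T, lo i ≤ lo' i ∧ lo' i ≤ hi i) ∧
      ∑ i ∈ T, (hi i - lo' i) + 1 = ∑ i ∈ T, (hi i - lo i) ∧
      short T lo' hi ≤ max (short T lo hi - 1) 2 := by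
  have key : ∀ i ∈ T, 1 ≤ hi i - lo i → ∃ lo', (∀ i ∈ T, lo i ≤ lo' i ∧ lo' i ≤ hi i) ∧
      ∑ i ∈ T, (hi i - lo' i) + 1 = ∑ i ∈ T, (hi i - lo i) ∧
      short T lo' hi + (if hi i - lo i ≤ 2 then hi i - lo i else 0) =
        short T lo hi + (if hi i - lo i ≤ 3 then hi i - lo i - 1 else 0) := by
    intro i hiT hlt
    refine ⟨Function.update lo i (lo i + 1), ?_, ?_, ?_⟩
    · intro j hj
      have := hlo j hj
      rcases eq_or_ne j i with rfl | hne
      · rw [Function.update_self]; omega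
      · rw [Function.update_of_ne hne]; omega
    · have := sum_update hiT (fun j => hi j - Function.update lo i (lo i + 1) j) (fun j => hi j - lo j)
        (fun j _ hne => by rw [Function.update_of_ne hne])
      simp only [Function.update_self] at this
      omega
    · have := sum_update hiT (fun j => if hi j - Function.update lo i (lo i + 1) j ≤ 2 then
          hi j - Function.update lo i (lo i + 1) j else 0)
        (fun j => if hi j - lo j ≤ 2 then hi j - lo j else 0)
        (fun j _ hne => by rw [Function.update_of_ne hne])
      simp only [Function.update_self] at this
      rw [short, short, this]
      congr 1
      split_ifs <;> omega
  by_cases hs : ∃ i ∈ T, 1 ≤ hi i - lo i ∧ hi i - lo i ≤ 2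
  · obtain ⟨i, hiT, h1, h2⟩ := hs
    obtain ⟨lo', h3, h4, h5⟩ := key i hiT h1
    refine ⟨lo', h3, h4, ?_⟩
    rw [if_pos h2, if_pos (by omega)] at h5
    omega
  · push Not at hs
    obtain ⟨i, hiT, h1⟩ : ∃ i ∈ T, 1 ≤ hi i - lo i := by
      by_contra! hcon
      have : ∑ i ∈ T, (hi i - lo i) = 0 := Finset.sum_eq_zero fun i hiT => by
        have := hcon i hiT; omega
      omega
    have h0 : short T lo hi = 0 := Finset.sum_eq_zero fun j hj => by
      split_ifs with hj2
      · by_contra hne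
        exact absurd (hs j hj (by omega)) (by omega)
      · rfl
    obtain ⟨lo', h3, h4, h5⟩ := key i hiT h1
    refine ⟨lo', h3, h4, ?_⟩
    split_ifs at h5 <;> omega

theorem exists_fill (q : ℕ) {lo : ℕ → ℕ} (hlo : ∀ i ∈ T, lo i ≤ hi i)
    (h : q ≤ ∑ i ∈ T, (hi i - lo i)) :
    ∃ lo', (∀ i ∈ T, lo i ≤ lo' i ∧ lo' i ≤ hi i) ∧
      ∑ i ∈ T, (hi i - lo' i) + q = ∑ i ∈ T, (hi i - lo i) ∧
      short T lo' hi ≤ max (short T lo hi - q) 2 := by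
  induction q with
  | zero => exact ⟨lo, fun i hiT => ⟨le_rfl, hlo i hiT⟩, rfl, by omega⟩
  | succ q ih =>
    obtain ⟨lo1, h1, h2, h3⟩ := ih (by omega)
    obtain ⟨lo2, h4, h5, h6⟩ := exists_advance (fun i hiT => (h1 i hiT).2) (by omega)
    exact ⟨lo2, fun i hiT => ⟨(h1 i hiT).1.trans (h4 i hiT).1, (h4 i hiT).2⟩, by omega, by omega⟩

theorem sum_sub_add_sum_sub {lo mid : ℕ → ℕ} (h : ∀ i ∈ T, lo i ≤ mid i ∧ mid i ≤ hi i) :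
    ∑ i ∈ T, (mid i - lo i) + ∑ i ∈ T, (hi i - mid i) = ∑ i ∈ T, (hi i - lo i) := by
  rw [← Finset.sum_add_distrib]
  exact Finset.sum_congr rfl fun i hiT => by have := h i hiT; omega

theorem R_union {lo mid : ℕ → ℕ} (h : ∀ i ∈ T, lo i ≤ mid i ∧ mid i ≤ hi i) :
    R T lo mid ∪ R T mid hi = R T lo hi := by
  ext x
  cases x with
  | u => simp
  | w => simp
  | s i j =>
    simp only [Finset.mem_union, mem_R]
    constructor
    · rintro (⟨h1, h2⟩ | ⟨h1, h2⟩) <;> have := h i h1 <;> exact ⟨h1, by omega⟩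
    · rintro ⟨h1, h2⟩
      have := h i h1
      rcases le_or_gt j (mid i) with h3 | h3
      · exact Or.inl ⟨h1, by omega⟩
      · exact Or.inr ⟨h1, by omega⟩

end Fill

section Peel

variable {C : Type} {L : Nd → Finset C} {n : ℕ → ℕ} {T : Finset ℕ} {k : ℕ} {hi : ℕ → ℕ}

theorem disjoint_R {A : Finset Nd} {lo mid : ℕ → ℕ}
    (h : ∀ i ∈ T, ∀ j, lo i < j → j ≤ mid i → s i j ∉ A) : Disjoint (R T lo mid) A := by
  rw [Finset.disjoint_left]
  intro x hx hxA
  obtain ⟨i, j, rfl, h1, h2, h3⟩ := exists_of_mem_R hx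
  exact h i h1 j h2 h3 hxA

theorem exists_long (hk : 5 ≤ k) {lo : ℕ → ℕ} (hs : short T lo hi ≤ k - 2)
    (h : k - 1 ≤ ∑ i ∈ T, (hi i - lo i)) : ∃ i ∈ T, 3 ≤ hi i - lo i := by
  by_contra! hcon
  have : short T lo hi = ∑ i ∈ T, (hi i - lo i) :=
    Finset.sum_congr rfl fun i hiT => if_pos (by have := hcon i hiT; omega)
  omega

theorem short_le_sum (T : Finset ℕ) (lo hi : ℕ → ℕ) : short T lo hi ≤ ∑ i ∈ T, (hi i - lo i) :=
  Finset.sum_le_sum fun i _ => by split_ifs <;> omega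

/-- Colour one block of elements, from left to right on every path. -/
theorem Can.peel_one (hk : 5 ≤ k) (hL : ∀ x, (L x).card = k) (hhi : ∀ i ∈ T, hi i < n i)
    {lo : ℕ → ℕ} {A : Finset Nd} {μ : ℕ} (hC : Can (ndGraph n) L A μ ∅ ∅)
    (hlo : ∀ i ∈ T, 1 ≤ lo i ∧ lo i ≤ hi i)
    (hA : ∀ i ∈ T, ∀ j, lo i < j → j ≤ n i + 1 → pos n i j ∉ A)
    (hs : short T lo hi ≤ k - 2) :
    ∃ lo', (∀ i ∈ T, lo i ≤ lo' i ∧ lo' i ≤ hi i) ∧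
      ∑ i ∈ T, (hi i - lo' i) = ∑ i ∈ T, (hi i - lo i) - k ∧ short T lo' hi ≤ k - 2 ∧
      Can (ndGraph n) L (A ∪ R T lo lo') (μ + 1) ∅ ∅ := by
  have hnot : ∀ i ∈ T, ∀ j, lo i < j → j ≤ n i → s i j ∉ A := by
    intro i hiT j h1 h2 h3
    have := hlo i hiT
    exact hA i hiT j h1 (by omega) (by rwa [pos_eq_s (by omega) h2])
  by_cases hr : ∑ i ∈ T, (hi i - lo i) < k - 1
  · refine ⟨hi, fun i hiT => ⟨(hlo i hiT).2, le_rfl⟩, by simp; omega, by simp [short], ?_⟩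
    have h1 := hC.phase (k := k) (d := 2) (R T lo hi) ?_ (fun x _ => (hL x).ge) ?_ ?_
    · rw [Finset.empty_union] at h1
      exact h1.close
    · rw [Finset.union_empty, Finset.union_empty]
      exact disjoint_R fun i hiT j h1 h2 => hnot i hiT j h1 (h2.trans (hhi i hiT).le)
    · intro x hx
      obtain ⟨i, j, rfl, h1, h2, h3⟩ := exists_of_mem_R hx
      have := hlo i h1
      have := hhi i h1
      rw [Finset.union_empty]
      exact cost_left (by omega) (by omega) fun b hb hb' => hA i h1 b (by omega) hb'
    · intro x _
      rw [card_R, Finset.card_empty]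
      omega
  · obtain ⟨i, hiT, hi3⟩ := exists_long hk hs (by omega)
    have hloi := hlo i hiT
    have hhii := hhi i hiT
    set lo0 := Function.update lo i (lo i + 3) with hlo0
    have h0i : lo0 i = lo i + 3 := Function.update_self _ _ _
    have h0 : ∀ j, j ≠ i → lo0 j = lo j := fun j hj => Function.update_of_ne hj _ _
    have hle0 : ∀ j ∈ T, lo j ≤ lo0 j ∧ lo0 j ≤ hi j := by
      intro j hj
      have := hlo j hj
      rcases eq_or_ne j i with rfl | hne
      · omega
      · rw [h0 j hne]; omega
    have hsum := sum_update hiT (fun j => hi j - lo0 j) (fun j => hi j - lo j)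
      (fun j _ hne => by rw [h0 j hne])
    have hshort := sum_update hiT (fun j => if hi j - lo0 j ≤ 2 then hi j - lo0 j else 0)
      (fun j => if hi j - lo j ≤ 2 then hi j - lo j else 0) (fun j _ hne => by rw [h0 j hne])
    have hshort' : short T lo0 hi ≤ short T lo hi + 2 := by
      rw [short, short]
      rw [if_neg (by omega)] at hshort
      have : (if hi i - lo0 i ≤ 2 then hi i - lo0 i else 0) ≤ 2 := by split_ifs <;> omega
      omega
    simp only [h0i] at hsum
    obtain ⟨lo1, hl1, hl2, hl3⟩ := exists_fill (min k (∑ i ∈ T, (hi i - lo i)) - 3)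
      (fun j hj => (hle0 j hj).2) (by omega)
    have hl1i := hl1 i hiT
    have hlo1 : ∀ j ∈ T, lo j ≤ lo1 j ∧ lo1 j ≤ hi j :=
      fun j hj => ⟨(hle0 j hj).1.trans (hl1 j hj).1, (hl1 j hj).2⟩
    have hle := short_le_sum T lo1 hi
    refine ⟨lo1, hlo1, by omega, by omega, ?_⟩
    have hcard : (R T lo0 lo1).card = min k (∑ i ∈ T, (hi i - lo i)) - 3 := by
      have := sum_sub_add_sum_sub hl1
      rw [card_R]; omega
    have p1 := hC.phase (k := k) (d := 2) (R T lo0 lo1) ?_ (fun x _ => (hL x).ge) ?_ ?_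
    · rw [Finset.empty_union] at p1
      have hAnot : ∀ b, 1 ≤ b → b ≤ 3 → s i (lo i + b) ∉ A ∪ ∅ ∪ R T lo0 lo1 := by
        intro b hb hb'
        simp only [Finset.union_empty, Finset.mem_union, mem_R, not_or]
        exact ⟨hnot i hiT _ (by omega) (by omega), by omega⟩
      have p2 := p1.phase (k := k) (d := 2) {s i (lo i + 1)} ?_ (fun x _ => (hL x).ge) ?_ ?_
      · have p3 := p2.phase (k := k) (d := 1) {s i (lo i + 2)} ?_ (fun x _ => (hL x).ge) ?_ ?_
        · have p4 := p3.phase (k := k) (d := 0) {s i (lo i + 3)} ?_ (fun x _ => (hL x).ge) ?_ ?_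
          · have e : A ∪ (R T lo0 lo1 ∪ {s i (lo i + 1)} ∪ {s i (lo i + 2)} ∪ {s i (lo i + 3)}) =
                A ∪ R T lo lo1 := by
              congr 1
              ext x
              cases x with
              | u => simp
              | w => simp
              | s i' j =>
                simp only [Finset.mem_union, mem_R, Finset.mem_singleton, s.injEq]
                rcases eq_or_ne i' i with rfl | hne
                · simp only [h0i, hiT, true_and]; omega
                · simp [hne, h0 i' hne]
            rw [← e]
            exact p4.close
          · rw [Finset.disjoint_singleton_left]
            have := hAnot 3 (by omega) le_rfl
            simp only [Finset.mem_union, not_or] at this ⊢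
            simp [this.1, this.2]
          · intro x hx
            rw [Finset.mem_singleton.1 hx, Finset.union_empty]
            refine (cost_inner (by omega) (by omega) ∅ fun b h1 h2 h3 h4 h5 => ?_)
            exact absurd h5 (hA i hiT b (by omega) h4)
          · intro x _
            have h1 := Finset.card_union_le (R T lo0 lo1 ∪ {s i (lo i + 1)}) {s i (lo i + 2)}
            have h2 := Finset.card_union_le (R T lo0 lo1) {s i (lo i + 1)}
            simp only [Finset.card_singleton] at h1 h2 ⊢
            omega
        · rw [Finset.disjoint_singleton_left]
          have := hAnot 2 (by omega) (by omega)
          simp only [Finset.mem_union, not_or] at this ⊢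
          simp [this.1, this.2]
        · intro x hx
          rw [Finset.mem_singleton.1 hx, Finset.union_empty]
          refine (cost_inner (by omega) (by omega) {lo i} fun b h1 h2 h3 h4 h5 => ?_)
          have : ¬ lo i < b := fun h => hA i hiT b h h4 h5
          simp only [Finset.mem_singleton]
          omega
        · intro x _
          have h2 := Finset.card_union_le (R T lo0 lo1) {s i (lo i + 1)}
          simp only [Finset.card_singleton] at h2 ⊢
          omega
      · rw [Finset.disjoint_singleton_left]
        exact hAnot 1 le_rfl (by omega)
      · intro x hx
        rw [Finset.mem_singleton.1 hx, Finset.union_empty]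
        exact cost_left (by omega) (by omega) fun b hb hb' => hA i hiT b (by omega) hb'
      · intro x _
        simp only [Finset.card_singleton]
        omega
    · rw [Finset.union_empty, Finset.union_empty]
      refine disjoint_R fun j hj b h1 h2 => hnot j hj b ?_ ?_
      · exact (hle0 j hj).1.trans_lt h1
      · exact h2.trans ((hl1 j hj).2.trans (hhi j hj).le)
    · intro x hx
      obtain ⟨j, b, rfl, h1, h2, h3⟩ := exists_of_mem_R hx
      have := hlo j h1
      have := hhi j h1
      have := hl1 j h1
      have := hle0 j h1
      rw [Finset.union_empty]
      exact cost_left (by omega) (by omega) fun c hc hc' => hA j h1 c (by omega) hc'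
    · intro x _
      rw [hcard, Finset.card_empty]
      omega

theorem R_self (T : Finset ℕ) (lo : ℕ → ℕ) : R T lo lo = ∅ := by
  rw [← Finset.card_eq_zero, card_R]; simp

/-- Colour all but `cap` elements of the intervals `(lo i, hi i]` in at most `q` blocks. -/
theorem Can.peel (hk : 5 ≤ k) (hL : ∀ x, (L x).card = k) (hhi : ∀ i ∈ T, hi i < n i) {cap : ℕ}
    (q : ℕ) {lo : ℕ → ℕ} {A : Finset Nd} {μ : ℕ} (hC : Can (ndGraph n) L A μ ∅ ∅)
    (hlo : ∀ i ∈ T, 1 ≤ lo i ∧ lo i ≤ hi i)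
    (hA : ∀ i ∈ T, ∀ j, lo i < j → j ≤ n i + 1 → pos n i j ∉ A)
    (hs : short T lo hi ≤ k - 2) (hq : ∑ i ∈ T, (hi i - lo i) ≤ q * k + cap) :
    ∃ lo', (∀ i ∈ T, lo i ≤ lo' i ∧ lo' i ≤ hi i) ∧ ∑ i ∈ T, (hi i - lo' i) ≤ cap ∧
      Can (ndGraph n) L (A ∪ R T lo lo') (μ + q) ∅ ∅ := by
  induction q generalizing lo A μ with
  | zero =>
    exact ⟨lo, fun i hiT => ⟨le_rfl, (hlo i hiT).2⟩, by omega, by simpa [R_self] using hC⟩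
  | succ q ih =>
    obtain ⟨lo1, h1, h2, h3, h4⟩ := hC.peel_one hk hL hhi hlo hA hs
    obtain ⟨lo2, h5, h6, h7⟩ := ih h4 (fun i hiT => ⟨(hlo i hiT).1.trans (h1 i hiT).1, (h1 i hiT).2⟩)
      (fun i hiT j hj hj' => by
        have := h1 i hiT
        rw [Finset.mem_union, not_or]
        refine ⟨hA i hiT j (by omega) hj', fun hmem => ?_⟩
        obtain ⟨i', j', e, h8, h9, h10⟩ := exists_of_mem_R hmem
        obtain ⟨rfl, rfl, -, -⟩ := pos_eq_s_iff.1 e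
        omega) h3 (by rw [Nat.succ_mul] at hq; omega)
    refine ⟨lo2, fun i hiT => ⟨(h1 i hiT).1.trans (h5 i hiT).1, (h5 i hiT).2⟩, h6, ?_⟩
    rw [Finset.union_assoc, R_union (fun i hiT => ⟨(h1 i hiT).1, (h5 i hiT).1⟩)] at h7
    exact h7.mono (by omega)

end Peel

section EndBlocks

variable {C : Type} {L : Nd → Finset C} {n : ℕ → ℕ} {T Hs : Finset ℕ} {k : ℕ}

set_option maxHeartbeats 2000000 in
/-- Colour everything on the paths in `T` up to position `hi2 i`, together with `u`, `w`, the one-edge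
path and some of the end edges, in `q + 2` blocks: one block around `u`, one around `w`, and `q`
blocks between them. The first few elements, in number at most `qQ`, are left uncoloured. -/
theorem can_ends (hk : 5 ≤ k) (hL : ∀ x, (L x).card = k) (hn : ∀ i, i ∉ Hs → 3 ≤ n i)
    (hH : ∀ i ∈ Hs, n i = 1) (hTH : Disjoint T Hs) {TE Fr Fb Fa : Finset ℕ} (hTE : TE ⊆ T)
    (hFr : Fr ⊆ T) (hFb : Fb ⊆ T) (hFa : Fa ⊆ T) (hrb : Disjoint Fr Fb) (hra : Disjoint Fr Fa)
    (hba : Disjoint Fb Fa) {hi hi2 : ℕ → ℕ} (hhi : ∀ i ∈ T, 1 ≤ hi i ∧ hi i ≤ hi2 i ∧ hi2 i < n i)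
    (hb : ∀ i ∈ Fb, hi i + 2 ≤ n i) (ha : ∀ i ∈ Fa, hi i + 3 ≤ n i) {qQ aX q cap : ℕ}
    (h1 : ∑ i ∈ T, (hi2 i - 1) ≤ qQ + aX + q * k + cap) (h2 : ∑ i ∈ T, (hi2 i - hi i) ≤ cap)
    (h3 : short T 1 hi ≤ k - 2 + qQ + aX) (h4 : TE.card + 1 + aX ≤ k) (h5 : TE.card + 1 + Hs.card ≤ k)
    (h6 : Hs.card + cap + 2 ≤ k)
    (h7 : Hs.card + cap + Hs.card + (T.filter fun i => hi i + 1 = n i).card + 1 ≤ k)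
    (h8 : ∀ i ∈ Fr, Hs.card + cap + 1 + Fr.card + 2 ≤ k)
    (h9 : ∀ i ∈ Fb, Hs.card + cap + 1 + Fr.card + Fb.card + 1 ≤ k)
    (h10 : ∀ i ∈ Fa, Hs.card + cap + 1 + Fr.card + Fb.card + Fa.card ≤ k) [Nonempty C] :
    ∃ lo, (∀ i ∈ T, 1 ≤ lo i ∧ lo i ≤ hi i) ∧ ∑ i ∈ T, (lo i - 1) ≤ qQ ∧
      Can (ndGraph n) L ({u, w} ∪ R Hs 0 1 ∪ R TE 0 1 ∪ R (Fr ∪ Fb ∪ Fa) (n - 1) n ∪ R T lo hi2)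
        (q + 2) ∅ ∅ := by
  have hTH' : ∀ i ∈ T, i ∉ Hs := fun i hiT => Finset.disjoint_left.1 hTH hiT
  have hsplit : ∑ i ∈ T, (hi i - 1) + ∑ i ∈ T, (hi2 i - hi i) = ∑ i ∈ T, (hi2 i - 1) :=
    sum_sub_add_sum_sub (lo := 1) (fun i hiT => ⟨(hhi i hiT).1, (hhi i hiT).2.1⟩)
  obtain ⟨lo0, a1, a2, a3⟩ := exists_fill (T := T) (lo := 1) (hi := hi)
    (min qQ (∑ i ∈ T, (hi i - 1))) (fun i hiT => (hhi i hiT).1) (min_le_right _ _)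
  obtain ⟨lo1, b1, b2, b3⟩ := exists_fill (T := T) (lo := lo0) (hi := hi)
    (min aX (∑ i ∈ T, (hi i - lo0 i))) (fun i hiT => (a1 i hiT).2) (min_le_right _ _)
  simp only [Pi.one_apply] at a1 a2
  have a4 := short_le_sum T lo0 hi
  have b4 := short_le_sum T lo1 hi
  have a5 := sum_sub_add_sum_sub (T := T) (lo := 1) (mid := lo0) (hi := hi) a1
  have b5 := sum_sub_add_sum_sub b1
  simp only [Pi.one_apply] at a5
  have hlo1 : ∀ i ∈ T, 1 ≤ lo1 i ∧ lo1 i ≤ hi i :=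
    fun i hiT => ⟨(a1 i hiT).1.trans (b1 i hiT).1, (b1 i hiT).2⟩
  -- the block around `u`
  have hTEc : (R TE 0 1).card ≤ TE.card := (card_R_le (d := 1) (by simp)).trans (by simp)
  have hHc : (R Hs 0 1).card ≤ Hs.card := (card_R_le (d := 1) (by simp)).trans (by simp)
  have hFc : ∀ F : Finset ℕ, (R F (n - 1) n).card ≤ F.card := fun F =>
    (card_R_le (d := 1) fun i _ => by simp only [Pi.sub_apply, Pi.one_apply]; omega).trans (by simp)
  have hX : (R T lo0 lo1).card ≤ aX := by rw [card_R]; omega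
  have p1 := (can_empty (H := ndGraph n) (L := L)).phase (k := k) (d := 0)
    ({u} ∪ R TE 0 1 ∪ R T lo0 lo1) (by simp) (fun x _ => (hL x).ge)
    (fun x _ => ⟨∅, by simp, by simp⟩) (fun x _ => by
      have e1 := Finset.card_union_le ({u} ∪ R TE 0 1) (R T lo0 lo1)
      have e2 := Finset.card_union_le {u} (R TE 0 1)
      simp only [Finset.card_singleton, Finset.card_empty] at e1 e2 ⊢
      omega)
  have p2 := p1.close
  rw [Finset.empty_union, Finset.empty_union] at p2
  -- the blocks between
  obtain ⟨lo2, c1, c2, c3⟩ := p2.peel hk hL (fun i hiT => (hhi i hiT).2.1.trans_lt (hhi i hiT).2.2)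
    (cap := cap - ∑ i ∈ T, (hi2 i - hi i)) q hlo1 (by
      intro i hiT j hj hj' hmem
      have := hlo1 i hiT
      simp only [Finset.mem_union, Finset.mem_singleton] at hmem
      rcases hmem with (hmem | hmem) | hmem
      · rw [pos_eq_u_iff] at hmem; omega
      · obtain ⟨i', j', e, -, e2, e3⟩ := exists_of_mem_R hmem
        obtain ⟨rfl, rfl, -, -⟩ := pos_eq_s_iff.1 e
        simp only [Pi.one_apply] at e3
        omega
      · obtain ⟨i', j', e, -, e2, e3⟩ := exists_of_mem_R hmem
        obtain ⟨rfl, rfl, -, -⟩ := pos_eq_s_iff.1 e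
        omega) (by omega) (by omega)
  set A := {u} ∪ R TE 0 1 ∪ R T lo0 lo1 ∪ R T lo1 lo2 with hAdef
  have hlo2 : ∀ i ∈ T, 1 ≤ lo2 i ∧ lo2 i ≤ hi i :=
    fun i hiT => ⟨(hlo1 i hiT).1.trans (c1 i hiT).1, (c1 i hiT).2⟩
  have hw : w ∉ A := by simp [hAdef]
  have hs : ∀ i j, s i j ∈ A → i ∈ T ∧ j ≤ lo2 i := by
    intro i j h
    simp only [hAdef, Finset.mem_union, Finset.mem_singleton, mem_R, Pi.one_apply, Pi.zero_apply,
      reduceCtorEq, false_or] at h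
    rcases h with (h | h) | h
    · exact ⟨hTE h.1, h.2.2.trans (hlo2 i (hTE h.1)).1⟩
    · exact ⟨h.1, h.2.2.trans (c1 i h.1).1⟩
    · exact ⟨h.1, h.2.2⟩
  have hs1 : ∀ i, s i 1 ∈ A → i ∈ TE := by
    intro i h
    simp only [hAdef, Finset.mem_union, Finset.mem_singleton, mem_R, Pi.one_apply, Pi.zero_apply,
      reduceCtorEq, false_or] at h
    rcases h with (h | h) | h
    · exact h.1
    · have := a1 i h.1
      omega
    · have := hlo1 i h.1
      omega
  have hpos : ∀ i ∈ T, ∀ b, lo2 i < b → pos n i b ∉ A := by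
    intro i hiT b hb hmem
    have := hlo2 i hiT
    rcases le_or_gt b (n i) with h | h
    · rw [pos_eq_s (by omega) h] at hmem
      have := (hs i b hmem).2
      omega
    · rw [pos_eq_w h] at hmem
      exact hw hmem
  have hlast : ∀ i, s i (n i) ∉ A := by
    intro i hmem
    obtain ⟨hiT, h⟩ := hs i _ hmem
    have := hlo2 i hiT
    have := hhi i hiT
    omega
  -- the block around `w`
  have p3 := c3.phase (k := k) (d := TE.card + 1) (R Hs 0 1) (by
      rw [Finset.union_empty, Finset.union_empty]
      refine disjoint_R fun i hiH j _ _ hmem => hTH' i (hs i j hmem).1 hiH)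
    (fun x _ => (hL x).ge) (by
      intro x hx
      obtain ⟨i, j, rfl, d1, d2, d3⟩ := exists_of_mem_R hx
      simp only [Pi.zero_apply, Pi.one_apply] at d2 d3
      obtain rfl : j = 1 := by omega
      refine ⟨insert u (R TE 0 1), (Finset.card_insert_le _ _).trans (by omega), fun y hy hadj => ?_⟩
      rw [Finset.union_empty] at hy
      rcases ndGraph_adj_s hadj with ⟨b, e1, e2, e3, e4, rfl⟩ | ⟨-, i', e1, rfl⟩ | ⟨-, i', e1, rfl⟩
      · rw [hH i d1] at e4
        rcases (by omega : b = 0 ∨ b = 2) with rfl | rfl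
        · simp
        · rw [pos_eq_w (by rw [hH i d1]; omega)] at hy
          exact absurd hy hw
      · rw [Finset.mem_insert, mem_R]
        exact Or.inr ⟨hs1 _ hy, by simp⟩
      · exact absurd hy (hlast i'))
    (fun x _ => by simp only [Finset.card_empty]; omega)
  rw [Finset.empty_union] at p3
  have hYc : (R T lo2 hi2).card ≤ cap := by
    rw [card_R, ← sum_sub_add_sum_sub (mid := hi) (fun i hiT => ⟨(c1 i hiT).2, (hhi i hiT).2.1⟩)]
    omega
  have hHY : (R Hs 0 1 ∪ R T lo2 hi2).card ≤ Hs.card + cap :=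
    (Finset.card_union_le _ _).trans (by omega)
  have p4 := p3.phase (k := k) (d := 2) (R T lo2 hi2) (by
      rw [Finset.union_empty]
      refine disjoint_R fun i hiT j e1 e2 hmem => ?_
      rcases Finset.mem_union.1 hmem with h | h
      · have := (hs i j h).2
        omega
      · exact hTH' i hiT (mem_R.1 h).1)
    (fun x _ => (hL x).ge) (by
      intro x hx
      obtain ⟨i, j, rfl, d1, d2, d3⟩ := exists_of_mem_R hx
      have := hlo2 i d1
      have := hhi i d1
      rw [Finset.union_empty]
      exact cost_left (by omega) (by omega) fun b hb _ => hpos i d1 b (by omega))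
    (fun x _ => by
      have := Finset.card_le_card (Finset.subset_union_right (s₁ := R Hs 0 1) (s₂ := R T lo2 hi2))
      omega)
  have p5 := p4.phase (k := k)
    (d := Hs.card + (T.filter fun i => hi i + 1 = n i).card) {w} (by
      rw [Finset.disjoint_singleton_left]
      simp [hw])
    (fun x _ => (hL x).ge) (by
      intro x hx
      rw [Finset.mem_singleton.1 hx, Finset.union_empty]
      refine ⟨Hs.image (fun _ => u) ∪ (T.filter fun i => hi i + 1 = n i).image (fun i => s i (n i - 1)),
        (Finset.card_union_le _ _).trans (Nat.add_le_add Finset.card_image_le Finset.card_image_le),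
        fun y hy hadj => ?_⟩
      obtain ⟨i, b, ⟨e1, rfl⟩ | ⟨rfl, rfl⟩⟩ := ndGraph_adj_w hadj
      · by_cases hiH : i ∈ Hs
        · have := hH i hiH
          obtain rfl : b = 0 := by omega
          rw [pos_zero]
          exact Finset.mem_union_left _ (Finset.mem_image_of_mem (fun _ => u) hiH)
        · have := hn i hiH
          rw [pos_eq_s (by omega) (by omega)] at hy ⊢
          obtain ⟨hiT, e2⟩ := hs i b hy
          have := hlo2 i hiT
          have := hhi i hiT
          obtain rfl : b = n i - 1 := by omega
          exact Finset.mem_union_right _ (Finset.mem_image_of_mem (fun i => s i (n i - 1))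
            (Finset.mem_filter.2 ⟨hiT, by omega⟩))
      · by_cases hiH : i ∈ Hs
        · have := hH i hiH
          rw [pos_eq_s (by omega) (by omega)] at hy
          exact absurd hy (hlast i)
        · have := hn i hiH
          rw [pos_eq_s (by omega) (by omega)] at hy
          exact absurd hy (hlast i))
    (fun x _ => by
      rw [Finset.card_singleton]
      omega)
  have hB5 : (R Hs 0 1 ∪ R T lo2 hi2 ∪ {w}).card ≤ Hs.card + cap + 1 :=
    (Finset.card_union_le _ _).trans (by rw [Finset.card_singleton]; omega)
  have hdisj : ∀ F ⊆ T, ∀ F', Disjoint F F' → Disjoint (R F (n - 1) n)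
      (A ∪ ∅ ∪ (R Hs 0 1 ∪ R T lo2 hi2 ∪ {w} ∪ R F' (n - 1) n)) := by
    intro F hF F' hFF'
    refine disjoint_R fun i hiF j e1 e2 hmem => ?_
    simp only [Pi.sub_apply, Pi.one_apply] at e1
    have hnT := hn i (hTH' i (hF hiF))
    obtain rfl : j = n i := by omega
    simp only [Finset.mem_union, mem_R, Finset.mem_singleton, reduceCtorEq, or_false,
      Finset.notMem_empty] at hmem
    rcases hmem with h | (h | h) | h
    · exact hlast i h
    · exact hTH' i (hF hiF) h.1
    · have := hhi i h.1
      omega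
    · exact Finset.disjoint_left.1 hFF' hiF h.1
  have hcost : ∀ F ⊆ T, ∀ (d : ℕ), (∀ i ∈ F, hi i + (3 - d) ≤ n i) → d ≤ 2 →
      ∀ x ∈ R F (n - 1) n, Cost (ndGraph n) (A ∪ ∅) x d := by
    intro F hF d hd hd2 x hx
    obtain ⟨i, j, rfl, e1, e2, e3⟩ := exists_of_mem_R hx
    simp only [Pi.sub_apply, Pi.one_apply] at e2
    have hnT := hn i (hTH' i (hF e1))
    have hlo2 := hlo2 i (hF e1)
    have hhi := hhi i (hF e1)
    have hd := hd i e1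
    obtain rfl : j = n i := by omega
    rw [Finset.union_empty]
    have hc := cost_last (A := A) (n := n) (i := i) (by omega) (Finset.Ico (n i - 2) (n i - 2 + d)) ∅
      (by
        intro b f1 f2 f3 f4
        have : ¬ lo2 i < b := fun h => hpos i (hF e1) b h f4
        rw [Finset.mem_Ico]
        omega)
      (fun i' _ h => absurd h (hlast i'))
    simpa using hc
  have hcard : ∀ F, (R F (n - 1) n).card ≤ F.card := hFc
  have p6 := p5.phase (k := k) (d := 2) (R Fr (n - 1) n)
    (by simpa [R] using hdisj Fr hFr ∅ (by simp))
    (fun x _ => (hL x).ge) (hcost Fr hFr 2 (fun i hiF => by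
      have := hhi i (hFr hiF)
      omega) le_rfl)
    (fun x hx => by
      obtain ⟨i, j, rfl, e1, e2, e3⟩ := exists_of_mem_R hx
      have := h8 i e1
      have := hcard Fr
      omega)
  have p7 := p6.phase (k := k) (d := 1) (R Fb (n - 1) n) (hdisj Fb hFb Fr hrb.symm)
    (fun x _ => (hL x).ge) (hcost Fb hFb 1 (fun i hiF => by
      have := hb i hiF
      omega) (by omega))
    (fun x hx => by
      obtain ⟨i, j, rfl, e1, e2, e3⟩ := exists_of_mem_R hx
      have := h9 i e1
      have := hcard Fr
      have := hcard Fb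
      have := Finset.card_union_le (R Hs 0 1 ∪ R T lo2 hi2 ∪ {w}) (R Fr (n - 1) n)
      omega)
  have hunion : ∀ F F', R F (n - 1) n ∪ R F' (n - 1) n = R (F ∪ F') (n - 1) n := by
    intro F F'
    ext x
    cases x <;> simp [or_and_right]
  rw [Finset.union_assoc _ (R Fr (n - 1) n), hunion] at p7
  have p8 := p7.phase (k := k) (d := 0) (R Fa (n - 1) n)
    (hdisj Fa hFa (Fr ∪ Fb) (Finset.disjoint_union_right.2 ⟨hra.symm, hba.symm⟩))
    (fun x _ => (hL x).ge) (hcost Fa hFa 0 (fun i hiF => by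
      have := ha i hiF
      omega) (by omega))
    (fun x hx => by
      obtain ⟨i, j, rfl, e1, e2, e3⟩ := exists_of_mem_R hx
      have := h10 i e1
      have := hcard Fa
      have := hcard (Fr ∪ Fb)
      have := Finset.card_union_le Fr Fb
      have := Finset.card_union_le (R Hs 0 1 ∪ R T lo2 hi2 ∪ {w}) (R (Fr ∪ Fb) (n - 1) n)
      omega)
  rw [Finset.union_assoc _ (R (Fr ∪ Fb) (n - 1) n), hunion] at p8
  refine ⟨lo0, a1, by omega, ?_⟩
  have p9 := p8.close
  rw [show 0 + 1 + q + 1 = q + 2 by omega] at p9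
  convert p9 using 1
  rw [hAdef, ← R_union (T := T) (lo := lo0) (mid := lo2) (hi := hi2)
      (fun i hiT => ⟨(b1 i hiT).1.trans (c1 i hiT).1, (c1 i hiT).2.trans (hhi i hiT).2.1⟩),
    ← R_union (T := T) (lo := lo0) (mid := lo1) (hi := lo2)
      (fun i hiT => ⟨(b1 i hiT).1, (c1 i hiT).1⟩)]
  ext x
  simp only [Finset.mem_union, Finset.mem_insert, Finset.mem_singleton]
  tauto

end EndBlocks

/-- All elements: `u`, `w`, the elements of the one-edge paths in `Hs` and of the paths in `T`. -/
noncomputable def verts (n : ℕ → ℕ) (T Hs : Finset ℕ) : Finset Nd :=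
  {u, w} ∪ R Hs 0 1 ∪ R T 0 n

section Cases

variable {C : Type} {L : Nd → Finset C} {n : ℕ → ℕ} {T Hs : Finset ℕ} {k a : ℕ}

theorem Can.phase_le {A B : Finset Nd} {μ b d b' : ℕ} {H : SimpleGraph Nd} (hL : ∀ x, (L x).card = k)
    (h : Can H L A μ ∅ B ∧ B.card ≤ b) (B' : Finset Nd) (hb' : B'.card ≤ b')
    (hB' : ∀ x ∈ B', x ∉ A ∧ x ∉ B ∧ Cost H A x d ∧ d + b + b' ≤ k) :
    Can H L A μ ∅ (B ∪ B') ∧ (B ∪ B').card ≤ b + b' := by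
  refine ⟨h.1.phase (k := k) (d := d) B' ?_ (fun x _ => (hL x).ge) (fun x hx => ?_) (fun x hx => ?_),
    (Finset.card_union_le _ _).trans (Nat.add_le_add h.2 hb')⟩
  · rw [Finset.disjoint_left]
    intro x hx
    have := hB' x hx
    simp [this.1, this.2.1]
  · rw [Finset.union_empty]
    exact (hB' x hx).2.2.1
  · have := (hB' x hx).2.2.2
    have := h.2
    omega

theorem card_filter_le_sub_two {p r : ℕ} (hp : p ∈ T) (hr : r ∈ T) (hpr : p ≠ r) (P : ℕ → Prop)
    [DecidablePred P]
    (h1 : ¬ P p) (h2 : ¬ P r) : (T.filter P).card + 2 ≤ T.card := by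
  have : T.filter P ⊆ (T.erase p).erase r := by
    intro i hi
    rw [Finset.mem_filter] at hi
    refine Finset.mem_erase.2 ⟨?_, Finset.mem_erase.2 ⟨?_, hi.1⟩⟩
    · rintro rfl; exact h2 hi.2
    · rintro rfl; exact h1 hi.2
  have h3 := Finset.card_le_card this
  rw [Finset.card_erase_of_mem (Finset.mem_erase.2 ⟨hpr.symm, hr⟩), Finset.card_erase_of_mem hp] at h3
  have : 1 < T.card := Finset.one_lt_card.2 ⟨p, hp, r, hr, hpr⟩
  omega

theorem sum_sub_add_mul {f : ℕ → ℕ} (d : ℕ) (h : ∀ i ∈ T, d ≤ f i) :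
    ∑ i ∈ T, (f i - d) + T.card * d = ∑ i ∈ T, f i := by
  rw [← smul_eq_mul, ← Finset.sum_const, ← Finset.sum_add_distrib]
  exact Finset.sum_congr rfl fun i hi => Nat.sub_add_cancel (h i hi)

theorem can_of_large_slack [Nonempty C] (hL : ∀ x, (L x).card = k) (hn : ∀ i, i ∉ Hs → 3 ≤ n i)
    (hodd : ∀ i ∈ T, n i % 2 = 1) (hH : ∀ i ∈ Hs, n i = 1) (hTH : Disjoint T Hs)
    (hHs : Hs.card ≤ 1) (hka : T.card + Hs.card + a + 1 = k) (ha : 3 ≤ a) {p r : ℕ} (hp : p ∈ T)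
    (hr : r ∈ T) (hpr : p ≠ r) (hnp : n p ≠ 3) {M : ℕ}
    (hM : 2 + Hs.card + ∑ i ∈ T, n i ≤ (M + 2) * k) :
    Can (ndGraph n) L (verts n T Hs) (M + 2) ∅ ∅ := by
  have hT2 : 1 < T.card := Finset.one_lt_card.2 ⟨p, hp, r, hr, hpr⟩
  have hTn : ∀ i ∈ T, 3 ≤ n i := fun i hi => hn i (Finset.disjoint_left.1 hTH hi)
  have hnp3 := hTn p hp
  have hop := hodd p hp
  have hnr3 := hTn r hr
  have hsum := sum_sub_add_mul (T := T) (f := n) 2 fun i hi => by have := hTn i hi; omega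
  have hsum1 : ∑ i ∈ T, (n i - 1 - 1) = ∑ i ∈ T, (n i - 2) :=
    Finset.sum_congr rfl fun i _ => by omega
  set δ : ℕ → ℕ := fun i => (if i = p then 2 else 0) + (if i = r then 1 else 0) with hδ
  have hδp : δ p = 2 := by simp [hδ, hpr]
  have hδr : δ r = 1 := by simp [hδ, hpr.symm]
  have hδ0 : ∀ i, i ≠ p → i ≠ r → δ i = 0 := fun i h1 h2 => by simp [hδ, h1, h2]
  have hδs : ∑ i ∈ T, δ i = 3 := by
    simp [hδ, Finset.sum_add_distrib, Finset.sum_ite_eq', hp, hr]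
  have hδle : ∀ i ∈ T, δ i + 2 ≤ n i := by
    intro i hi
    have := hTn i hi
    by_cases h1 : i = p
    · subst h1; omega
    by_cases h2 : i = r
    · subst h2; omega
    rw [hδ0 i h1 h2]; omega
  have hcardF : ((T.erase p).erase r).card = T.card - 2 := by
    rw [Finset.card_erase_of_mem (Finset.mem_erase.2 ⟨hpr.symm, hr⟩), Finset.card_erase_of_mem hp]
    omega
  obtain ⟨lo, h1, h2, h3⟩ := can_ends (L := L) (n := n) (T := T) (Hs := Hs) (k := k) (by omega) hL hn hH
    hTH (TE := T) (Fr := (T.erase p).erase r) (Fb := {r}) (Fa := {p}) subset_rfl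
    ((Finset.erase_subset _ _).trans (Finset.erase_subset _ _)) (by simpa) (by simpa) (by simp)
    (by simp) (by simpa using hpr.symm) (hi := fun i => n i - 1 - δ i) (hi2 := fun i => n i - 1)
    (fun i hi => by have := hδle i hi; omega)
    (fun i hi => by rw [Finset.mem_singleton.1 hi, hδr]; omega)
    (fun i hi => by rw [Finset.mem_singleton.1 hi, hδp]; omega)
    (qQ := 0) (aX := a + Hs.card) (q := M) (cap := a)
    (by rw [add_mul] at hM; omega)
    (by
      rw [← hδs] at ha
      refine le_trans (Finset.sum_le_sum fun i hi => ?_) ha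
      have := hδle i hi
      omega)
    (by
      have : short T 1 (fun i => n i - 1 - δ i) ≤ ∑ i ∈ T, (1 + if i = r then 1 else 0) := by
        refine Finset.sum_le_sum fun i hi => ?_
        have := hTn i hi
        have := hodd i hi
        simp only [Pi.one_apply]
        by_cases h1 : i = p
        · subst h1; split_ifs <;> omega
        by_cases h2 : i = r
        · subst h2; split_ifs <;> omega
        rw [hδ0 i h1 h2]; split_ifs <;> omega
      have h2 : ∑ i ∈ T, (1 + if i = r then 1 else 0) = T.card + 1 := by
        simp [Finset.sum_add_distrib, Finset.sum_ite_eq', hr]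
      omega)
    (by omega) (by omega) (by omega)
    (by
      have := card_filter_le_sub_two hp hr hpr (fun i => n i - 1 - δ i + 1 = n i)
        (by omega) (by omega)
      omega)
    (fun _ _ => by omega)
    (fun _ _ => by rw [Finset.card_singleton]; omega)
    (fun _ _ => by rw [Finset.card_singleton, Finset.card_singleton]; omega)
  have hlo : ∀ i ∈ T, lo i = 1 := by
    intro i hi
    have h4 := (Finset.sum_eq_zero_iff.1 (Nat.le_zero.1 h2)) i hi
    have := h1 i hi
    omega
  have hF : (T.erase p).erase r ∪ {r} ∪ {p} = T := by
    ext i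
    simp only [Finset.mem_union, Finset.mem_erase, Finset.mem_singleton]
    constructor
    · rintro ((h | rfl) | rfl)
      · exact h.2.2
      · exact hr
      · exact hp
    · intro h
      tauto
  rw [hF] at h3
  convert h3 using 1
  ext x
  cases x with
  | u => simp [verts]
  | w => simp [verts]
  | s i j =>
    simp only [verts, Finset.mem_union, Finset.mem_insert, Finset.mem_singleton, mem_R, Pi.zero_apply,
      Pi.one_apply, Pi.sub_apply, reduceCtorEq, false_or]
    by_cases hi : i ∈ T
    · have := hTn i hi
      have := hlo i hi
      simp only [hi, true_and]
      rw [or_assoc, or_assoc]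
      refine or_congr_right ?_
      omega
    · simp [hi]

theorem mem_ends_s {TE F : Finset ℕ} {lo hi2 : ℕ → ℕ} {i j : ℕ} :
    s i j ∈ ({u, w} ∪ R Hs 0 1 ∪ R TE 0 1 ∪ R F (n - 1) n ∪ R T lo hi2 : Finset Nd) ↔
      (i ∈ Hs ∧ j = 1) ∨ (i ∈ TE ∧ j = 1) ∨ (i ∈ F ∧ n i - 1 < j ∧ j ≤ n i) ∨
        (i ∈ T ∧ lo i < j ∧ j ≤ hi2 i) := by
  simp only [Finset.mem_union, Finset.mem_insert, Finset.mem_singleton, mem_R, Pi.zero_apply,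
      Pi.one_apply, Pi.sub_apply, reduceCtorEq, false_or]
  constructor
  · rintro (((h | h) | h) | h)
    · exact Or.inl ⟨h.1, by omega⟩
    · exact Or.inr (Or.inl ⟨h.1, by omega⟩)
    · exact Or.inr (Or.inr (Or.inl h))
    · exact Or.inr (Or.inr (Or.inr h))
  · rintro (h | h | h | h)
    · exact Or.inl (Or.inl (Or.inl ⟨h.1, by omega⟩))
    · exact Or.inl (Or.inl (Or.inr ⟨h.1, by omega⟩))
    · exact Or.inl (Or.inr h)
    · exact Or.inr h

theorem cost_four {A : Finset Nd} {i j : ℕ} (h1 : j ≠ 1) (h2 : j ≠ n i) :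
    Cost (ndGraph n) A (s i j) 4 := by
  refine (cost_inner h1 h2 {j - 2, j - 1, j + 1, j + 2} fun b hb1 hb2 hb3 _ _ => ?_).mono
    Finset.card_le_four
  simp only [Finset.mem_insert, Finset.mem_singleton]
  omega

end Cases

section Cases

variable {C : Type} {L : Nd → Finset C} {n : ℕ → ℕ} {T Hs : Finset ℕ} {k a : ℕ}

theorem can_of_long_path [Nonempty C] (hk : 5 ≤ k) (hL : ∀ x, (L x).card = k)
    (hn : ∀ i, i ∉ Hs → 3 ≤ n i) (hodd : ∀ i ∈ T, n i % 2 = 1) (hH : ∀ i ∈ Hs, n i = 1)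
    (hTH : Disjoint T Hs) (hHs : Hs.card ≤ 1) (hka : T.card + Hs.card + a + 1 = k) (ha : 1 ≤ a)
    {p r : ℕ} (hp : p ∈ T) (hr : r ∈ T) (hpr : p ≠ r) (hnp : 7 ≤ n p)
    (hr3 : n r = 3 ∨ ∀ i ∈ T, n i ≠ 3) {M : ℕ}
    (hM : 2 + Hs.card + ∑ i ∈ T, n i ≤ (M + 3) * k) :
    Can (ndGraph n) L (verts n T Hs) (M + 3) ∅ ∅ := by
  have hT2 : 1 < T.card := Finset.one_lt_card.2 ⟨p, hp, r, hr, hpr⟩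
  have hTn : ∀ i ∈ T, 3 ≤ n i := fun i hi => hn i (Finset.disjoint_left.1 hTH hi)
  have hop := hodd p hp
  have hnr3 := hTn r hr
  set δ : ℕ → ℕ := fun i => if i = p then 5 else 0 with hδ
  set ε : ℕ → ℕ := fun i => if i = r then 1 else 0 with hε
  have hδp : δ p = 5 := by simp [hδ]
  have hδ0 : ∀ i, i ≠ p → δ i = 0 := fun i h1 => by simp [hδ, h1]
  have hεr : ε r = 1 := by simp [hε]
  have hε0 : ∀ i, i ≠ r → ε i = 0 := fun i h1 => by simp [hε, h1]
  have hδs : ∑ i ∈ T, δ i = 5 := by simp [hδ, Finset.sum_ite_eq', hp]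
  have hεs : ∑ i ∈ T, ε i = 1 := by simp [hε, Finset.sum_ite_eq', hr]
  have hδle : ∀ i ∈ T, δ i + ε i + 2 ≤ n i := by
    intro i hi
    have := hTn i hi
    by_cases h1 : i = p
    · subst h1; rw [hδp, hε0 _ hpr]; omega
    rw [hδ0 i h1]
    have : ε i ≤ 1 := by simp only [hε]; split_ifs <;> omega
    omega
  have hsum := sum_sub_add_mul (T := T) (f := n) 2 fun i hi => by have := hTn i hi; omega
  have hsum1 : ∑ i ∈ T, (n i - 1 - δ i - 1) + ∑ i ∈ T, δ i = ∑ i ∈ T, (n i - 2) := by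
    rw [← Finset.sum_add_distrib]
    exact Finset.sum_congr rfl fun i hi => by have := hδle i hi; omega
  have hcardF : ((T.erase p).erase r).card = T.card - 2 := by
    rw [Finset.card_erase_of_mem (Finset.mem_erase.2 ⟨hpr.symm, hr⟩), Finset.card_erase_of_mem hp]
    omega
  have hshort : short T 1 (fun i => n i - 1 - δ i - ε i) ≤ k - 2 + (k - 5) + (a + Hs.card) := by
    rcases hr3 with h3 | h3
    · have h1 : short T 1 (fun i => n i - 1 - δ i - ε i) ≤ ∑ i ∈ T, (1 + if i = p then 1 else 0) := by
        refine Finset.sum_le_sum fun i hi => ?_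
        have := hTn i hi
        have := hodd i hi
        simp only [Pi.one_apply]
        by_cases h1 : i = p
        · subst h1; split_ifs <;> omega
        by_cases h2 : i = r
        · subst h2; split_ifs <;> omega
        rw [hδ0 i h1, hε0 i h2]; split_ifs <;> omega
      have h2 : ∑ i ∈ T, (1 + if i = p then 1 else 0) = T.card + 1 := by
        simp [Finset.sum_add_distrib, Finset.sum_ite_eq', hp]
      omega
    · have h1 : short T 1 (fun i => n i - 1 - δ i - ε i) ≤
          ∑ i ∈ T, ((if i = p then 2 else 0) + if i = r then 2 else 0) := by
        refine Finset.sum_le_sum fun i hi => ?_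
        have := hTn i hi
        have := hodd i hi
        have := h3 i hi
        simp only [Pi.one_apply]
        by_cases h1 : i = p
        · subst h1; split_ifs <;> omega
        by_cases h2 : i = r
        · subst h2; split_ifs <;> omega
        rw [hδ0 i h1, hε0 i h2]; split_ifs <;> omega
      have h2 : ∑ i ∈ T, ((if i = p then 2 else 0) + if i = r then 2 else 0) = 4 := by
        simp [Finset.sum_add_distrib, Finset.sum_ite_eq', hp, hr]
      omega
  obtain ⟨lo, h1, h2, h3⟩ := can_ends (L := L) (n := n) (T := T) (Hs := Hs) (k := k) hk hL hn hH
    hTH (TE := T) (Fr := (T.erase p).erase r) (Fb := {r}) (Fa := {p}) subset_rfl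
    ((Finset.erase_subset _ _).trans (Finset.erase_subset _ _)) (by simpa) (by simpa) (by simp)
    (by simp) (by simpa using hpr.symm) (hi := fun i => n i - 1 - δ i - ε i)
    (hi2 := fun i => n i - 1 - δ i)
    (fun i hi => by have := hδle i hi; omega)
    (fun i hi => by rw [Finset.mem_singleton.1 hi, hεr]; omega)
    (fun i hi => by rw [Finset.mem_singleton.1 hi, hδp]; omega)
    (qQ := k - 5) (aX := a + Hs.card) (q := M) (cap := a)
    (by rw [add_mul] at hM; omega)
    (by
      refine le_trans (Finset.sum_le_sum (g := ε) fun i hi => ?_) (hεs.le.trans ha)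
      omega)
    hshort
    (by omega) (by omega) (by omega)
    (by
      have := card_filter_le_sub_two hp hr hpr (fun i => n i - 1 - δ i - ε i + 1 = n i)
        (by omega) (by omega)
      omega)
    (fun _ _ => by omega)
    (fun _ _ => by rw [Finset.card_singleton]; omega)
    (fun _ _ => by rw [Finset.card_singleton, Finset.card_singleton]; omega)
  have hF : (T.erase p).erase r ∪ {r} ∪ {p} = T := by
    ext i
    simp only [Finset.mem_union, Finset.mem_erase, Finset.mem_singleton]
    constructor
    · rintro ((h | rfl) | rfl)
      · exact h.2.2
      · exact hr
      · exact hp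
    · intro h
      tauto
  rw [hF] at h3
  set A := ({u, w} ∪ R Hs 0 1 ∪ R T 0 1 ∪ R T (n - 1) n ∪ R T lo fun i => n i - 1 - δ i : Finset Nd)
    with hA
  have hmem : ∀ i j, s i j ∈ A ↔ _ := fun i j => mem_ends_s
  have hnot : ∀ i ∈ T, ∀ j, 2 ≤ j → j < n i → (j ≤ lo i ∨ n i - 1 - δ i < j) → s i j ∉ A := by
    intro i hi j h4 h5 h6
    rw [hmem]
    rintro (h | h | h | h)
    · exact Finset.disjoint_left.1 hTH hi h.1
    · omega
    · omega
    · omega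
  have hnotp : ∀ b, n p < b + 6 → b < n p → pos n p b ∉ A := by
    intro b h4 h5
    rw [pos_eq_s (by omega) (by omega)]
    exact hnot p hp b (by omega) h5 (by omega)
  have hQc : (R T 1 lo).card ≤ k - 5 := by rw [card_R]; exact h2
  have hQp : ∀ b, n p < b + 6 → s p b ∉ R T 1 lo := by
    intro b hb hmem
    have := (mem_R.1 hmem).2.2
    have := h1 p hp
    omega
  have q1 := Can.phase_le (d := 4) hL (b := 0) ⟨h3, by simp⟩ (R T 1 lo) hQc (by
    intro x hx
    obtain ⟨i, j, rfl, e1, e2, e3⟩ := exists_of_mem_R hx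
    have := h1 i e1
    have := hTn i e1
    simp only [Pi.one_apply] at e2
    exact ⟨hnot i e1 j (by omega) (by omega) (Or.inl e3), by simp,
      cost_four (by omega) (by omega), by omega⟩)
  have q2 := Can.phase_le (d := 2) hL q1 {s p (n p - 5), s p (n p - 1)} Finset.card_le_two (by
    intro x hx
    rw [Finset.mem_insert, Finset.mem_singleton] at hx
    rcases hx with rfl | rfl
    · refine ⟨hnot p hp _ (by omega) (by omega) (by omega), ?_, ?_, by omega⟩
      · rw [Finset.empty_union]
        exact hQp _ (by omega)
      · refine (cost_inner (by omega) (by omega) {n p - 6, n p - 7} fun b e1 e2 e3 e4 e5 => ?_).mono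
          Finset.card_le_two
        have : ¬ (n p < b + 6 ∧ b < n p) := fun h => hnotp b h.1 h.2 e5
        simp only [Finset.mem_insert, Finset.mem_singleton]
        omega
    · refine ⟨hnot p hp _ (by omega) (by omega) (by omega), ?_, ?_, by omega⟩
      · rw [Finset.empty_union]
        exact hQp _ (by omega)
      · refine (cost_inner (by omega) (by omega) {n p, n p + 1} fun b e1 e2 e3 e4 e5 => ?_).mono
          Finset.card_le_two
        have : ¬ (n p < b + 6 ∧ b < n p) := fun h => hnotp b h.1 h.2 e5
        simp only [Finset.mem_insert, Finset.mem_singleton]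
        omega)
  have q3 := Can.phase_le (d := 1) hL q2 {s p (n p - 4), s p (n p - 2)} Finset.card_le_two (by
    intro x hx
    rw [Finset.mem_insert, Finset.mem_singleton] at hx
    rcases hx with rfl | rfl
    · refine ⟨hnot p hp _ (by omega) (by omega) (by omega), ?_, ?_, by omega⟩
      · simp only [Finset.empty_union, Finset.mem_union, Finset.mem_insert, Finset.mem_singleton,
          s.injEq, true_and, not_or]
        exact ⟨hQp _ (by omega), by omega, by omega⟩
      · refine (cost_inner (by omega) (by omega) {n p - 6} fun b e1 e2 e3 e4 e5 => ?_)
        have : ¬ (n p < b + 6 ∧ b < n p) := fun h => hnotp b h.1 h.2 e5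
        simp only [Finset.mem_singleton]
        omega
    · refine ⟨hnot p hp _ (by omega) (by omega) (by omega), ?_, ?_, by omega⟩
      · simp only [Finset.empty_union, Finset.mem_union, Finset.mem_insert, Finset.mem_singleton,
          s.injEq, true_and, not_or]
        exact ⟨hQp _ (by omega), by omega, by omega⟩
      · refine (cost_inner (by omega) (by omega) {n p} fun b e1 e2 e3 e4 e5 => ?_)
        have : ¬ (n p < b + 6 ∧ b < n p) := fun h => hnotp b h.1 h.2 e5
        simp only [Finset.mem_singleton]
        omega)
  have q4 := Can.phase_le (d := 0) hL q3 {s p (n p - 3)} (b' := 1) (by simp) (by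
    intro x hx
    rw [Finset.mem_singleton] at hx
    subst hx
    refine ⟨hnot p hp _ (by omega) (by omega) (by omega), ?_, ?_, by omega⟩
    · simp only [Finset.empty_union, Finset.mem_union, Finset.mem_insert, Finset.mem_singleton,
        s.injEq, true_and, not_or]
      exact ⟨⟨hQp _ (by omega), by omega, by omega⟩, by omega, by omega⟩
    · refine (cost_inner (by omega) (by omega) ∅ fun b e1 e2 e3 e4 e5 => ?_)
      exact absurd e5 (hnotp b (by omega) (by omega)))
  have q5 := q4.1.close
  convert q5 using 1
  ext x
  cases x with
  | u => simp [verts, hA]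
  | w => simp [verts, hA]
  | s i j =>
    rw [Finset.mem_union, hmem]
    simp only [verts, Finset.mem_union, Finset.mem_insert, Finset.mem_singleton, mem_R, Pi.zero_apply,
      Pi.one_apply, reduceCtorEq, false_or, Finset.notMem_empty, s.injEq]
    by_cases hi : i ∈ T
    · have := hTn i hi
      have := h1 i hi
      have hiH : i ∉ Hs := Finset.disjoint_left.1 hTH hi
      simp only [hi, hiH, true_and, false_and, false_or]
      by_cases hip : i = p
      · subst hip
        simp only [true_and]
        omega
      · simp only [hip, false_and, or_false]
        have := hδ0 i hip
        omega
    · have hip : i ≠ p := fun h => hi (h ▸ hp)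
      simp only [hi, hip, false_and, or_false]
      refine and_congr_right fun _ => by omega

end Cases

section Cases

variable {C : Type} {L : Nd → Finset C} {n : ℕ → ℕ} {T Hs : Finset ℕ} {k a : ℕ}

/-- Colour a last block containing a whole path with five elements. -/
theorem Can.last_triple {d : ℕ} (hL : ∀ x, (L x).card = k) (hn : ∀ i, i ∉ Hs → 3 ≤ n i)
    (hTH : Disjoint T Hs) (hka : T.card + Hs.card + a + 1 = k) (ha : 1 ≤ a)
    (hd : d = 0 ∧ k = 6 ∨ d = 1 ∧ 7 ≤ k)
    {p r : ℕ} (hp : p ∈ T) (hr : r ∈ T) (hpr : p ≠ r) (hnp : n p = 5) {lo hi2 : ℕ → ℕ}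
    (hlo : ∀ i ∈ T, 1 ≤ lo i ∧ lo i ≤ hi2 i) (hp2 : hi2 p = 1) (hr2 : hi2 r + 1 + d = n r)
    (h02 : ∀ i ∈ T, i ≠ p → i ≠ r → hi2 i = n i - 1) (hQ : ∑ i ∈ T, (lo i - 1) ≤ k - 6 - d) {M : ℕ}
    (hC : Can (ndGraph n) L ({u, w} ∪ R Hs 0 1 ∪ R (T.erase p) 0 1 ∪
      R ((T.erase p).erase r) (n - 1) n ∪ R T lo hi2) M ∅ ∅) :
    Can (ndGraph n) L (verts n T Hs) (M + 1) ∅ ∅ := by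
  have hT2 : 1 < T.card := Finset.one_lt_card.2 ⟨p, hp, r, hr, hpr⟩
  have hTn : ∀ i ∈ T, 3 ≤ n i := fun i hi => hn i (Finset.disjoint_left.1 hTH hi)
  have hrn := hTn r hr
  have hcardE : (T.erase p).card = T.card - 1 := Finset.card_erase_of_mem hp
  have hcardF : ((T.erase p).erase r).card = T.card - 2 := by
    rw [Finset.card_erase_of_mem (Finset.mem_erase.2 ⟨hpr.symm, hr⟩), Finset.card_erase_of_mem hp]
    omega
  have hlt : ∀ i ∈ T, hi2 i < n i := by
    intro i hi
    have := hTn i hi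
    by_cases h1 : i = p
    · subst h1; omega
    by_cases h2 : i = r
    · subst h2; omega
    rw [h02 i hi h1 h2]; omega
  set A := ({u, w} ∪ R Hs 0 1 ∪ R (T.erase p) 0 1 ∪ R ((T.erase p).erase r) (n - 1) n ∪
    R T lo hi2 : Finset Nd) with hA
  have hmem : ∀ i j, s i j ∈ A ↔ _ := fun i j => mem_ends_s
  have hHp : p ∉ Hs := Finset.disjoint_left.1 hTH hp
  have hHr : r ∉ Hs := Finset.disjoint_left.1 hTH hr
  have hnotp : ∀ b, 1 ≤ b → b ≤ 5 → s p b ∉ A := by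
    intro b h1 h2
    rw [hmem]
    have := hlo p hp
    rintro (h | h | h | h)
    · exact hHp h.1
    · exact Finset.notMem_erase p T h.1
    · exact Finset.notMem_erase p T (Finset.mem_of_mem_erase h.1)
    · omega
  have hnotpp : ∀ b, 1 ≤ b → b ≤ 5 → pos n p b ∉ A := by
    intro b h1 h2
    rw [pos_eq_s h1 (by omega)]
    exact hnotp b h1 h2
  have hnotr : s r (n r) ∉ A := by
    rw [hmem]
    rintro (h | h | h | h)
    · exact hHr h.1
    · omega
    · exact Finset.notMem_erase r _ h.1
    · omega
  have hlast : ∀ i, s i (n i) ∈ A → i ∈ (T.erase p).erase r ∪ Hs := by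
    intro i hmem'
    rw [Finset.mem_union]
    rcases (hmem i _).1 hmem' with h | h | h | h
    · exact Or.inr h.1
    · have := hTn i (Finset.mem_of_mem_erase h.1)
      omega
    · exact Or.inl h.1
    · have := hlt i h.1
      omega
  have hfirst : ∀ i, s i 1 ∈ A → i ∈ T.erase p ∪ Hs := by
    intro i hmem'
    rw [Finset.mem_union]
    rcases (hmem i _).1 hmem' with h | h | h | h
    · exact Or.inr h.1
    · exact Or.inl h.1
    · exact Or.inl (Finset.mem_of_mem_erase h.1)
    · have := hlo i h.1
      omega
  have hEH := Finset.card_union_le (T.erase p) Hs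
  have hFH := Finset.card_union_le ((T.erase p).erase r) Hs
  have hQc : (R T 1 lo).card ≤ k - 6 - d := by rw [card_R]; exact hQ
  have hZc : (R {r} hi2 (n - 1)).card ≤ d := by
    rw [card_R, Finset.sum_singleton, Pi.sub_apply, Pi.one_apply]
    omega
  have q1 := Can.phase_le (d := T.card + Hs.card + 1) hL (b := 0) ⟨hC, by simp⟩ {s r (n r)} (b' := 1)
    (by simp) (by
      intro x hx
      rw [Finset.mem_singleton] at hx
      subst hx
      refine ⟨hnotr, by simp, (cost_last (by omega) {n r - 2, n r - 1, n r + 1}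
        ((T.erase p).erase r ∪ Hs) (fun b e1 e2 e3 e4 => ?_) (fun i _ h => hlast i h)).mono ?_, by omega⟩
      · simp only [Finset.mem_insert, Finset.mem_singleton]
        omega
      · have := Finset.card_le_three (a := n r - 2) (b := n r - 1) (c := n r + 1)
        omega)
  have q2 := Can.phase_le (d := T.card + Hs.card) hL q1 {s p 1} (b' := 1)
    (by simp) (by
      intro x hx
      rw [Finset.mem_singleton] at hx
      subst hx
      refine ⟨hnotp 1 le_rfl (by omega), by simp [hpr], (cost_first (by omega) {0}
        (T.erase p ∪ Hs) (fun b e1 e2 e3 e4 => ?_) (fun i _ h => hfirst i h)).mono ?_, by omega⟩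
      · have : ¬ 1 ≤ b := fun h => hnotpp b h (by omega) e4
        simp only [Finset.mem_singleton]
        omega
      · rw [Finset.card_singleton]
        omega)
  have q3 := Can.phase_le (d := T.card + Hs.card - 1) hL q2 {s p (n p)} (b' := 1)
    (by simp) (by
      intro x hx
      rw [Finset.mem_singleton] at hx
      subst hx
      refine ⟨hnotp _ (by omega) (by omega), by simp [hpr, hnp], (cost_last (by omega) {6}
        ((T.erase p).erase r ∪ Hs) (fun b e1 e2 e3 e4 => ?_) (fun i _ h => hlast i h)).mono ?_, by omega⟩
      · have : ¬ (1 ≤ b ∧ b ≤ 5) := fun h => hnotpp b h.1 h.2 e4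
        simp only [Finset.mem_singleton]
        omega
      · rw [Finset.card_singleton]
        omega)
  have q4 := Can.phase_le (d := 4) hL q3 (R T 1 lo) hQc (by
      intro x hx
      have hcard : 1 ≤ (R T 1 lo).card := Finset.card_pos.2 ⟨x, hx⟩
      obtain ⟨i, j, rfl, e1, e2, e3⟩ := exists_of_mem_R hx
      have f1 := hlo i e1
      have f2 := hTn i e1
      have f3 := hlt i e1
      simp only [Pi.one_apply] at e2
      refine ⟨?_, ?_, cost_four (by omega) (by omega), by omega⟩
      · rw [hmem]
        rintro (h | h | h | h) <;> omega
      · simp only [Finset.empty_union, Finset.mem_union, Finset.mem_singleton, s.injEq, not_or]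
        refine ⟨⟨?_, by omega⟩, ?_⟩
        · rintro ⟨rfl, rfl⟩; omega
        · rintro ⟨rfl, rfl⟩; omega)
  have q5 := Can.phase_le (d := 3) hL q4 (R {r} hi2 (n - 1)) hZc (by
      intro x hx
      obtain ⟨i, j, rfl, e1, e2, e3⟩ := exists_of_mem_R hx
      rw [Finset.mem_singleton] at e1
      subst e1
      have f1 := hlo i hr
      rw [Pi.sub_apply, Pi.one_apply] at e3
      obtain rfl : j = n i - 1 := by omega
      refine ⟨?_, ?_, (cost_inner (by omega) (by omega) {n i + 1, n i - 2, n i - 3}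
        fun b g1 g2 g3 g4 g5 => ?_).mono Finset.card_le_three, by omega⟩
      · rw [hmem]
        rintro (h | h | h | h) <;> omega
      · simp only [Finset.empty_union, Finset.mem_union, Finset.mem_singleton, s.injEq, not_or,
          mem_R, Pi.one_apply]
        exact ⟨⟨⟨by omega, by omega⟩, fun h => hpr h.1.symm⟩, by omega⟩
      · have : b ≠ n i := by
          rintro rfl
          rw [pos_eq_s (by omega) le_rfl] at g5
          exact hnotr g5
        simp only [Finset.mem_insert, Finset.mem_singleton]
        omega)
  have hlop := hlo p hp
  have hB5 : ∀ b, 2 ≤ b → b ≤ 4 →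
      s p b ∉ ∅ ∪ {s r (n r)} ∪ {s p 1} ∪ {s p (n p)} ∪ R T 1 lo ∪ R {r} hi2 (n - 1) := by
    intro b hb hb'
    simp only [Finset.empty_union, Finset.mem_union, Finset.mem_singleton, s.injEq, not_or,
      mem_R, Pi.one_apply]
    exact ⟨⟨⟨⟨fun h => hpr h.1, by omega⟩, by omega⟩, by omega⟩, fun h => hpr h.1⟩
  have q6 := Can.phase_le (d := 1) hL q5 {s p 2, s p 4} Finset.card_le_two (by
      intro x hx
      rw [Finset.mem_insert, Finset.mem_singleton] at hx
      rcases hx with rfl | rfl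
      · refine ⟨hnotp _ (by omega) (by omega), hB5 _ (by omega) (by omega),
          (cost_inner (by omega) (by omega) {0} fun b e1 e2 e3 e4 e5 => ?_), by omega⟩
        have : ¬ (1 ≤ b ∧ b ≤ 5) := fun h => hnotpp b h.1 h.2 e5
        simp only [Finset.mem_singleton]
        omega
      · refine ⟨hnotp _ (by omega) (by omega), hB5 _ (by omega) (by omega),
          (cost_inner (by omega) (by omega) {6} fun b e1 e2 e3 e4 e5 => ?_), by omega⟩
        have : ¬ (1 ≤ b ∧ b ≤ 5) := fun h => hnotpp b h.1 h.2 e5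
        simp only [Finset.mem_singleton]
        omega)
  have q7 := Can.phase_le (d := 0) hL q6 {s p 3} (b' := 1) (by simp) (by
      intro x hx
      rw [Finset.mem_singleton] at hx
      subst hx
      refine ⟨hnotp _ (by omega) (by omega), ?_,
          (cost_inner (by omega) (by omega) ∅ fun b e1 e2 e3 e4 e5 => ?_), by omega⟩
      · rw [Finset.mem_union, not_or]
        exact ⟨hB5 _ (by omega) (by omega), by simp⟩
      · exact absurd e5 (hnotpp b (by omega) (by omega)))
  have q8 := q7.1.close
  convert q8 using 1
  ext x
  cases x with
  | u => simp [verts, hA]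
  | w => simp [verts, hA]
  | s i j =>
    rw [Finset.mem_union, hmem]
    simp only [verts, Finset.mem_union, Finset.mem_insert, Finset.mem_singleton, mem_R, Pi.zero_apply,
      Pi.one_apply, Pi.sub_apply, reduceCtorEq, false_or, Finset.notMem_empty, s.injEq,
      Finset.mem_erase]
    by_cases hi : i ∈ T
    · have := hTn i hi
      have := hlo i hi
      have hiH : i ∉ Hs := Finset.disjoint_left.1 hTH hi
      simp only [hi, hiH, true_and, false_and, false_or, and_true]
      by_cases hip : i = p
      · subst hip
        simp only [true_and, hpr, false_and, ne_eq, not_true_eq_false, and_false, false_or,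
          or_false]
        omega
      · by_cases hir : i = r
        · subst hir
          simp only [true_and, hip, false_and, ne_eq, not_true_eq_false, or_false, not_false_eq_true,
            false_or]
          omega
        · simp only [hip, hir, false_and, or_false, ne_eq, not_false_eq_true, true_and, and_true,
            false_or, or_false]
          have := h02 i hi hip hir
          omega
    · have hip : i ≠ p := fun h => hi (h ▸ hp)
      have hir : i ≠ r := fun h => hi (h ▸ hr)
      simp only [hi, hip, hir, false_and, and_false, or_false]
      refine and_congr_right fun _ => by omega

end Cases

section Cases

variable {C : Type} {L : Nd → Finset C} {n : ℕ → ℕ} {T Hs : Finset ℕ} {k a : ℕ}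

theorem can_of_triples_aux [Nonempty C] (hL : ∀ x, (L x).card = k)
    (hn : ∀ i, i ∉ Hs → 3 ≤ n i) (hn35 : ∀ i ∈ T, n i = 3 ∨ n i = 5) (hH : ∀ i ∈ Hs, n i = 1)
    (hTH : Disjoint T Hs) (hHs : Hs.card ≤ 1) (hka : T.card + Hs.card + a + 1 = k) (ha : 1 ≤ a)
    {d β p q r t : ℕ} (hd : d = 0 ∧ k = 6 ∨ d = 1 ∧ 7 ≤ k)
    (hp : p ∈ T) (hq : q ∈ T) (hr : r ∈ T) (ht : t ∈ T) (hpq : p ≠ q) (hpr : p ≠ r) (hpt : p ≠ t)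
    (hqr : q ≠ r) (hqt : q ≠ t) (hnp : n p = 5) (hnq : n q = 5)
    (hβ : t ≠ r ∧ β = 1 ∨ t = r ∧ d + β = 1) {Fr Fb : Finset ℕ}
    (hF : Fr ∪ Fb ∪ {q} = (T.erase p).erase r) (hrb : Disjoint Fr Fb) (hrq : q ∉ Fr) (hbq : q ∉ Fb)
    (hFr : ∀ i ∈ Fr, Fr.card + 4 ≤ T.card) (hFb : Fb ⊆ {t}) {M : ℕ}
    (hM : 2 + Hs.card + ∑ i ∈ T, n i ≤ (M + 3) * k) :
    Can (ndGraph n) L (verts n T Hs) (M + 3) ∅ ∅ := by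
  have hT3 : 3 ≤ T.card := by
    have : ({p, q, r} : Finset ℕ) ⊆ T := by
      intro i hi
      simp only [Finset.mem_insert, Finset.mem_singleton] at hi
      rcases hi with rfl | rfl | rfl <;> assumption
    have h := Finset.card_le_card this
    rwa [Finset.card_eq_three.2 ⟨p, q, r, hpq, hpr, hqr, rfl⟩] at h
  have hcardE : (T.erase p).card = T.card - 1 := Finset.card_erase_of_mem hp
  have hcardF : ((T.erase p).erase r).card = T.card - 2 := by
    rw [Finset.card_erase_of_mem (Finset.mem_erase.2 ⟨hpr.symm, hr⟩), Finset.card_erase_of_mem hp]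
    omega
  have hcardF' : Fr.card + Fb.card + 1 = T.card - 2 := by
    rw [← hcardF, ← hF, Finset.card_union_of_disjoint, Finset.card_union_of_disjoint hrb,
      Finset.card_singleton]
    simp [hrq, hbq]
  have hFT : Fr ∪ Fb ∪ {q} ⊆ T :=
    hF ▸ ((Finset.erase_subset _ _).trans (Finset.erase_subset _ _))
  set δ : ℕ → ℕ := fun i => (if i = p then 3 else 0) + if i = r then d else 0 with hδ
  set ε : ℕ → ℕ := fun i => (if i = q then 2 else 0) + if i = t then β else 0 with hε
  have hδp : δ p = 3 := by simp [hδ, hpr]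
  have hεp : ε p = 0 := by simp [hε, hpq, hpt]
  have hδq : δ q = 0 := by simp [hδ, hqr, hpq.symm]
  have hεq : ε q = 2 := by simp [hε, hqt]
  have hδr : δ r = d := by simp [hδ, hpr.symm]
  have hδ0 : ∀ i, i ≠ p → i ≠ r → δ i = 0 := fun i h1 h2 => by simp [hδ, h1, h2]
  have hδs : ∑ i ∈ T, δ i = 3 + d := by
    simp [hδ, Finset.sum_add_distrib, Finset.sum_ite_eq', hp, hr]
  have hεs : ∑ i ∈ T, ε i = 2 + β := by
    simp [hε, Finset.sum_add_distrib, Finset.sum_ite_eq', hq, ht]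
  have hle : ∀ i, i ≠ p → i ≠ q → δ i + ε i ≤ 1 ∧
      δ i + ε i ≤ (if i = r then 1 else 0) + if i = t then 1 else 0 := by
    intro i h1 h2
    simp only [hδ, hε, h1, h2, if_false, zero_add]
    split_ifs <;> omega
  have htt : δ t + ε t = 1 := by
    simp only [hδ, hε, hpt.symm, hqt.symm, if_false, zero_add, if_true]
    split_ifs <;> omega
  have hTle : ∀ i ∈ T, δ i + ε i + 2 ≤ n i := by
    intro i hi
    have := hn35 i hi
    by_cases h1 : i = p
    · subst h1; omega
    by_cases h2 : i = q
    · subst h2; omega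
    have := (hle i h1 h2).1
    omega
  have hsum := sum_sub_add_mul (T := T) (f := n) 2 fun i hi => by have := hTle i hi; omega
  have hsum1 : ∑ i ∈ T, (n i - 1 - δ i - 1) + ∑ i ∈ T, δ i = ∑ i ∈ T, (n i - 2) := by
    rw [← Finset.sum_add_distrib]
    exact Finset.sum_congr rfl fun i hi => by have := hTle i hi; omega
  have hshort : short T 1 (fun i => n i - 1 - δ i - ε i) ≤ T.card + 2 := by
    have h1 : short T 1 (fun i => n i - 1 - δ i - ε i) ≤
        ∑ i ∈ T, (1 + ((if i = r then 1 else 0) + if i = t then 1 else 0)) := by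
      refine Finset.sum_le_sum fun i hi => ?_
      have := hn35 i hi
      simp only [Pi.one_apply]
      by_cases h1 : i = p
      · subst h1; rw [if_pos (by omega)]; omega
      by_cases h2 : i = q
      · subst h2; rw [if_pos (by omega)]; omega
      have := hle i h1 h2
      generalize δ i = x at *
      generalize ε i = y at *
      generalize ((if i = r then 1 else 0) + if i = t then 1 else 0) = z at *
      split_ifs <;> omega
    have h2 : ∑ i ∈ T, (1 + ((if i = r then 1 else 0) + if i = t then 1 else 0)) = T.card + 2 := by
      simp [Finset.sum_add_distrib, Finset.sum_ite_eq', hr, ht]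
    omega
  have hfilter : (T.filter fun i => n i - 1 - δ i - ε i + 1 = n i).card + 3 ≤ T.card := by
    have : T.filter (fun i => n i - 1 - δ i - ε i + 1 = n i) ⊆ T \ {p, q, t} := by
      intro i hi
      rw [Finset.mem_filter] at hi
      rw [Finset.mem_sdiff]
      refine ⟨hi.1, fun h => ?_⟩
      have := hTle i hi.1
      simp only [Finset.mem_insert, Finset.mem_singleton] at h
      rcases h with rfl | rfl | rfl <;> omega
    have h1 := Finset.card_le_card this
    have h2 : ({p, q, t} : Finset ℕ) ⊆ T := by
      intro i hi
      simp only [Finset.mem_insert, Finset.mem_singleton] at hi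
      rcases hi with rfl | rfl | rfl <;> assumption
    rw [Finset.card_sdiff_of_subset h2, Finset.card_eq_three.2 ⟨p, q, t, hpq, hpt, hqt, rfl⟩] at h1
    omega
  have hFbc : Fb.card ≤ 1 := (Finset.card_le_card hFb).trans (by simp)
  obtain ⟨lo, h1, h2, h3⟩ := can_ends (L := L) (n := n) (T := T) (Hs := Hs) (k := k) (by omega) hL hn hH
    hTH (TE := T.erase p) (Fr := Fr) (Fb := Fb) (Fa := {q}) (Finset.erase_subset _ _)
    (fun i hi => hFT (by simp [hi])) (fun i hi => hFT (by simp [hi])) (by simpa) hrb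
    (by simpa) (by simpa) (hi := fun i => n i - 1 - δ i - ε i)
    (hi2 := fun i => n i - 1 - δ i)
    (fun i hi => by have := hTle i hi; omega)
    (fun i hi => by rw [Finset.mem_singleton.1 (hFb hi)]; have := hTle t ht; omega)
    (fun i hi => by rw [Finset.mem_singleton.1 hi]; omega)
    (qQ := k - 6 - d) (aX := a + Hs.card + 1) (q := M) (cap := a + 2)
    (by rw [add_mul] at hM; omega)
    (by
      refine le_trans (Finset.sum_le_sum (g := ε) fun i hi => ?_) (hεs.le.trans (by omega))
      omega)
    (by omega) (by omega) (by omega) (by omega) (by omega)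
    (fun i hi => by have := hFr i hi; omega)
    (fun _ _ => by omega)
    (fun _ _ => by rw [Finset.card_singleton]; omega)
  rw [hF] at h3
  refine h3.last_triple hL hn hTH hka ha hd hp hr hpr hnp (fun i hi => ?_) (by omega)
    (by have := hTle r hr; omega) (fun i _ e1 e2 => by rw [hδ0 i e1 e2]; omega) h2
  have := h1 i hi
  omega

theorem can_of_triples [Nonempty C] (hk : 6 ≤ k) (hL : ∀ x, (L x).card = k)
    (hn : ∀ i, i ∉ Hs → 3 ≤ n i) (hn35 : ∀ i ∈ T, n i = 3 ∨ n i = 5) (hH : ∀ i ∈ Hs, n i = 1)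
    (hTH : Disjoint T Hs) (hHs : Hs.card ≤ 1) (hka : T.card + Hs.card + a + 1 = k) (ha : 1 ≤ a)
    (ha2 : a ≤ 2) {p q : ℕ} (hp : p ∈ T) (hq : q ∈ T) (hpq : p ≠ q)
    (hnp : n p = 5) (hnq : n q = 5) {M : ℕ}
    (hM : 2 + Hs.card + ∑ i ∈ T, n i ≤ (M + 3) * k) :
    Can (ndGraph n) L (verts n T Hs) (M + 3) ∅ ∅ := by
  have hT2 : 1 < T.card := Finset.one_lt_card.2 ⟨p, hp, q, hq, hpq⟩
  have hcardF : ((T.erase p).erase q).card = T.card - 2 := by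
    rw [Finset.card_erase_of_mem (Finset.mem_erase.2 ⟨hpq.symm, hq⟩), Finset.card_erase_of_mem hp]
    omega
  have hcardE : (T.erase p).card = T.card - 1 := Finset.card_erase_of_mem hp
  by_cases h2 : T.card = 2
  · have hT0 : (T.erase p).erase q = ∅ := by rw [← Finset.card_eq_zero]; omega
    have hTpq : ∀ i ∈ T, i = p ∨ i = q := by
      intro i hi
      by_contra! h
      exact Finset.notMem_empty i (hT0 ▸ Finset.mem_erase.2 ⟨h.2, Finset.mem_erase.2 ⟨h.1, hi⟩⟩)
    have hsumle : ∀ f : ℕ → ℕ, ∑ i ∈ T, f i = f p + f q := by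
      intro f
      have : T = {p, q} := by
        ext i
        rw [Finset.mem_insert, Finset.mem_singleton]
        exact ⟨hTpq i, by rintro (rfl | rfl) <;> assumption⟩
      rw [this, Finset.sum_pair hpq]
    have hval : ∀ i ∈ T, i = p ∧ (if i = p then 1 else 4) = 1 ∧ n i = 5 ∨
        i = q ∧ (if i = p then 1 else 4) = 4 ∧ n i = 5 := by
      intro i hi
      rcases hTpq i hi with rfl | rfl
      · exact Or.inl ⟨rfl, by simp, hnp⟩
      · exact Or.inr ⟨rfl, by simp [hpq.symm], hnq⟩
    obtain ⟨lo, e1, e2, e3⟩ := can_ends (L := L) (n := n) (T := T) (Hs := Hs) (k := k) (by omega) hL hn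
      hH hTH (TE := T.erase p) (Fr := ∅) (Fb := ∅) (Fa := ∅) (Finset.erase_subset _ _)
      (by simp) (by simp) (by simp) (by simp) (by simp) (by simp)
      (hi := fun i => if i = p then 1 else 4) (hi2 := fun i => if i = p then 1 else 4)
      (fun i hi => by rcases hval i hi with h | h <;> omega)
      (by simp) (by simp)
      (qQ := 0) (aX := a + Hs.card + 1) (q := M) (cap := 0)
      (by rw [hsumle]; simp [hpq.symm]; omega)
      (by simp)
      ((short_le_sum _ _ _).trans (by rw [hsumle]; simp [hpq.symm]; omega))
      (by omega) (by omega) (by omega)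
      (by
        have := Finset.card_filter_le T (fun i => (if i = p then 1 else 4) + 1 = n i)
        omega)
      (by simp) (by simp) (by simp)
    refine Can.last_triple (d := 0) hL hn hTH hka ha (Or.inl ⟨rfl, by omega⟩) hp hq hpq hnp e1 (by simp)
      (by simp [hpq.symm, hnq]) (fun i hi f1 f2 => ?_) (e2.trans (by omega)) (hT0 ▸ e3)
    · rcases hval i hi with h | h <;> omega
  · obtain ⟨r, hr⟩ : ((T.erase p).erase q).Nonempty := by
      rw [← Finset.card_pos]; omega
    have hcardF3 : (((T.erase p).erase q).erase r).card = T.card - 3 := by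
      rw [Finset.card_erase_of_mem hr]; omega
    have hr' := hr
    simp only [Finset.mem_erase] at hr'
    obtain ⟨hrq, hrp, hrT⟩ := hr'
    have hcomm : ((T.erase p).erase q).erase r = ((T.erase p).erase r).erase q := Finset.erase_right_comm
    obtain ⟨d, hd⟩ : ∃ d, d = 0 ∧ k = 6 ∨ d = 1 ∧ 7 ≤ k := by
      rcases (by omega : k = 6 ∨ 7 ≤ k) with h | h
      · exact ⟨0, Or.inl ⟨rfl, h⟩⟩
      · exact ⟨1, Or.inr ⟨rfl, h⟩⟩
    have hqF : q ∈ (T.erase p).erase r :=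
      Finset.mem_erase.2 ⟨hrq.symm, Finset.mem_erase.2 ⟨hpq.symm, hq⟩⟩
    by_cases h3 : T.card = 3
    · have h0 : ((T.erase p).erase r).erase q = ∅ := by
        rw [← hcomm, ← Finset.card_eq_zero]; omega
      refine can_of_triples_aux hL hn hn35 hH hTH hHs hka ha hd hp hq hrT hrT hpq hrp.symm hrp.symm
        hrq.symm hrq.symm hnp hnq (β := 1 - d) (Or.inr ⟨rfl, by omega⟩) (Fr := ∅) (Fb := ∅) ?_ (by simp)
        (by simp) (by simp) (by simp) (by simp) hM
      rw [← Finset.insert_erase hqF, h0]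
      simp
    · obtain ⟨t, ht⟩ : (((T.erase p).erase q).erase r).Nonempty := by
        rw [← Finset.card_pos]; omega
      have hcardF4 : ((((T.erase p).erase q).erase r).erase t).card = T.card - 4 := by
        rw [Finset.card_erase_of_mem ht]; omega
      have ht' := ht
      simp only [Finset.mem_erase] at ht'
      obtain ⟨htr, htq, htp, htT⟩ := ht'
      refine can_of_triples_aux hL hn hn35 hH hTH hHs hka ha hd hp hq hrT htT hpq hrp.symm htp.symm
        hrq.symm htq.symm hnp hnq (β := 1) (Or.inl ⟨htr, rfl⟩)
        (Fr := (((T.erase p).erase q).erase r).erase t) (Fb := {t}) ?_ (by simp)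
        (by simp) (by simpa using htq.symm) (fun i hi => ?_) (by simp) hM
      · rw [Finset.union_comm _ {t}, ← Finset.insert_eq, Finset.insert_erase ht, hcomm,
          Finset.union_comm, ← Finset.insert_eq, Finset.insert_erase hqF]
      · have := Finset.card_pos.2 ⟨i, hi⟩
        omega

end Cases

section Cases

variable {C : Type} {L : Nd → Finset C} {n : ℕ → ℕ} {T Hs : Finset ℕ} {k a : ℕ}

theorem mem_verts_s {i j : ℕ} :
    s i j ∈ verts n T Hs ↔ (i ∈ Hs ∧ j = 1) ∨ (i ∈ T ∧ 1 ≤ j ∧ j ≤ n i) := by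
  simp only [verts, Finset.mem_union, Finset.mem_insert, Finset.mem_singleton, mem_R, Pi.zero_apply,
    Pi.one_apply, reduceCtorEq, false_or]
  refine or_congr (and_congr_right fun _ => by omega) Iff.rfl

theorem Can.add_five (hL : ∀ x, (L x).card = 5) {i : ℕ} (hi : i ∉ T)
    (hiH : i ∉ Hs) (hni : n i = 5) (hcard : T.card + Hs.card ≤ 2) {μ : ℕ}
    (hC : Can (ndGraph n) L (verts n T Hs) μ ∅ ∅) :
    Can (ndGraph n) L (verts n (insert i T) Hs) (μ + 1) ∅ ∅ := by
  have hnot : ∀ b, s i b ∉ verts n T Hs := by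
    intro b
    rw [mem_verts_s]
    rintro (h | h)
    · exact hiH h.1
    · exact hi h.1
  have hnotp : ∀ b, 1 ≤ b → b ≤ 5 → pos n i b ∉ verts n T Hs := by
    intro b h1 h2
    rw [pos_eq_s h1 (by omega)]
    exact hnot b
  have hall : ∀ i' j, s i' j ∈ verts n T Hs → i' ∈ T ∪ Hs := by
    intro i' j h
    rw [Finset.mem_union]
    rcases mem_verts_s.1 h with h | h
    · exact Or.inr h.1
    · exact Or.inl h.1
  have hTH := Finset.card_union_le T Hs
  have q1 := Can.phase_le (d := 3) hL (b := 0) ⟨hC, by simp⟩ {s i 1} (b' := 1) (by simp) (by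
    intro x hx
    obtain rfl := Finset.mem_singleton.1 hx
    refine ⟨hnot _, by simp, (cost_first (by omega) {0} (T ∪ Hs) (fun b e1 e2 e3 e4 => ?_)
      (fun i' _ h => hall _ _ h)).mono (by rw [Finset.card_singleton]; omega), by omega⟩
    have : ¬ 1 ≤ b := fun h => hnotp b h (by omega) e4
    rw [Finset.mem_singleton]; omega)
  have q2 := Can.phase_le (d := 3) hL q1 {s i (n i)} (b' := 1) (by simp) (by
    intro x hx
    obtain rfl := Finset.mem_singleton.1 hx
    refine ⟨hnot _, by simp [hni], (cost_last (by omega) {6} (T ∪ Hs) (fun b e1 e2 e3 e4 => ?_)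
      (fun i' _ h => hall _ _ h)).mono (by rw [Finset.card_singleton]; omega), by omega⟩
    have : ¬ (1 ≤ b ∧ b ≤ 5) := fun h => hnotp b h.1 h.2 e4
    rw [Finset.mem_singleton]; omega)
  have q3 := Can.phase_le (d := 1) hL q2 {s i 2, s i 4} (b' := 2) Finset.card_le_two (by
    intro x hx
    rw [Finset.mem_insert, Finset.mem_singleton] at hx
    rcases hx with rfl | rfl
    · refine ⟨hnot _, by simp [hni], (cost_inner (by omega) (by omega) {0}
        fun b e1 e2 e3 e4 e5 => ?_), by omega⟩
      have : ¬ (1 ≤ b ∧ b ≤ 5) := fun h => hnotp b h.1 h.2 e5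
      rw [Finset.mem_singleton]; omega
    · refine ⟨hnot _, by simp [hni], (cost_inner (by omega) (by omega) {6}
        fun b e1 e2 e3 e4 e5 => ?_), by omega⟩
      have : ¬ (1 ≤ b ∧ b ≤ 5) := fun h => hnotp b h.1 h.2 e5
      rw [Finset.mem_singleton]; omega)
  have q4 := Can.phase_le (d := 0) hL q3 {s i 3} (b' := 1) (by simp) (by
    intro x hx
    obtain rfl := Finset.mem_singleton.1 hx
    refine ⟨hnot _, by simp [hni], (cost_inner (by omega) (by omega) ∅
      fun b e1 e2 e3 e4 e5 => ?_), by omega⟩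
    exact absurd e5 (hnotp b (by omega) (by omega)))
  have q5 := q4.1.close
  convert q5 using 1
  ext x
  cases x with
  | u => simp [verts]
  | w => simp [verts]
  | s i' j =>
    rw [Finset.mem_union, mem_verts_s, mem_verts_s]
    simp only [Finset.mem_union, Finset.mem_insert, Finset.mem_singleton, Finset.notMem_empty, s.injEq,
      false_or]
    by_cases h : i' = i
    · subst h
      simp only [hi, hiH, true_or, true_and, false_and, false_or]
      omega
    · simp [h]

theorem card_verts_le : (verts n T Hs).card ≤ 2 + Hs.card + ∑ i ∈ T, n i := by
  have h1 := Finset.card_union_le ({u, w} ∪ R Hs 0 1) (R T 0 n)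
  have h2 := Finset.card_union_le ({u, w} : Finset Nd) (R Hs 0 1)
  have h3 := Finset.card_le_two (a := u) (b := w)
  have h4 : (R Hs 0 1).card = Hs.card := by simp [card_R]
  have h5 : (R T 0 n).card = ∑ i ∈ T, n i := by simp [card_R]
  rw [verts]
  omega

theorem can_of_card_le [Nonempty C] (hL : ∀ x, (L x).card = k)
    (h : 2 + Hs.card + ∑ i ∈ T, n i ≤ k) : Can (ndGraph n) L (verts n T Hs) 1 ∅ ∅ := by
  have p1 := (can_empty (H := ndGraph n) (L := L)).phase (k := k) (d := 0) (verts n T Hs) (by simp)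
    (fun x _ => (hL x).ge) (fun x _ => ⟨∅, by simp, by simp⟩) (fun x _ => by
      have := card_verts_le (n := n) (T := T) (Hs := Hs)
      simp only [Finset.card_empty]
      omega)
  simpa using p1.close

theorem sum_three_five (hn35 : ∀ i ∈ T, n i = 3 ∨ n i = 5) :
    ∑ i ∈ T, n i = 3 * (T.filter fun i => n i = 3).card + 5 * (T.filter fun i => n i = 5).card ∧
      T.card = (T.filter fun i => n i = 3).card + (T.filter fun i => n i = 5).card := by
  have h : (T.filter fun i => n i = 5) = T.filter fun i => ¬ n i = 3 :=
    Finset.filter_congr fun i hi => by have := hn35 i hi; omega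
  constructor
  · rw [← Finset.sum_filter_add_sum_filter_not T (fun i => n i = 3), ← h,
      Finset.sum_congr rfl (fun i hi => (Finset.mem_filter.1 hi).2),
      Finset.sum_congr (s₁ := T.filter fun i => n i = 5) rfl (fun i hi => (Finset.mem_filter.1 hi).2)]
    simp [mul_comm]
  · rw [h, Finset.card_filter_add_card_filter_not]

theorem can_of_triples_five [Nonempty C] (hL : ∀ x, (L x).card = 5)
    (hn35 : ∀ i ∈ T, n i = 3 ∨ n i = 5)
    (hTH : Disjoint T Hs) (hcard : T.card + Hs.card ≤ 3)
    (ht : 2 ≤ (T.filter fun i => n i = 5).card) {M : ℕ}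
    (hM : 2 + Hs.card + ∑ i ∈ T, n i ≤ M * 5) :
    Can (ndGraph n) L (verts n T Hs) M ∅ ∅ := by
  obtain ⟨h1, h2⟩ := sum_three_five hn35
  have key : ∀ Tr ⊆ T.filter (fun i => n i = 5),
      Can (ndGraph n) L (verts n (T.filter (fun i => n i = 3) ∪ Tr) Hs) (1 + Tr.card) ∅ ∅ := by
    intro Tr
    induction Tr using Finset.induction_on with
    | empty =>
      intro _
      rw [Finset.union_empty]
      refine can_of_card_le hL ?_
      rw [Finset.sum_congr rfl (fun i hi => (Finset.mem_filter.1 hi).2)]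
      simp only [Finset.sum_const, smul_eq_mul]
      omega
    | insert i Tr hi ih =>
      intro hsub
      have h3 := ih ((Finset.subset_insert _ _).trans hsub)
      have h4 := Finset.mem_filter.1 (hsub (Finset.mem_insert_self i Tr))
      rw [Finset.union_insert, Finset.card_insert_of_notMem hi]
      refine h3.add_five hL ?_ (Finset.disjoint_left.1 hTH h4.1) h4.2 ?_
      · rw [Finset.mem_union, Finset.mem_filter]
        rintro (h | h)
        · omega
        · exact hi h
      · have h5 := Finset.card_le_card hsub
        rw [Finset.card_insert_of_notMem hi] at h5
        have := Finset.card_union_le (T.filter fun i => n i = 3) Tr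
        omega
  have h3 := key _ subset_rfl
  have h4 : T.filter (fun i => n i = 3) ∪ T.filter (fun i => n i = 5) = T := by
    ext i
    simp only [Finset.mem_union, Finset.mem_filter]
    constructor
    · rintro (h | h) <;> exact h.1
    · intro h
      rcases hn35 i h with h' | h'
      · exact Or.inl ⟨h, h'⟩
      · exact Or.inr ⟨h, h'⟩
  rw [h4] at h3
  exact h3.mono (by omega)

/-- Two colours can be chosen so that they hit a small list at most once. -/
theorem exists_pair {A B F : Finset C} (hA : A.Nonempty) (hB : B.Nonempty)
    (h : F.card < A.card + B.card) :
    ∃ α ∈ A, ∃ β ∈ B, F.card ≤ (F \ {α, β}).card + 1 := by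
  have hsd : ∀ c, F.card ≤ (F \ {c}).card + 1 := by
    intro c
    have := Finset.le_card_sdiff {c} F
    rw [Finset.card_singleton] at this
    omega
  by_cases hd : Disjoint A B
  · have : ¬ (A ∪ B ⊆ F) := fun hs => by
      have := Finset.card_le_card hs
      rw [Finset.card_union_of_disjoint hd] at this
      omega
    rw [Finset.not_subset] at this
    obtain ⟨c, hc, hcF⟩ := this
    rcases Finset.mem_union.1 hc with hcA | hcB
    · obtain ⟨β, hβ⟩ := hB
      refine ⟨c, hcA, β, hβ, ?_⟩
      rw [show F \ {c, β} = F \ {β} from ?_]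
      · exact hsd β
      · ext x
        simp only [Finset.mem_sdiff, Finset.mem_insert, Finset.mem_singleton, not_or]
        refine and_congr_right fun hx => and_iff_right ?_
        rintro rfl; exact hcF hx
    · obtain ⟨α, hα⟩ := hA
      refine ⟨α, hα, c, hcB, ?_⟩
      rw [show F \ {α, c} = F \ {α} from ?_]
      · exact hsd α
      · ext x
        simp only [Finset.mem_sdiff, Finset.mem_insert, Finset.mem_singleton, not_or]
        refine and_congr_right fun hx => and_iff_left ?_
        rintro rfl; exact hcF hx
  · rw [Finset.not_disjoint_iff] at hd
    obtain ⟨c, hcA, hcB⟩ := hd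
    refine ⟨c, hcA, c, hcB, ?_⟩
    rw [Finset.pair_eq_singleton]
    exact hsd c

theorem not_adj_w {i j : ℕ} (h1 : j + 1 ≠ n i) (h2 : j ≠ n i) : ¬ (ndGraph n).Adj w (s i j) := by
  intro h
  obtain ⟨i', b, ⟨e1, e2⟩ | ⟨e1, e2⟩⟩ := ndGraph_adj_w h
  · obtain ⟨rfl, rfl, -, -⟩ := pos_eq_s_iff.1 e2.symm
    exact h1 e1
  · obtain ⟨rfl, rfl, -, -⟩ := pos_eq_s_iff.1 e2.symm
    exact h2 e1

theorem not_adj_s {i j i' j' : ℕ} (h1 : i ≠ i') (h2 : ¬ (j = 1 ∧ j' = 1))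
    (h3 : ¬ (j = n i ∧ j' = n i')) : ¬ (ndGraph n).Adj (s i j) (s i' j') := by
  intro h
  rcases ndGraph_adj_s h with ⟨b, e1, e2, e3, e4, e5⟩ | ⟨e1, i'', e2, e3⟩ | ⟨e1, i'', e2, e3⟩
  · exact h1 (pos_eq_s_iff.1 e5.symm).1
  · rw [s.injEq] at e3
    exact h2 ⟨e1, e3.2⟩
  · rw [s.injEq] at e3
    obtain ⟨rfl, e3⟩ := e3
    exact h3 ⟨e1, e3⟩

end Cases

section Cases

variable {C : Type} {L : Nd → Finset C} {n : ℕ → ℕ} {T Hs : Finset ℕ} {k a : ℕ}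

/-- Lists of size `k`, except that `w` and the first element of the path `q` are (possibly)
precoloured, at the cost of at most one colour of the last element of that path. -/
structure SavingLists (L : Nd → Finset C) (k q : ℕ) : Prop where
  card : ∀ x, x ≠ w → x ≠ s q 1 → x ≠ s q 3 → k ≤ (L x).card
  card_w : 1 ≤ (L w).card
  card_first : 1 ≤ (L (s q 1)).card
  card_last : k ≤ (L (s q 3)).card + 1
  disj_w : Disjoint (L (s q 3)) (L w)
  disj_first : Disjoint (L (s q 3)) (L (s q 1))

theorem exists_savingLists (hk : 1 ≤ k) (hL : ∀ x, (L x).card = k) (q : ℕ) :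
    ∃ L' : Nd → Finset C, (∀ x, L' x ⊆ L x) ∧ SavingLists L' k q := by
  have hne : ∀ x, (L x).Nonempty := fun x => Finset.card_pos.1 (by rw [hL x]; omega)
  obtain ⟨α, hα, β, hβ, h⟩ := exists_pair (F := L (s q 3)) (hne w) (hne (s q 1))
    (by rw [hL, hL, hL]; omega)
  refine ⟨fun x => if x = w then {α} else if x = s q 1 then {β} else
    if x = s q 3 then L x \ {α, β} else L x, fun x => ?_, ?_, ?_, ?_, ?_, ?_, ?_⟩
  · dsimp only
    split_ifs with h1 h2 h3
    · subst h1; simpa using hα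
    · subst h2; simpa using hβ
    · exact Finset.sdiff_subset
    · rfl
  · intro x h1 h2 h3
    rw [if_neg h1, if_neg h2, if_neg h3, hL]
  · simp
  · simp
  · simpa [hL] using h
  · simp
  · simp

theorem can_start [Nonempty C] {q : ℕ} (hL : SavingLists L k q) (hT : ∀ i ∈ T, 3 ≤ n i) (hq : q ∈ T)
    (hq3 : n q = 3) {X : Finset Nd} (hX : ∀ x ∈ X, ∃ i ∈ T, ∃ j, x = s i j ∧ 2 ≤ j ∧ j < n i)
    (h1 : 1 + X.card + T.card ≤ k) (h2 : X.card + 3 ≤ k) :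
    Can (ndGraph n) L ({u} ∪ R T 0 1 ∪ X) 1 {w} ∅ := by
  have p1 := (can_empty (H := ndGraph n) (L := L)).step w (by simp) ∅ (by simp) (by simp)
    (by rw [Finset.card_empty]; exact hL.card_w)
  have p2 := p1.swap.step (s q 1) (by simp) ∅ (by
      intro y hy hadj
      simp only [Finset.empty_union, Finset.mem_insert, Finset.notMem_empty, or_false] at hy
      subst hy
      exact absurd hadj.symm (not_adj_w (by omega) (by omega))) (by simp)
    (by rw [Finset.card_empty]; exact hL.card_first)
  have hXn : ∀ i, s i 1 ∉ X := by
    intro i hi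
    obtain ⟨i', -, j, e, e1, -⟩ := hX _ hi
    rw [s.injEq] at e
    omega
  have hXq : s q 3 ∉ X := by
    intro hi
    obtain ⟨i', -, j, e, e1, e2⟩ := hX _ hi
    rw [s.injEq] at e
    obtain ⟨rfl, rfl⟩ := e
    omega
  have hXu : u ∉ X := by
    intro hi
    obtain ⟨i', -, j, e, -⟩ := hX _ hi
    cases e
  have hXw : w ∉ X := by
    intro hi
    obtain ⟨i', -, j, e, -⟩ := hX _ hi
    cases e
  have hRc : (R (T.erase q) 0 1).card = T.card - 1 := by simp [card_R, Finset.card_erase_of_mem hq]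
  have hT1 := Finset.card_pos.2 ⟨q, hq⟩
  have p3 := p2.phase (k := k) (d := 1) (insert u X) (by
      rw [Finset.disjoint_insert_left]
      refine ⟨by simp, ?_⟩
      simpa using ⟨hXw, hXn q⟩)
    (by
      intro x hx
      rw [Finset.mem_insert] at hx
      refine hL.card x ?_ ?_ ?_ <;> rintro rfl <;> simp_all)
    (fun x _ => ⟨{w}, by simp, by simp⟩)
    (by
      intro x _
      have := Finset.card_insert_le u X
      simp only [insert_empty_eq, Finset.card_singleton]
      omega)
  have p4 := p3.phase (k := k) (d := 0) (R (T.erase q) 0 1) (by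
      rw [Finset.disjoint_left]
      intro x hx
      obtain ⟨i, j, rfl, e1, e2, e3⟩ := exists_of_mem_R hx
      rw [Pi.zero_apply] at e2
      rw [Pi.one_apply] at e3
      obtain rfl : j = 1 := by omega
      have := Finset.ne_of_mem_erase e1
      simp [this, hXn])
    (by
      intro x hx
      obtain ⟨i, j, rfl, e1, e2, e3⟩ := exists_of_mem_R hx
      have := Finset.ne_of_mem_erase e1
      exact hL.card _ (by simp) (by simp [this]) (by simp [this]))
    (by
      intro x hx
      obtain ⟨i, j, rfl, e1, e2, e3⟩ := exists_of_mem_R hx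
      rw [Pi.one_apply] at e3
      have := hT i (Finset.mem_of_mem_erase e1)
      refine ⟨∅, by simp, fun y hy hadj => ?_⟩
      simp only [Finset.empty_union, Finset.mem_insert, Finset.notMem_empty, or_false] at hy
      subst hy
      exact absurd hadj.symm (not_adj_w (by omega) (by omega)))
    (by
      intro x _
      have h5 := Finset.card_insert_le u X
      have h6 := Finset.card_union_le (insert (s q 1) ∅) (insert u X)
      simp only [insert_empty_eq, Finset.card_singleton] at h6 ⊢
      omega)
  have p5 := p4.close
  convert p5 using 1
  · ext x
    cases x with
    | u => simp
    | w => simp [hXw]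
    | s i j =>
      simp only [Finset.mem_union, mem_R, Finset.mem_singleton, Finset.mem_insert, s.injEq, reduceCtorEq,
        Finset.notMem_empty, Pi.zero_apply, Pi.one_apply, false_or, or_false, Finset.mem_erase]
      by_cases hiq : i = q
      · subst hiq
        simp only [hq, true_and, ne_eq, not_true_eq_false, false_and, or_false]
        refine or_congr_left ?_
        omega
      · simp only [hiq, ne_eq, not_false_eq_true, true_and, false_and, false_or]
        tauto
  · rfl

theorem Can.finish {q : ℕ} {μ : ℕ} (hL : SavingLists L k q) (hT : ∀ i ∈ T, 3 ≤ n i)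
    (hH : ∀ i ∈ Hs, n i = 1) (hTH : Disjoint T Hs) (hka : T.card + Hs.card + a + 1 = k)
    (ha : 1 ≤ a) (hT2 : 2 ≤ T.card)
    (hq : q ∈ T) (hq3 : n q = 3) {Y : Finset ℕ} (hY : Y ⊆ T) (hY3 : ∀ i ∈ Y, n i = 3)
    (hYa : Y.card + 1 ≤ a ∨ Y.card ≤ a ∧ q ∈ Y ∧ ∃ r ∈ Y, r ≠ q)
    (hC : Can (ndGraph n) L ({u} ∪ R T 0 1 ∪ R (T \ Y) 1 (n - 1)) μ {w} ∅) :
    Can (ndGraph n) L (verts n T Hs) (μ + 1) ∅ ∅ := by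
  have p0 := hC.swap
  set A := ({u} ∪ R T 0 1 ∪ R (T \ Y) 1 (n - 1) : Finset Nd) with hA
  have hw : w ∉ A := by simp [hA]
  have hs : ∀ i j, s i j ∈ A ↔ i ∈ T ∧ (j = 1 ∨ i ∉ Y ∧ 1 < j ∧ j ≤ n i - 1) := by
    intro i j
    simp only [hA, Finset.mem_union, Finset.mem_singleton, mem_R, Pi.zero_apply, Pi.one_apply,
      Pi.sub_apply, Finset.mem_sdiff, reduceCtorEq, false_or]
    constructor
    · rintro (h | h)
      · exact ⟨h.1, by omega⟩
      · exact ⟨h.1.1, Or.inr ⟨h.1.2, h.2⟩⟩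
    · rintro ⟨h1, h | h⟩
      · exact Or.inl ⟨h1, by omega⟩
      · exact Or.inr ⟨⟨h1, h.1⟩, h.2⟩
  have hlast : ∀ i, s i (n i) ∉ A := by
    intro i hmem
    obtain ⟨h1, h2⟩ := (hs _ _).1 hmem
    have := hT i h1
    omega
  have hTH' : ∀ i ∈ T, i ∉ Hs := fun i hi => Finset.disjoint_left.1 hTH hi
  have hsub : ∀ x, x ≠ w → x ≠ s q 1 → x ≠ s q 3 → k ≤ (L x).card := hL.card
  have hc1 : ∀ S : Finset ℕ, (R S 0 1).card = S.card := fun S => by simp [card_R]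
  have hc2 : ∀ S : Finset ℕ, (R S 1 2).card = S.card := fun S => by simp [card_R]
  have hcF : ∀ S : Finset ℕ, (R S (n - 1) n).card ≤ S.card := fun S =>
    (card_R_le (d := 1) fun i _ => by simp only [Pi.sub_apply, Pi.one_apply]; omega).trans (by simp)
  have p1 := p0.phase (k := k) (d := T.card + 1) (R Hs 0 1) (by
      rw [Finset.disjoint_left]
      intro x hx
      obtain ⟨i, j, rfl, e1, e2, e3⟩ := exists_of_mem_R hx
      simp only [Finset.mem_union, Finset.notMem_empty, or_false, Finset.mem_singleton, reduceCtorEq, hs]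
      exact fun h => hTH' i h.1 e1)
    (by
      intro x hx
      obtain ⟨i, j, rfl, e1, e2, e3⟩ := exists_of_mem_R hx
      have : i ≠ q := by rintro rfl; exact hTH' _ hq e1
      exact hsub _ (by simp) (by simp [this]) (by simp [this]))
    (by
      intro x hx
      obtain ⟨i, j, rfl, e1, e2, e3⟩ := exists_of_mem_R hx
      simp only [Pi.zero_apply, Pi.one_apply] at e2 e3
      obtain rfl : j = 1 := by omega
      refine ⟨insert u (R T 0 1), (Finset.card_insert_le _ _).trans (by rw [hc1]), fun y hy hadj => ?_⟩
      rw [Finset.union_empty] at hy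
      rcases ndGraph_adj_s hadj with ⟨b, f1, f2, f3, f4, rfl⟩ | ⟨-, i', f1, rfl⟩ | ⟨-, i', f1, rfl⟩
      · rw [hH i e1] at f4
        rcases (by omega : b = 0 ∨ b = 2) with rfl | rfl
        · simp
        · rw [pos_eq_w (by rw [hH i e1]; omega)] at hy
          exact absurd hy hw
      · rw [Finset.mem_insert, mem_R]
        exact Or.inr ⟨((hs _ _).1 hy).1, by simp⟩
      · exact absurd hy (hlast i'))
    (by
      intro x _
      rw [hc1, Finset.card_singleton]
      omega)
  have p2 := p1.phase (k := k) (d := 2) (R Y 1 2) (by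
      rw [Finset.disjoint_left]
      intro x hx
      obtain ⟨i, j, rfl, e1, e2, e3⟩ := exists_of_mem_R hx
      rw [Pi.one_apply] at e2
      simp only [Finset.mem_union, Finset.notMem_empty, or_false, Finset.mem_singleton, reduceCtorEq, hs,
        mem_R, false_or, Pi.one_apply]
      rintro (h | h)
      · rcases h.2 with h2 | h2
        · omega
        · exact h2.1 e1
      · exact hTH' i (hY e1) h.1)
    (by
      intro x hx
      obtain ⟨i, j, rfl, e1, e2, e3⟩ := exists_of_mem_R hx
      rw [Pi.one_apply] at e2
      rw [Pi.ofNat_apply] at e3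
      exact hsub _ (by simp) (by simp; omega) (by simp; omega))
    (by
      intro x hx
      obtain ⟨i, j, rfl, e1, e2, e3⟩ := exists_of_mem_R hx
      rw [Pi.one_apply] at e2
      rw [Pi.ofNat_apply] at e3
      have h3 := hY3 i e1
      rw [Finset.union_empty]
      refine cost_left (by omega) (by omega) fun b f1 f2 f3 => ?_
      rcases le_or_gt b 3 with f4 | f4
      · rw [pos_eq_s (by omega) (by omega)] at f3
        obtain rfl : b = n i := by omega
        exact hlast i f3
      · rw [pos_eq_w (by omega)] at f3
        exact hw f3)
    (by
      intro x _
      have := Finset.card_union_le {w} (R Hs 0 1)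
      rw [hc1, Finset.card_singleton] at this
      rw [hc2]
      omega)
  have hB2 : ({w} ∪ R Hs 0 1 ∪ R Y 1 2).card ≤ 1 + Hs.card + Y.card := by
    have h1 := Finset.card_union_le {w} (R Hs 0 1)
    have h2 := Finset.card_union_le ({w} ∪ R Hs 0 1) (R Y 1 2)
    rw [hc1, Finset.card_singleton] at h1
    rw [hc2] at h2
    omega
  have hB2l : ∀ i ∈ T, s i (n i) ∉ {w} ∪ R Hs 0 1 ∪ R Y 1 2 := by
    intro i hi
    have := hT i hi
    simp only [Finset.mem_union, Finset.mem_singleton, reduceCtorEq, mem_R, false_or, Pi.ofNat_apply]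
    rintro (h | h)
    · exact hTH' i hi h.1
    · omega
  have hcost : ∀ i ∈ T, Cost (ndGraph n) (A ∪ ∅) (s i (n i)) 2 := by
    intro i hi
    have := hT i hi
    rw [Finset.union_empty]
    refine (cost_last (by omega) {n i - 2, n i - 1} ∅ (fun b f1 f2 f3 f4 => ?_)
      (fun i' _ h => absurd h (hlast i'))).mono (by simpa using Finset.card_le_two)
    rcases le_or_gt b (n i) with f5 | f5
    · simp only [Finset.mem_insert, Finset.mem_singleton]; omega
    · rw [pos_eq_w f5] at f4
      exact absurd f4 hw
  have hcostY : ∀ i ∈ Y, Cost (ndGraph n) (A ∪ ∅) (s i (n i)) 1 := by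
    intro i hi
    have := hY3 i hi
    rw [Finset.union_empty]
    refine (cost_last (by omega) {1} ∅ (fun b f1 f2 f3 f4 => ?_)
      (fun i' _ h => absurd h (hlast i'))).mono (by simp)
    rcases le_or_gt b (n i) with f5 | f5
    · rw [pos_eq_s (by omega) f5] at f4
      rcases ((hs _ _).1 f4).2 with h | h
      · simp [h]
      · exact absurd hi h.1
    · rw [pos_eq_w f5] at f4
      exact absurd f4 hw
  have hq1 : (T.erase q).card = T.card - 1 := Finset.card_erase_of_mem hq
  -- all last elements except the one with the saving
  have p3 : Can (ndGraph n) L A μ ∅ ({w} ∪ R Hs 0 1 ∪ R Y 1 2 ∪ R (T.erase q) (n - 1) n) := by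
    have hFs : ∀ S ⊆ T.erase q, ∀ x ∈ R S (n - 1) n, ∃ i ∈ S, i ∈ T ∧ i ≠ q ∧ x = s i (n i) := by
      intro S hS x hx
      obtain ⟨i, j, rfl, e1, e2, e3⟩ := exists_of_mem_R hx
      have h5 := Finset.mem_erase.1 (hS e1)
      have := hT i h5.2
      rw [Pi.sub_apply, Pi.one_apply] at e2
      exact ⟨i, e1, h5.2, h5.1, by congr 1; omega⟩
    have hFL : ∀ S ⊆ T.erase q, ∀ x ∈ R S (n - 1) n, k ≤ (L x).card := by
      intro S hS x hx
      obtain ⟨i, -, -, h6, rfl⟩ := hFs S hS x hx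
      exact hsub _ (by simp) (by simp [h6]) (by simp [h6])
    have hFd : ∀ S ⊆ T.erase q, Disjoint (R S (n - 1) n) (A ∪ ∅ ∪ ({w} ∪ R Hs 0 1 ∪ R Y 1 2)) := by
      intro S hS
      rw [Finset.disjoint_left]
      intro x hx
      obtain ⟨i, -, h5, -, rfl⟩ := hFs S hS x hx
      rw [Finset.union_empty, Finset.mem_union, not_or]
      exact ⟨hlast i, hB2l i h5⟩
    rcases hYa with hYa | ⟨hYa, -, r, hr, hrq⟩
    · refine p2.phase (k := k) (d := 2) _ (hFd _ subset_rfl) (hFL _ subset_rfl) ?_ ?_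
      · intro x hx
        obtain ⟨i, -, h5, -, rfl⟩ := hFs _ subset_rfl x hx
        exact hcost i h5
      · intro x _
        have := hcF (T.erase q)
        omega
    · have hrT : r ∈ T.erase q := Finset.mem_erase.2 ⟨hrq, hY hr⟩
      have hr1 : ((T.erase q).erase r).card = T.card - 2 := by
        rw [Finset.card_erase_of_mem hrT]; omega
      have p3 := p2.phase (k := k) (d := 2) (R ((T.erase q).erase r) (n - 1) n)
        (hFd _ (Finset.erase_subset _ _)) (hFL _ (Finset.erase_subset _ _)) (by
          intro x hx
          obtain ⟨i, -, h5, -, rfl⟩ := hFs _ (Finset.erase_subset _ _) x hx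
          exact hcost i h5)
        (by
          intro x _
          have := hcF ((T.erase q).erase r)
          omega)
      have hr3 := hY3 r hr
      have p4 := p3.phase (k := k) (d := 1) (R {r} (n - 1) n) (by
          have h5 := hFd {r} (by simpa using hrT)
          rw [Finset.disjoint_union_right] at h5 ⊢
          refine ⟨h5.1, Finset.disjoint_union_right.2 ⟨h5.2, ?_⟩⟩
          rw [Finset.disjoint_left]
          intro x hx hx'
          obtain ⟨i, j, rfl, e1, -⟩ := exists_of_mem_R hx
          exact Finset.ne_of_mem_erase (mem_R.1 hx').1 (Finset.mem_singleton.1 e1))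
        (hFL _ (by simpa using hrT)) (by
          intro x hx
          obtain ⟨i, h6, h5, -, rfl⟩ := hFs {r} (by simpa using hrT) x hx
          rw [Finset.mem_singleton.1 h6]
          exact hcostY r hr)
        (by
          intro x _
          have := hcF ((T.erase q).erase r)
          have := hcF {r}
          have := Finset.card_union_le ({w} ∪ R Hs 0 1 ∪ R Y 1 2) (R ((T.erase q).erase r) (n - 1) n)
          rw [Finset.card_singleton] at *
          omega)
      convert p4 using 1
      rw [Finset.union_assoc _ (R ((T.erase q).erase r) (n - 1) n)]
      congr 1
      ext x
      cases x with
      | u => simp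
      | w => simp
      | s i j =>
        simp only [Finset.mem_union, mem_R, Finset.mem_erase, Finset.mem_singleton]
        by_cases h : i = r
        · subst h; simp [hrq, hY hr]
        · simp [h]
  have hqF : ∀ j, s q j ∉ R (T.erase q) (n - 1) n := fun j h =>
    Finset.notMem_erase q T (mem_R.1 h).1
  have hlq := hlast q
  have hBq := hB2l q hq
  rw [hq3] at hlq hBq
  have p4 := p3.step (s q 3) (by
      rw [Finset.union_empty]
      intro h
      rcases Finset.mem_union.1 h with h | h
      · exact hlq h
      rcases Finset.mem_union.1 h with h | h
      · exact hBq h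
      · exact hqF 3 h)
    (R Hs 0 1 ∪ R Y 1 2 ∪ R (T.erase q) (n - 1) n ∪ R ({q} \ Y) 1 2)
    (by
      intro y hy hadj
      rw [Finset.union_empty] at hy
      rcases ndGraph_adj_s hadj with ⟨b, f1, f2, f3, f4, rfl⟩ | ⟨f1, -⟩ | ⟨-, i', f1, rfl⟩
      · rcases (by omega : b = 1 ∨ b = 2 ∨ b = 4) with rfl | rfl | rfl
        · right
          rw [pos_eq_s (by omega) (by omega)]
          exact hL.disj_first
        · left
          rw [pos_eq_s (by omega) (by omega)] at hy ⊢
          have h6 := ((hs _ _).1 hy).2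
          refine Finset.mem_union_right _ (mem_R.2 ⟨?_, by simp, by simp⟩)
          rw [Finset.mem_sdiff, Finset.mem_singleton]
          exact ⟨rfl, (h6.resolve_left (by omega)).1⟩
        · rw [pos_eq_w (by omega)] at hy
          exact absurd hy hw
      · omega
      · exact absurd hy (hlast i'))
    (by
      intro y hy
      simp only [Finset.mem_union, Finset.mem_singleton] at hy ⊢
      rcases hy with ((rfl | hy) | hy) | hy
      · exact Or.inr hL.disj_w
      · exact Or.inl (Or.inl (Or.inl (Or.inl hy)))
      · exact Or.inl (Or.inl (Or.inl (Or.inr hy)))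
      · exact Or.inl (Or.inl (Or.inr hy)))
    (by
      have g1 := Finset.card_union_le (R Hs 0 1 ∪ R Y 1 2 ∪ R (T.erase q) (n - 1) n) (R ({q} \ Y) 1 2)
      have g2 := Finset.card_union_le (R Hs 0 1 ∪ R Y 1 2) (R (T.erase q) (n - 1) n)
      have g3 := Finset.card_union_le (R Hs 0 1) (R Y 1 2)
      have g4 := hcF (T.erase q)
      have g5 := hL.card_last
      rw [hc1, hc2] at g3
      rw [hc2] at g1
      have g6 : ({q} \ Y).card + Y.card ≤ a := by
        rcases hYa with hYa | ⟨hYa, hqY, -⟩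
        · have := Finset.card_le_card (Finset.sdiff_subset (s := {q}) (t := Y))
          rw [Finset.card_singleton] at this
          omega
        · rw [Finset.sdiff_eq_empty_iff_subset.2 (by simpa using hqY)]
          simpa using hYa
      omega)
  have p5 := p4.close
  convert p5 using 1
  ext x
  cases x with
  | u => simp [verts, hA]
  | w => simp [verts, hA]
  | s i j =>
    rw [mem_verts_s, Finset.mem_union, hs]
    simp only [Finset.mem_union, Finset.mem_insert, Finset.mem_singleton, mem_R, Pi.sub_apply,
      reduceCtorEq, false_or, s.injEq, Finset.mem_erase, Pi.ofNat_apply]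
    by_cases hi : i ∈ T
    · have hiT := hT i hi
      have hiH := hTH' i hi
      by_cases hiY : i ∈ Y
      · have := hY3 i hiY
        by_cases hiq : i = q
        · subst hiq
          simp only [hi, hiH, hiY, true_and, false_and, false_or, not_true_eq_false, or_false, ne_eq]
          omega
        · simp only [hi, hiH, hiY, hiq, true_and, false_and, false_or, not_true_eq_false, or_false, ne_eq,
            not_false_eq_true]
          omega
      · by_cases hiq : i = q
        · subst hiq
          simp only [hi, hiH, hiY, true_and, false_and, false_or, not_false_eq_true, not_true_eq_false,
            or_false, ne_eq]
          omega
        · simp only [hi, hiH, hiY, hiq, true_and, false_and, false_or, ne_eq, not_false_eq_true]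
          omega
    · have hiq : i ≠ q := fun h => hi (h ▸ hq)
      have hiY : i ∉ Y := fun h => hi (hY h)
      simp only [hi, hiq, hiY, false_and, and_false, or_false, false_or]
      refine and_congr_right fun _ => by omega

end Cases

section Cases

variable {C : Type} {L : Nd → Finset C} {n : ℕ → ℕ} {T Hs : Finset ℕ} {k a : ℕ}

theorem can_three_blocks [Nonempty C] {q : ℕ} (hL : SavingLists L k q)
    (hn35 : ∀ i ∈ T, n i = 3 ∨ n i = 5) (hH : ∀ i ∈ Hs, n i = 1)
    (hTH : Disjoint T Hs) (hka : T.card + Hs.card + a + 1 = k) (ha : 1 ≤ a) (hT2 : 2 ≤ T.card)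
    (hm : 3 ≤ T.card + Hs.card)
    (ht : (T.filter fun i => n i = 5).card ≤ 1) (hq : q ∈ T) (hq3 : n q = 3) :
    Can (ndGraph n) L (verts n T Hs) 3 ∅ ∅ := by
  have hT : ∀ i ∈ T, 3 ≤ n i := fun i hi => by have := hn35 i hi; omega
  have p1 := can_start hL hT hq hq3 (X := {s q 2})
    (fun x hx => ⟨q, hq, 2, Finset.mem_singleton.1 hx, le_rfl, by omega⟩)
    (by rw [Finset.card_singleton]; omega) (by rw [Finset.card_singleton]; omega)
  set A := ({u} ∪ R T 0 1 ∪ {s q 2} : Finset Nd) with hA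
  have hs : ∀ i j, s i j ∈ A ↔ i ∈ T ∧ j = 1 ∨ i = q ∧ j = 2 := by
    intro i j
    simp only [hA, Finset.mem_union, Finset.mem_singleton, mem_R, Pi.zero_apply, Pi.one_apply,
      reduceCtorEq, false_or, s.injEq]
    exact or_congr_left (and_congr_right fun _ => by omega)
  obtain ⟨-, hcard⟩ := sum_three_five hn35
  set S := T.filter fun i => n i = 3 with hS
  set F := T.filter fun i => n i = 5 with hF
  have hqS : q ∈ S := Finset.mem_filter.2 ⟨hq, hq3⟩
  have hSm : ∀ i ∈ S.erase q, i ≠ q ∧ i ∈ T ∧ n i = 3 := fun i hi =>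
    ⟨Finset.ne_of_mem_erase hi, Finset.mem_filter.1 (Finset.mem_of_mem_erase hi)⟩
  have hFm : ∀ i ∈ F, i ≠ q ∧ i ∈ T ∧ n i = 5 := fun i hi =>
    ⟨by rintro rfl; have := (Finset.mem_filter.1 hi).2; omega, Finset.mem_filter.1 hi⟩
  have hSF : ∀ i ∈ F, i ∉ S := fun i hi hi' => by
    have := (Finset.mem_filter.1 hi).2
    have := (Finset.mem_filter.1 hi').2
    omega
  have hS1 : (S.erase q).card = S.card - 1 := Finset.card_erase_of_mem hqS
  have hS0 := Finset.card_pos.2 ⟨q, hqS⟩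
  have hc2 : ∀ S : Finset ℕ, (R S 1 2).card = S.card := fun S => by simp [card_R]
  have hc3 : ∀ S : Finset ℕ, (R S 2 3).card = S.card := fun S => by simp [card_R]
  have hc4 : ∀ S : Finset ℕ, (R S 3 4).card = S.card := fun S => by simp [card_R]
  have hLs : ∀ i j, i ≠ q → k ≤ (L (s i j)).card := fun i j h =>
    hL.card _ (by simp) (by simp [h]) (by simp [h])
  have hnotF : ∀ i ∈ F, ∀ b, 2 ≤ b → b ≤ 5 → pos n i b ∉ A ∪ {w} := by
    intro i hi b h1 h2
    obtain ⟨e1, e2, e3⟩ := hFm i hi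
    rw [pos_eq_s (by omega) (by omega), Finset.mem_union, hs]
    simp [e1]
    omega
  have p2 := p1.phase (k := k) (d := 3) (R (S.erase q) 1 2) (by
      rw [Finset.disjoint_left]
      intro x hx
      obtain ⟨i, j, rfl, e1, e2, e3⟩ := exists_of_mem_R hx
      obtain ⟨f1, -, -⟩ := hSm i e1
      rw [Pi.one_apply] at e2
      simp only [Finset.mem_union, hs, Finset.notMem_empty, Finset.mem_singleton, reduceCtorEq, or_false]
      omega)
    (fun x hx => by
      obtain ⟨i, j, rfl, e1, e2, e3⟩ := exists_of_mem_R hx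
      exact hLs i j (hSm i e1).1)
    (fun x hx => by
      obtain ⟨i, j, rfl, e1, e2, e3⟩ := exists_of_mem_R hx
      obtain ⟨f1, f2, f3⟩ := hSm i e1
      rw [Pi.one_apply] at e2
      rw [Pi.ofNat_apply] at e3
      refine (cost_inner (by omega) (by omega) {0, 1, 4} fun b g1 g2 g3 g4 g5 => ?_).mono
        Finset.card_le_three
      have : b ≠ 3 := by
        rintro rfl
        rw [pos_eq_s (by omega) (by omega), Finset.mem_union, hs] at g5
        simp [f1] at g5
      simp only [Finset.mem_insert, Finset.mem_singleton]
      omega)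
    (fun x _ => by
      rw [hc2, Finset.card_empty]
      omega)
  rw [Finset.empty_union] at p2
  have hdisj : ∀ i ∈ F, ∀ j, 1 < j → s i j ∉ A ∪ {w} ∪ R (S.erase q) 1 2 := by
    intro i hi j hj
    obtain ⟨f1, -, -⟩ := hFm i hi
    simp only [Finset.mem_union, hs, Finset.mem_singleton, reduceCtorEq, or_false, mem_R]
    rintro (h | h)
    · omega
    · exact hSF i hi (Finset.mem_of_mem_erase h.1)
  have p3 := p2.phase (k := k) (d := 2) (R F 1 2) (by
      rw [Finset.disjoint_left]
      intro x hx
      obtain ⟨i, j, rfl, e1, e2, e3⟩ := exists_of_mem_R hx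
      exact hdisj i e1 j e2)
    (fun x hx => by
      obtain ⟨i, j, rfl, e1, e2, e3⟩ := exists_of_mem_R hx
      exact hLs i j (hFm i e1).1)
    (fun x hx => by
      obtain ⟨i, j, rfl, e1, e2, e3⟩ := exists_of_mem_R hx
      obtain ⟨f1, f2, f3⟩ := hFm i e1
      rw [Pi.one_apply] at e2
      rw [Pi.ofNat_apply] at e3
      refine (cost_inner (by omega) (by omega) {0, 1} fun b g1 g2 g3 g4 g5 => ?_).mono
        Finset.card_le_two
      have : ¬ (2 ≤ b ∧ b ≤ 5) := fun h => hnotF i e1 b h.1 h.2 g5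
      simp only [Finset.mem_insert, Finset.mem_singleton]
      omega)
    (fun x hx => by
      rw [hc2, hc2]
      omega)
  have p4 := p3.phase (k := k) (d := 1) (R F 2 3) (by
      rw [Finset.disjoint_left]
      intro x hx
      obtain ⟨i, j, rfl, e1, e2, e3⟩ := exists_of_mem_R hx
      rw [Pi.ofNat_apply] at e2
      rw [← Finset.union_assoc, Finset.mem_union, not_or]
      exact ⟨hdisj i e1 j (by omega), by simp; omega⟩)
    (fun x hx => by
      obtain ⟨i, j, rfl, e1, e2, e3⟩ := exists_of_mem_R hx
      exact hLs i j (hFm i e1).1)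
    (fun x hx => by
      obtain ⟨i, j, rfl, e1, e2, e3⟩ := exists_of_mem_R hx
      obtain ⟨f1, f2, f3⟩ := hFm i e1
      rw [Pi.ofNat_apply] at e2 e3
      refine (cost_inner (by omega) (by omega) {1} fun b g1 g2 g3 g4 g5 => ?_)
      have : ¬ (2 ≤ b ∧ b ≤ 5) := fun h => hnotF i e1 b h.1 h.2 g5
      simp only [Finset.mem_singleton]
      omega)
    (fun x hx => by
      have := Finset.card_union_le (R (S.erase q) 1 2) (R F 1 2)
      rw [hc2, hc2] at this
      rw [hc3]
      omega)
  have p5 := p4.phase (k := k) (d := 1) (R F 3 4) (by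
      rw [Finset.disjoint_left]
      intro x hx
      obtain ⟨i, j, rfl, e1, e2, e3⟩ := exists_of_mem_R hx
      rw [Pi.ofNat_apply] at e2
      rw [← Finset.union_assoc, ← Finset.union_assoc, Finset.mem_union, Finset.mem_union, not_or, not_or]
      exact ⟨⟨hdisj i e1 j (by omega), by simp; omega⟩, by simp; omega⟩)
    (fun x hx => by
      obtain ⟨i, j, rfl, e1, e2, e3⟩ := exists_of_mem_R hx
      exact hLs i j (hFm i e1).1)
    (fun x hx => by
      obtain ⟨i, j, rfl, e1, e2, e3⟩ := exists_of_mem_R hx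
      obtain ⟨f1, f2, f3⟩ := hFm i e1
      rw [Pi.ofNat_apply] at e2 e3
      refine (cost_inner (by omega) (by omega) {6} fun b g1 g2 g3 g4 g5 => ?_)
      have : ¬ (2 ≤ b ∧ b ≤ 5) := fun h => hnotF i e1 b h.1 h.2 g5
      simp only [Finset.mem_singleton]
      omega)
    (fun x hx => by
      have h1 := Finset.card_union_le (R (S.erase q) 1 2) (R F 1 2)
      have h2 := Finset.card_union_le (R (S.erase q) 1 2 ∪ R F 1 2) (R F 2 3)
      rw [hc2, hc2] at h1
      rw [hc3] at h2
      rw [hc4]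
      omega)
  have p6 := p5.close
  refine Can.finish (μ := 2) (Y := ∅) hL hT hH hTH hka ha hT2 hq hq3 (by simp) (by simp)
    (by simp; omega) ?_
  convert p6 using 1
  ext x
  cases x with
  | u => simp [hA]
  | w => simp [hA]
  | s i j =>
    rw [Finset.mem_union (s := A), hs]
    simp only [Finset.mem_union, Finset.mem_singleton, mem_R, reduceCtorEq, false_or,
      Pi.sub_apply, Pi.ofNat_apply, Finset.sdiff_empty, Finset.mem_erase, hS, hF,
      Finset.mem_filter]
    by_cases hi : i ∈ T
    · have := hn35 i hi
      by_cases hiq : i = q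
      · subst hiq
        simp only [hi, true_and, ne_eq, not_true_eq_false, false_and, false_or]
        omega
      · simp only [hi, hiq, true_and, ne_eq, not_false_eq_true, false_and, or_false]
        omega
    · have hiq : i ≠ q := fun h => hi (h ▸ hq)
      simp [hi, hiq]

theorem can_two_blocks [Nonempty C] {q : ℕ} (hL : SavingLists L k q)
    (hT : ∀ i ∈ T, 3 ≤ n i) (hH : ∀ i ∈ Hs, n i = 1)
    (hTH : Disjoint T Hs) (hka : T.card + Hs.card + a + 1 = k) (ha : 1 ≤ a) (hT2 : 2 ≤ T.card)
    (hq : q ∈ T) (hq3 : n q = 3) {Y : Finset ℕ} (hY : Y ⊆ T) (hY3 : ∀ i ∈ Y, n i = 3)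
    (hYa : Y.card + 1 ≤ a ∨ Y.card ≤ a ∧ q ∈ Y ∧ ∃ r ∈ Y, r ≠ q)
    (hX : 1 + ∑ i ∈ T \ Y, (n i - 2) + T.card ≤ k) :
    Can (ndGraph n) L (verts n T Hs) 2 ∅ ∅ := by
  have hc : (R (T \ Y) 1 (n - 1)).card = ∑ i ∈ T \ Y, (n i - 2) := by
    rw [card_R]
    refine Finset.sum_congr rfl fun i _ => ?_
    rw [Pi.sub_apply, Pi.one_apply]; omega
  refine Can.finish (μ := 1) hL hT hH hTH hka ha hT2 hq hq3 hY hY3 hYa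
    (can_start hL hT hq hq3 (fun x hx => ?_) (by omega) (by omega))
  obtain ⟨i, j, rfl, e1, e2, e3⟩ := exists_of_mem_R hx
  have h := (Finset.mem_sdiff.1 e1).1
  have := hT i h
  rw [Pi.one_apply] at e2
  rw [Pi.sub_apply, Pi.one_apply] at e3
  exact ⟨i, h, j, rfl, by omega, by omega⟩

theorem can_of_few_triples [Nonempty C] (hL : ∀ x, (L x).card = k)
    (hn35 : ∀ i ∈ T, n i = 3 ∨ n i = 5) (hH : ∀ i ∈ Hs, n i = 1)
    (hTH : Disjoint T Hs) (hHs : Hs.card ≤ 1) (hka : T.card + Hs.card + a + 1 = k) (ha : 1 ≤ a)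
    (hm : 3 ≤ T.card + Hs.card) (ht : (T.filter fun i => n i = 5).card = 0 ∨
      (T.filter fun i => n i = 5).card = 1 ∧ a ≤ 2)
    (hspecial : ¬ (T.card = 3 ∧ Hs.card = 1 ∧ a = 1 ∧
      (T.filter fun i => n i = 5).card = 0)) {M : ℕ}
    (hM : 2 + Hs.card + ∑ i ∈ T, n i ≤ (M + 2) * k) :
    Can (ndGraph n) L (verts n T Hs) (M + 2) ∅ ∅ := by
  have hT : ∀ i ∈ T, 3 ≤ n i := fun i hi => by have := hn35 i hi; omega
  obtain ⟨hsum, hcard⟩ := sum_three_five hn35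
  obtain ⟨q, hq⟩ : (T.filter fun i => n i = 3).Nonempty := by
    rw [← Finset.card_pos]; omega
  have hq' := Finset.mem_filter.1 hq
  obtain ⟨L', hL', hS⟩ := exists_savingLists (by omega) hL q
  refine Can.subset_list ?_ hL'
  rcases Nat.eq_zero_or_pos M with rfl | hMpos
  · have hq1 : (T.erase q).card = T.card - 1 := Finset.card_erase_of_mem hq'.1
    rcases ht with ht | ⟨ht, ha2⟩
    · have hall : ∀ i ∈ T, n i = 3 := by
        intro i hi
        rcases hn35 i hi with h | h
        · exact h
        · exact absurd (Finset.mem_filter.2 ⟨hi, h⟩) (by rw [Finset.card_eq_zero.1 ht]; simp)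
      have hmain : ∀ Y ⊆ T, Y.card = T.card - a - Hs.card →
          (Y.card + 1 ≤ a ∨ Y.card ≤ a ∧ q ∈ Y ∧ ∃ r ∈ Y, r ≠ q) →
          Can (ndGraph n) L' (verts n T Hs) 2 ∅ ∅ := by
        intro Y hY hYc hYa
        refine can_two_blocks hS hT hH hTH hka ha (by omega) hq'.1 hq'.2 hY (fun i hi => hall i (hY hi))
          hYa ?_
        have : ∑ i ∈ T \ Y, (n i - 2) = (T \ Y).card := by
          rw [Finset.card_eq_sum_ones]
          exact Finset.sum_congr rfl fun i hi => by rw [hall i (Finset.mem_sdiff.1 hi).1]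
        rw [this, Finset.card_sdiff_of_subset hY]
        omega
      by_cases hsmall : T.card - a - Hs.card + 1 ≤ a
      · obtain ⟨Y, hY, hYc⟩ := Finset.exists_subset_card_eq
          (show T.card - a - Hs.card ≤ T.card by omega)
        exact hmain Y hY hYc (Or.inl (by omega))
      · obtain ⟨r, hr⟩ : (T.erase q).Nonempty := by
          rw [← Finset.card_pos]; omega
        have hr' := Finset.mem_erase.1 hr
        have hqr : ({q, r} : Finset ℕ) ⊆ T := by
          intro i hi
          simp only [Finset.mem_insert, Finset.mem_singleton] at hi
          rcases hi with rfl | rfl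
          · exact hq'.1
          · exact hr'.2
        obtain ⟨Y, hY1, hY2, hYc⟩ := Finset.exists_subsuperset_card_eq hqr
          (show ({q, r} : Finset ℕ).card ≤ T.card - a - Hs.card by
            rw [Finset.card_pair hr'.1.symm]; omega) (by omega)
        exact hmain Y hY2 hYc (Or.inr ⟨by omega, hY1 (by simp), r, hY1 (by simp), hr'.1⟩)
    · obtain ⟨p, hp⟩ := Finset.card_eq_one.1 ht
      have hpF : p ∈ T.filter fun i => n i = 5 := by rw [hp]; simp
      rw [Finset.mem_filter] at hpF
      have hsd : T \ (T.filter fun i => n i = 3) = {p} := by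
        rw [← hp]
        ext i
        simp only [Finset.mem_sdiff, Finset.mem_filter]
        refine ⟨fun h => ⟨h.1, ?_⟩, fun h => ⟨h.1, fun h' => by omega⟩⟩
        rcases hn35 i h.1 with h' | h'
        · exact absurd ⟨h.1, h'⟩ h.2
        · exact h'
      refine can_two_blocks hS hT hH hTH hka ha (by omega) hq'.1 hq'.2 (Finset.filter_subset _ _)
        (fun i hi => (Finset.mem_filter.1 hi).2) ?_ ?_
      · by_cases h2 : (T.filter fun i => n i = 3).card + 1 ≤ a
        · exact Or.inl h2
        · refine Or.inr ⟨by omega, hq, ?_⟩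
          obtain ⟨r, hr, hrq⟩ := Finset.exists_mem_ne
            (show 1 < (T.filter fun i => n i = 3).card by omega) q
          exact ⟨r, hr, hrq⟩
      · rw [hsd, Finset.sum_singleton]
        omega
  · exact (can_three_blocks hS hn35 hH hTH hka ha (by omega) hm (by omega) hq'.1 hq'.2).mono (by omega)

end Cases

section Cases

variable {C : Type} {L : Nd → Finset C} {n : ℕ → ℕ} {T Hs : Finset ℕ} {k : ℕ}

set_option maxHeartbeats 1000000 in
/-- Two blocks suffice for `Θ(1, 2, 2, 2)` and lists of size six. -/
theorem can_one_two_two_two [Nonempty C] (hL : ∀ x, (L x).card = 6) {a b c g : ℕ} (hab : a ≠ b)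
    (hac : a ≠ c) (hbc : b ≠ c) (hga : g ≠ a) (hgb : g ≠ b) (hgc : g ≠ c) (ha : n a = 3)
    (hb : n b = 3) (hc : n c = 3) (hg : n g = 1) :
    Can (ndGraph n) L (verts n {a, b, c} {g}) 2 ∅ ∅ := by
  have hne : ∀ x, (L x).Nonempty := fun x => Finset.card_pos.1 (by rw [hL x]; omega)
  obtain ⟨α, hα, β, hβ, h1⟩ := exists_pair (F := L (s a 3)) (hne (s g 1)) (hne (s a 2))
    (by rw [hL, hL, hL]; omega)
  have hc1 := Finset.le_card_sdiff {α, β} (L (s a 1))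
  have hc2 := Finset.le_card_sdiff {α} (L (s c 2))
  have hc3 := Finset.card_le_card (Finset.sdiff_subset (s := L (s a 3)) (t := {α, β}))
  have hαβ := Finset.card_le_two (a := α) (b := β)
  rw [Finset.card_singleton] at hc2
  rw [hL] at hc1 hc2 hc3 h1
  obtain ⟨γ, hγ, δ, hδ, h2⟩ := exists_pair (F := L (s a 3) \ {α, β})
    (A := L (s a 1) \ {α, β}) (B := L (s c 2) \ {α})
    (Finset.card_pos.1 (by omega)) (Finset.card_pos.1 (by omega)) (by omega)
  simp only [Finset.mem_sdiff, Finset.mem_insert, Finset.mem_singleton, not_or] at hγ hδ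
  set L' : Nd → Finset C := fun x => if x = s g 1 then {α} else if x = s a 2 then {β} else
    if x = s a 1 then {γ} else if x = s c 2 then {δ} else
    if x = s a 3 then (L x \ {α, β}) \ {γ, δ} else L x with hL'
  have hLh : L' (s g 1) = {α} := by simp [hL']
  have hLv0 : L' (s a 2) = {β} := by simp [hL', hga.symm]
  have hLe0 : L' (s a 1) = {γ} := by simp [hL', hga.symm]
  have hLv2 : L' (s c 2) = {δ} := by simp [hL', hgc.symm, hac.symm]
  have hLf0 : L' (s a 3) = (L (s a 3) \ {α, β}) \ {γ, δ} := by simp [hL', hga.symm, hac]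
  have hLo : ∀ x, x ≠ s g 1 → x ≠ s a 2 → x ≠ s a 1 → x ≠ s c 2 → x ≠ s a 3 → (L' x).card = 6 := by
    intro x h1 h2 h3 h4 h5
    simp only [hL', h1, h2, h3, h4, h5, if_false]
    exact hL x
  refine Can.subset_list (L' := L') ?_ (fun x => ?_)
  swap
  · simp only [hL']
    split_ifs with e1 e2 e3 e4 e5
    · subst e1; simpa using hα
    · subst e2; simpa using hβ
    · subst e3; simpa using hγ.1
    · subst e4; simpa using hδ.1
    · exact Finset.sdiff_subset.trans Finset.sdiff_subset
    · rfl
  have hle4 : ∀ x y z t : Nd, ({x, y, z, t} : Finset Nd).card < 6 := fun x y z t =>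
    Finset.card_le_four.trans_lt (by omega)
  have hle5 : ∀ x y z t v : Nd, ({x, y, z, t, v} : Finset Nd).card < 6 := fun x y z t v =>
    Finset.card_le_five.trans_lt (by omega)
  have p1 := (can_empty (H := ndGraph n) (L := L')).step (s g 1) (by simp) ∅ (by simp) (by simp)
    (by rw [hLh]; simp)
  have p2 := p1.swap.step (s a 2) (by simp [hga.symm]) ∅ (by
      intro y hy hadj
      simp at hy
      subst hy
      exact absurd hadj (not_adj_s hga.symm (by omega) (by omega))) (by simp) (by rw [hLv0]; simp)
  have p3 := p2.step (s a 1) (by simp [hga.symm]) ∅ (by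
      intro y hy hadj
      simp at hy
      subst hy
      rw [hLe0, hLh]
      exact Or.inr (by simpa using hγ.2.1))
    (by
      intro y hy
      simp at hy
      subst hy
      rw [hLe0, hLv0]
      exact Or.inr (by simpa using hγ.2.2)) (by rw [hLe0]; simp)
  have p4 := p3.swap.step (s c 2) (by simp [hgc.symm, hac.symm]) ∅ (by
      intro y hy hadj
      simp at hy
      rcases hy with rfl | rfl <;>
      exact absurd hadj (not_adj_s hac.symm (by omega) (by omega)))
    (by
      intro y hy
      simp at hy
      subst hy
      rw [hLv2, hLh]
      exact Or.inr (by simpa using hδ.2)) (by rw [hLv2]; simp)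
  have p5 := p4.swap.step u (by simp) {s g 1, s c 2, s a 1, s a 2}
    (fun y hy _ => Or.inl (by simp at hy ⊢; tauto)) (fun y hy => Or.inl (by simp at hy ⊢; tauto))
    (by rw [hLo _ (by simp) (by simp) (by simp) (by simp) (by simp)]; exact hle4 _ _ _ _)
  have p6 := p5.step (s c 1) (by simp [hgc.symm, hac.symm]) {s g 1, s c 2, s a 1, s a 2, u}
    (fun y hy _ => Or.inl (by simp at hy ⊢; tauto)) (fun y hy => Or.inl (by simp at hy ⊢; tauto))
    (by rw [hLo _ (by simp [hgc.symm]) (by simp) (by simp [hac.symm]) (by simp) (by simp)]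
        exact hle5 _ _ _ _ _)
  have p7 := p6.step (s b 1) (by simp [hgb.symm, hab.symm, hbc]) {s g 1, s c 1, s a 1, s a 2, u}
    (fun y hy hadj => Or.inl (by
      simp at hy ⊢
      rcases hy with rfl | rfl
      · exact absurd hadj (not_adj_s hbc (by omega) (by omega))
      · tauto)) (fun y hy => Or.inl (by simp at hy ⊢; tauto))
    (by rw [hLo _ (by simp [hgb.symm]) (by simp) (by simp [hab.symm]) (by simp) (by simp)]
        exact hle5 _ _ _ _ _)
  have p8 := p7.step (s b 2) (by simp [hab.symm, hbc]) {s b 1, s c 1, s a 1, s a 2, u}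
    (fun y hy hadj => Or.inl (by
      simp at hy ⊢
      rcases hy with rfl | rfl
      · exact absurd hadj (not_adj_s hbc (by omega) (by omega))
      · exact absurd hadj (not_adj_s hgb.symm (by omega) (by omega))))
    (fun y hy => Or.inl (by simp at hy ⊢; tauto))
    (by rw [hLo _ (by simp) (by simp [hab.symm]) (by simp) (by simp [hbc]) (by simp)]
        exact hle5 _ _ _ _ _)
  have p9 := p8.close.swap
  have p10 := p9.step w (by simp) {s g 1, s c 2, u, s a 2, s b 2}
    (fun y hy hadj => Or.inl (by
      simp at hy ⊢
      rcases hy with rfl | rfl | rfl | rfl | rfl | rfl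
      · tauto
      · exact absurd hadj (not_adj_w (by omega) (by omega))
      · exact absurd hadj (not_adj_w (by omega) (by omega))
      · tauto
      · exact absurd hadj (not_adj_w (by omega) (by omega))
      · tauto))
    (fun y hy => Or.inl (by simp at hy ⊢; tauto))
    (by rw [hLo _ (by simp) (by simp) (by simp) (by simp) (by simp)]
        exact hle5 _ _ _ _ _)
  have p11 := p10.step (s b 3) (by simp [hab.symm, hbc, hgb.symm]) {s g 1, s c 2, w, s b 1, s b 2}
    (fun y hy hadj => Or.inl (by
      simp at hy ⊢
      rcases hy with rfl | rfl | rfl | rfl | rfl | rfl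
      · tauto
      · tauto
      · exact absurd hadj (not_adj_s hbc (by omega) (by omega))
      · rcases ndGraph_adj_s hadj with ⟨j, e1, e2, e3, e4, e5⟩ | ⟨e1, -⟩ | ⟨-, i, -, e1⟩
        · have := pos_eq_u_iff.1 e5.symm
          omega
        · omega
        · cases e1
      · exact absurd hadj (not_adj_s hab.symm (by omega) (by omega))
      · exact absurd hadj (not_adj_s hab.symm (by omega) (by omega))))
    (fun y hy => Or.inl (by simp at hy ⊢; tauto))
    (by rw [hLo _ (by simp) (by simp) (by simp) (by simp) (by simp [hab.symm])]
        exact hle5 _ _ _ _ _)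
  have p12 := p11.step (s c 3) (by simp [hac.symm, hbc.symm, hgc.symm]) {s g 1, s c 2, w, s b 3, s c 1}
    (fun y hy hadj => Or.inl (by
      simp at hy ⊢
      rcases hy with rfl | rfl | rfl | rfl | rfl | rfl
      · exact absurd hadj (not_adj_s hbc.symm (by omega) (by omega))
      · exact absurd hadj (not_adj_s hbc.symm (by omega) (by omega))
      · tauto
      · rcases ndGraph_adj_s hadj with ⟨j, e1, e2, e3, e4, e5⟩ | ⟨e1, -⟩ | ⟨-, i, -, e1⟩
        · have := pos_eq_u_iff.1 e5.symm
          omega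
        · omega
        · cases e1
      · exact absurd hadj (not_adj_s hac.symm (by omega) (by omega))
      · exact absurd hadj (not_adj_s hac.symm (by omega) (by omega))))
    (fun y hy => Or.inl (by simp at hy ⊢; tauto))
    (by rw [hLo _ (by simp) (by simp) (by simp) (by simp) (by simp [hac.symm])]
        exact hle5 _ _ _ _ _)
  have hdis : ∀ x ∈ ({α, β, γ, δ} : Finset C), Disjoint (L' (s a 3)) {x} := by
    intro x hx
    rw [Finset.disjoint_singleton_right, hLf0]
    simp only [Finset.mem_insert, Finset.mem_singleton, Finset.mem_sdiff] at hx ⊢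
    tauto
  have p13 := p12.step (s a 3) (by simp [hab, hac, hga.symm]) {w, s b 3, s c 3}
    (fun y hy hadj => by
      simp at hy
      rcases hy with rfl | rfl | rfl | rfl | rfl | rfl
      · exact absurd hadj (not_adj_s hab (by omega) (by omega))
      · exact absurd hadj (not_adj_s hab (by omega) (by omega))
      · exact absurd hadj (not_adj_s hac (by omega) (by omega))
      · rcases ndGraph_adj_s hadj with ⟨j, e1, e2, e3, e4, e5⟩ | ⟨e1, -⟩ | ⟨-, i, -, e1⟩
        · have := pos_eq_u_iff.1 e5.symm
          omega
        · omega
        · cases e1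
      · rw [hLe0]; exact Or.inr (hdis γ (by simp))
      · rw [hLv0]; exact Or.inr (hdis β (by simp)))
    (fun y hy => by
      simp at hy
      rcases hy with rfl | rfl | rfl | rfl | rfl
      · exact Or.inl (by simp)
      · exact Or.inl (by simp)
      · exact Or.inl (by simp)
      · rw [hLv2]; exact Or.inr (hdis δ (by simp))
      · rw [hLh]; exact Or.inr (hdis α (by simp)))
    (by
      have h3 := Finset.card_le_three (a := w) (b := s b 3) (c := s c 3)
      rw [hLf0]
      omega)
  have p14 := p13.close
  convert p14 using 1
  ext x
  cases x with
  | u => simp [verts]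
  | w => simp [verts]
  | s i j =>
    rw [mem_verts_s]
    simp only [Finset.mem_union, Finset.mem_insert, Finset.mem_singleton, Finset.notMem_empty, or_false,
      false_or, s.injEq, reduceCtorEq]
    by_cases e1 : i = a
    · subst e1; simp only [hab, hac, hga.symm, true_and, false_and, false_or, or_false]; omega
    by_cases e2 : i = b
    · subst e2; simp only [hab.symm, hbc, hgb.symm, or_true, true_and, false_and, false_or, or_false]; omega
    by_cases e3 : i = c
    · subst e3; simp only [hac.symm, hbc.symm, hgc.symm, or_true, true_and, false_and, false_or, or_false]; omega
    by_cases e4 : i = g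
    · subst e4; simp only [hga, hgb, hgc, true_and, false_and, false_or, or_false]
    simp [e1, e2, e3, e4]

/-- The main case: at least three paths. -/
theorem can_of_three_le [Nonempty C] (hL : ∀ x, (L x).card = k)
    (hn : ∀ i, i ∉ Hs → 3 ≤ n i) (hodd : ∀ i ∈ T, n i % 2 = 1) (hH : ∀ i ∈ Hs, n i = 1)
    (hTH : Disjoint T Hs) (hHs : Hs.card ≤ 1) (hm : 3 ≤ T.card + Hs.card)
    (hk : T.card + Hs.card + 2 ≤ k) {M : ℕ}
    (hM : 2 + Hs.card + ∑ i ∈ T, n i ≤ M * k) : Can (ndGraph n) L (verts n T Hs) M ∅ ∅ := by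
  have hTn : ∀ i ∈ T, 3 ≤ n i := fun i hi => hn i (Finset.disjoint_left.1 hTH hi)
  obtain ⟨a, ha, hka⟩ : ∃ a, 1 ≤ a ∧ T.card + Hs.card + a + 1 = k := ⟨k - 1 - T.card - Hs.card, by omega⟩
  have hM1 : M ≠ 0 := by rintro rfl; omega
  by_cases hsmall : 2 + Hs.card + ∑ i ∈ T, n i ≤ k
  · exact (can_of_card_le hL hsmall).mono (by omega)
  have hM2 : M ≠ 1 := by rintro rfl; omega
  obtain ⟨M, rfl⟩ : ∃ M', M = M' + 2 := ⟨M - 2, by omega⟩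
  by_cases h1 : 3 ≤ a ∧ ∃ p ∈ T, n p ≠ 3
  · obtain ⟨ha3, p, hp, hnp⟩ := h1
    obtain ⟨r, hr, hpr⟩ := Finset.exists_mem_ne (show 1 < T.card by omega) p
    exact can_of_large_slack hL hn hodd hH hTH hHs hka ha3 hp hr hpr.symm hnp hM
  by_cases h2 : ∃ p ∈ T, 7 ≤ n p
  · obtain ⟨p, hp, hnp⟩ := h2
    have ha2 : a ≤ 2 := by
      by_contra hcon
      exact h1 ⟨by omega, p, hp, by omega⟩
    have hsum : 7 + (T.card - 1) * 3 ≤ ∑ i ∈ T, n i := by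
      rw [← Finset.add_sum_erase T n hp]
      have := Finset.card_nsmul_le_sum (T.erase p) (fun i => n i) 3 (fun i hi => hTn i (Finset.mem_of_mem_erase hi))
      rw [Finset.card_erase_of_mem hp, smul_eq_mul] at this
      omega
    have hM3 : M ≠ 0 := by rintro rfl; omega
    obtain ⟨M, rfl⟩ : ∃ M', M = M' + 1 := ⟨M - 1, by omega⟩
    obtain ⟨r, hr, hpr, hr3⟩ : ∃ r ∈ T, r ≠ p ∧ (n r = 3 ∨ ∀ i ∈ T, n i ≠ 3) := by
      by_cases h3 : ∃ r ∈ T, n r = 3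
      · obtain ⟨r, hr, hr3⟩ := h3
        exact ⟨r, hr, by rintro rfl; omega, Or.inl hr3⟩
      · push Not at h3
        obtain ⟨r, hr, hpr⟩ := Finset.exists_mem_ne (show 1 < T.card by omega) p
        exact ⟨r, hr, hpr, Or.inr h3⟩
    exact can_of_long_path (by omega) hL hn hodd hH hTH hHs hka ha hp hr hpr.symm hnp hr3 hM
  have hn35 : ∀ i ∈ T, n i = 3 ∨ n i = 5 := by
    intro i hi
    have h3 : ¬ 7 ≤ n i := fun h => h2 ⟨i, hi, h⟩
    have := hTn i hi
    have := hodd i hi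
    omega
  obtain ⟨hsum, hcard⟩ := sum_three_five hn35
  by_cases h3 : 2 ≤ (T.filter fun i => n i = 5).card
  · rcases (by omega : k = 5 ∨ 6 ≤ k) with rfl | hk6
    · exact can_of_triples_five hL hn35 hTH (by omega) h3 hM
    · obtain ⟨p, hp, q, hq, hpq⟩ := Finset.one_lt_card.1 (show 1 < (T.filter fun i => n i = 5).card by omega)
      rw [Finset.mem_filter] at hp hq
      have ha2 : a ≤ 2 := by
        by_contra hcon
        exact h1 ⟨by omega, p, hp.1, by omega⟩
      have hM3 : M ≠ 0 := by rintro rfl; omega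
      obtain ⟨M, rfl⟩ : ∃ M', M = M' + 1 := ⟨M - 1, by omega⟩
      exact can_of_triples hk6 hL hn hn35 hH hTH hHs hka ha ha2 hp.1 hq.1 hpq hp.2 hq.2 hM
  · by_cases hsp : T.card = 3 ∧ Hs.card = 1 ∧ a = 1 ∧ (T.filter fun i => n i = 5).card = 0
    · obtain ⟨e1, e2, rfl, e4⟩ := hsp
      obtain ⟨x, y, z, hxy, hxz, hyz, rfl⟩ := Finset.card_eq_three.1 e1
      obtain ⟨g, rfl⟩ := Finset.card_eq_one.1 e2
      obtain rfl : k = 6 := by omega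
      have hall : ∀ i ∈ ({x, y, z} : Finset ℕ), n i = 3 := by
        intro i hi
        rcases hn35 i hi with h | h
        · exact h
        · exact absurd (Finset.mem_filter.2 ⟨hi, h⟩) (by rw [Finset.card_eq_zero.1 e4]; simp)
      have hgn : ∀ i ∈ ({x, y, z} : Finset ℕ), g ≠ i := by
        rintro i hi rfl
        exact Finset.disjoint_left.1 hTH hi (by simp)
      exact (can_one_two_two_two hL hxy hxz hyz (hgn x (by simp)) (hgn y (by simp)) (hgn z (by simp))
        (hall x (by simp)) (hall y (by simp)) (hall z (by simp)) (hH g (by simp))).mono (by omega)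
    · refine can_of_few_triples hL hn35 hH hTH hHs hka ha hm ?_ hsp hM
      rcases (by omega : (T.filter fun i => n i = 5).card = 0 ∨ (T.filter fun i => n i = 5).card = 1)
        with h | h
      · exact Or.inl h
      · refine Or.inr ⟨h, ?_⟩
        by_contra hcon
        obtain ⟨p, hp⟩ := Finset.card_pos.1 (show 0 < (T.filter fun i => n i = 5).card by omega)
        rw [Finset.mem_filter] at hp
        exact h1 ⟨by omega, p, hp.1, by omega⟩

end Cases

/-- The square of the cycle `0, 1, …, N - 1`. -/
def cyc (N : ℕ) : SimpleGraph ℕ where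
  Adj i j := i ≠ j ∧ (i ≤ j + 2 ∧ j ≤ i + 2 ∨ N ≤ j - i + 2 ∨ N ≤ i - j + 2)
  symm := ⟨fun i j h => ⟨h.1.symm, by have := h.2; omega⟩⟩
  loopless := ⟨fun i h => h.1 rfl⟩

theorem cyc_adj {N i j : ℕ} : (cyc N).Adj i j ↔
    i ≠ j ∧ (i ≤ j + 2 ∧ j ≤ i + 2 ∨ N ≤ j - i + 2 ∨ N ≤ i - j + 2) := Iff.rfl

section Cycle

variable {C : Type} {L : ℕ → Finset C} {N k : ℕ} {P : Finset ℕ}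

theorem Can.cyc_step {r j μ : ℕ} (hC : Can (cyc N) L (Finset.range r) μ P ∅) (hk : 3 ≤ k)
    (hL : ∀ i, r ≤ i → i < r + j → k ≤ (L i).card) (hj : j ≤ k) (hN : r + j + 2 ≤ N)
    (hP : ∀ y ∈ P, ∀ i, r ≤ i → i < r + j → i ≠ y ∧ ¬ (cyc N).Adj i y) :
    Can (cyc N) L (Finset.range (r + j)) (μ + 1) P ∅ := by
  set b1 := min (r + 1) (r + j) with hb1
  set b2 := min (r + 2) (r + j) with hb2
  have hdP : ∀ i, r ≤ i → i < r + j → i ∉ P := fun i h1 h2 hi => (hP i hi i h1 h2).1 rfl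
  have key : ∀ i d, r ≤ i → i < r + j → 2 ≤ d + (i - r) →
      Cost (cyc N) (Finset.range r ∪ P) i d := by
    intro i d h1 h2 h3
    refine ⟨Finset.Ico (r - d) r, by rw [Nat.card_Ico]; omega, fun y hy hadj => ?_⟩
    rcases Finset.mem_union.1 hy with hy | hy
    · rw [Finset.mem_range] at hy
      rw [cyc_adj] at hadj
      rw [Finset.mem_Ico]
      omega
    · exact absurd hadj (hP y hy i h1 h2).2
  have p1 := hC.phase (k := k) (d := 2) (Finset.Ico r b1) (by
      rw [Finset.disjoint_left]
      intro i hi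
      rw [Finset.mem_Ico] at hi
      have := hdP i (by omega) (by omega)
      simp [this]
      omega)
    (fun i hi => by rw [Finset.mem_Ico] at hi; exact hL i (by omega) (by omega))
    (fun i hi => by
      rw [Finset.mem_Ico] at hi
      exact key i 2 (by omega) (by omega) (by omega))
    (fun i _ => by rw [Nat.card_Ico, Finset.card_empty]; omega)
  rw [Finset.empty_union] at p1
  have p2 := p1.phase (k := k) (d := 1) (Finset.Ico b1 b2) (by
      rw [Finset.disjoint_left]
      intro i hi
      rw [Finset.mem_Ico] at hi
      have := hdP i (by omega) (by omega)
      simp [this]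
      omega)
    (fun i hi => by rw [Finset.mem_Ico] at hi; exact hL i (by omega) (by omega))
    (fun i hi => by
      rw [Finset.mem_Ico] at hi
      exact key i 1 (by omega) (by omega) (by omega))
    (fun i _ => by rw [Nat.card_Ico, Nat.card_Ico]; omega)
  rw [Finset.Ico_union_Ico_eq_Ico (by omega) (by omega)] at p2
  have p3 := p2.phase (k := k) (d := 0) (Finset.Ico b2 (r + j)) (by
      rw [Finset.disjoint_left]
      intro i hi
      rw [Finset.mem_Ico] at hi
      have := hdP i (by omega) (by omega)
      simp [this]
      omega)
    (fun i hi => by rw [Finset.mem_Ico] at hi; exact hL i (by omega) (by omega))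
    (fun i hi => by
      rw [Finset.mem_Ico] at hi
      exact key i 0 (by omega) (by omega) (by omega))
    (fun i _ => by rw [Nat.card_Ico, Nat.card_Ico]; omega)
  rw [Finset.Ico_union_Ico_eq_Ico (by omega) (by omega)] at p3
  have p4 := p3.close
  rwa [Finset.range_eq_Ico, Finset.Ico_union_Ico_eq_Ico (by omega) (by omega),
    ← Finset.range_eq_Ico] at p4

theorem Can.cyc_blocks {r0 μ : ℕ} (hC : Can (cyc N) L (Finset.range r0) μ P ∅) (hk : 3 ≤ k) (M : ℕ)
    {r : ℕ} (hr0 : r0 ≤ r) (hr : r ≤ r0 + M * k) (hL : ∀ i, r0 ≤ i → i < r → k ≤ (L i).card)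
    (hN : r + 2 ≤ N) (hP : ∀ y ∈ P, ∀ i, r0 ≤ i → i < r → i ≠ y ∧ ¬ (cyc N).Adj i y) :
    Can (cyc N) L (Finset.range r) (μ + M) P ∅ := by
  induction M generalizing r with
  | zero =>
    obtain rfl : r = r0 := by omega
    exact hC
  | succ M ih =>
    rw [Nat.succ_mul] at hr
    have h1 := ih (r := min r (r0 + M * k)) (by omega) (by omega) (fun i e1 e2 => hL i e1 (by omega))
      (by omega) (fun y hy i e1 e2 => hP y hy i e1 (by omega))
    have h2 := h1.cyc_step (k := k) (j := r - min r (r0 + M * k)) hk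
      (fun i e1 e2 => hL i (by omega) (by omega)) (by omega) (by omega)
      (fun y hy i e1 e2 => hP y hy i (by omega) (by omega))
    rwa [show min r (r0 + M * k) + (r - min r (r0 + M * k)) = r by omega] at h2

theorem can_path [Nonempty C] (hL : ∀ i, (L i).card = k) (hk : 3 ≤ k) {r M : ℕ} (hM : r ≤ M * k)
    (hN : r + 2 ≤ N) : Can (cyc N) L (Finset.range r) M ∅ ∅ := by
  have h := (can_empty (H := cyc N) (L := L))
  rw [← Finset.range_zero] at h
  have h1 := Can.cyc_blocks h hk M (r := r) (by omega) (by omega) (fun i _ _ => (hL i).ge) hN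
    (by simp)
  rwa [zero_add] at h1

theorem can_cycle_of_five_le [Nonempty C] (hL : ∀ i, (L i).card = k) (hk : 5 ≤ k) {M : ℕ}
    (hM : N ≤ M * k) (hN : 1 ≤ N) : Can (cyc N) L (Finset.range N) M ∅ ∅ := by
  obtain ⟨M, rfl⟩ : ∃ M', M = M' + 1 := ⟨M - 1, by
    have : M ≠ 0 := by rintro rfl; omega
    omega⟩
  rw [Nat.succ_mul] at hM
  by_cases hs : N ≤ k
  · have p1 := (can_empty (H := cyc N) (L := L)).phase (k := k) (d := 0) (Finset.range N) (by simp)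
      (fun x _ => (hL x).ge) (fun x _ => ⟨∅, by simp, by simp⟩) (fun x _ => by simpa using hs)
    simpa using p1.close.mono (by omega)
  · have p0 := can_path (N := N) hL (by omega) (r := N - k) (M := M) (by omega) (by omega)
    have p1 := p0.phase (k := k) (d := 2) {N - k, N - 1} (by
        rw [Finset.disjoint_left]
        intro i hi
        simp at hi ⊢
        omega)
      (fun x _ => (hL x).ge)
      (fun i hi => by
        rw [Finset.mem_insert, Finset.mem_singleton] at hi
        rcases hi with rfl | rfl
        · refine ⟨{N - k - 1, N - k - 2}, Finset.card_le_two, fun y hy hadj => ?_⟩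
          rw [Finset.union_empty, Finset.mem_range] at hy
          rw [cyc_adj] at hadj
          rw [Finset.mem_insert, Finset.mem_singleton]
          omega
        · refine ⟨{0, 1}, Finset.card_le_two, fun y hy hadj => ?_⟩
          rw [Finset.union_empty, Finset.mem_range] at hy
          rw [cyc_adj] at hadj
          rw [Finset.mem_insert, Finset.mem_singleton]
          omega)
      (fun i _ => by
        have := Finset.card_le_two (a := N - k) (b := N - 1)
        rw [Finset.card_empty]
        omega)
    have p2 := p1.phase (k := k) (d := 1) {N - k + 1, N - 2} (by
        rw [Finset.disjoint_left]
        intro i hi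
        simp at hi ⊢
        omega)
      (fun x _ => (hL x).ge)
      (fun i hi => by
        rw [Finset.mem_insert, Finset.mem_singleton] at hi
        rcases hi with rfl | rfl
        · refine ⟨{N - k - 1}, by simp, fun y hy hadj => ?_⟩
          rw [Finset.union_empty, Finset.mem_range] at hy
          rw [cyc_adj] at hadj
          rw [Finset.mem_singleton]
          omega
        · refine ⟨{0}, by simp, fun y hy hadj => ?_⟩
          rw [Finset.union_empty, Finset.mem_range] at hy
          rw [cyc_adj] at hadj
          rw [Finset.mem_singleton]
          omega)
      (fun i _ => by
        have := Finset.card_le_two (a := N - k) (b := N - 1)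
        have := Finset.card_le_two (a := N - k + 1) (b := N - 2)
        rw [Finset.empty_union]
        omega)
    have p3 := p2.phase (k := k) (d := 0) (Finset.Ico (N - k + 2) (N - 2)) (by
        rw [Finset.disjoint_left]
        intro i hi
        simp at hi ⊢
        omega)
      (fun x _ => (hL x).ge)
      (fun i hi => by
        refine ⟨∅, by simp, fun y hy hadj => ?_⟩
        rw [Finset.mem_Ico] at hi
        rw [Finset.union_empty, Finset.mem_range] at hy
        rw [cyc_adj] at hadj
        omega)
      (fun i _ => by
        have := Finset.card_le_two (a := N - k) (b := N - 1)
        have := Finset.card_le_two (a := N - k + 1) (b := N - 2)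
        have := Finset.card_union_le {N - k, N - 1} {N - k + 1, N - 2}
        rw [Finset.empty_union, Nat.card_Ico]
        omega)
    have p4 := p3.close
    convert p4 using 1
    ext i
    simp
    omega

theorem can_cycle_four_of_ne [Nonempty C] (hL : ∀ i, (L i).card = 4) {M : ℕ} (hM : N ≤ M * 4)
    (hN : 6 ≤ N) (heven : N % 2 = 0) (hne : L (N - 1) ≠ L (N - 2)) :
    Can (cyc N) L (Finset.range N) M ∅ ∅ := by
  obtain ⟨α, hα, hα'⟩ : ∃ α ∈ L (N - 1), α ∉ L (N - 2) := by
    by_contra! hcon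
    exact hne (Finset.eq_of_subset_of_card_le hcon (by rw [hL, hL]))
  obtain ⟨r, q, hr2, hr4, hrq⟩ : ∃ r q, 2 ≤ r ∧ r ≤ 4 ∧ N = r + q * 4 + 4 := by
    rcases (by omega : N % 4 = 0 ∨ N % 4 = 2) with h | h
    · exact ⟨4, N / 4 - 2, by omega, by omega, by omega⟩
    · exact ⟨2, N / 4 - 1, by omega, by omega, by omega⟩
  set L' : ℕ → Finset C := fun i => if i = N - 1 then {α} else L i with hL'
  have hL1 : L' (N - 1) = {α} := by simp [hL']
  have hLo : ∀ i, i ≠ N - 1 → L' i = L i := fun i hi => by simp [hL', hi]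
  have hLc : ∀ i, i ≠ N - 1 → 4 ≤ (L' i).card := fun i hi => by rw [hLo i hi, hL]
  refine Can.subset_list (L' := L') ?_ (fun i => ?_)
  swap
  · simp only [hL']
    split_ifs with h
    · subst h; simpa using hα
    · rfl
  have p1 := ((can_empty (H := cyc N) (L := L')).step (N - 1) (by simp) ∅ (by simp) (by simp)
    (by rw [hL1]; simp)).swap
  have hr8 : r = 2 ∨ 8 ≤ N := by omega
  have p2 := p1.phase (k := 4) (d := 1) (Finset.range 2) (by
      rw [Finset.disjoint_left]
      intro i hi
      simp at hi ⊢
      omega)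
    (fun i hi => by rw [Finset.mem_range] at hi; exact hLc i (by omega))
    (fun i hi => ⟨{N - 1}, by simp, by simp⟩) (by simp)
  have p3 := p2.phase (k := 4) (d := 0) (Finset.Ico 2 r) (by
      rw [Finset.disjoint_left]
      intro i hi
      simp at hi ⊢
      omega)
    (fun i hi => by rw [Finset.mem_Ico] at hi; exact hLc i (by omega))
    (fun i hi => by
      refine ⟨∅, by simp, fun y hy hadj => ?_⟩
      rw [Finset.mem_Ico] at hi
      simp at hy
      rw [cyc_adj] at hadj
      omega)
    (fun i hi => by
      rw [Finset.empty_union, Finset.card_range, Nat.card_Ico]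
      omega)
  have p4 := p3.close
  rw [Finset.empty_union, Finset.empty_union, Finset.range_eq_Ico, Finset.Ico_union_Ico_eq_Ico (by omega) hr2,
    ← Finset.range_eq_Ico] at p4
  have p5 := (p4.cyc_blocks (k := 4) (by omega) q (r := N - 4) (by omega) (by omega)
    (fun i e1 e2 => hLc i (by omega)) (by omega) (by
      intro y hy i e1 e2
      simp at hy
      rw [cyc_adj]
      omega)).swap
  have p6 := p5.phase (k := 4) (d := 2) {N - 4} (by
      rw [Finset.disjoint_left]
      intro i hi
      simp at hi ⊢
      omega)
    (fun i hi => by rw [Finset.mem_singleton] at hi; exact hLc i (by omega))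
    (fun i hi => by
      refine ⟨{N - 5, N - 6}, Finset.card_le_two, fun y hy hadj => ?_⟩
      rw [Finset.mem_singleton] at hi
      rw [Finset.union_empty, Finset.mem_range] at hy
      rw [cyc_adj] at hadj
      rw [Finset.mem_insert, Finset.mem_singleton]
      omega)
    (fun i hi => by simp)
  have p7 := p6.phase (k := 4) (d := 1) {N - 3} (by
      rw [Finset.disjoint_left]
      intro i hi
      simp at hi ⊢
      omega)
    (fun i hi => by rw [Finset.mem_singleton] at hi; exact hLc i (by omega))
    (fun i hi => by
      refine ⟨{N - 5}, by simp, fun y hy hadj => ?_⟩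
      rw [Finset.mem_singleton] at hi
      rw [Finset.union_empty, Finset.mem_range] at hy
      rw [cyc_adj] at hadj
      rw [Finset.mem_singleton]
      omega)
    (fun i hi => by
      have := Finset.card_le_two (a := N - 1) (b := N - 4)
      simp only [insert_empty_eq, ← Finset.insert_eq, Finset.card_singleton]
      omega)
  have p8 := p7.step (N - 2) (by
      simp
      omega) {0, N - 4, N - 3}
    (fun y hy hadj => by
      rw [Finset.union_empty, Finset.mem_range] at hy
      rw [cyc_adj] at hadj
      left
      simp only [Finset.mem_insert, Finset.mem_singleton]
      omega)
    (fun y hy => by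
      simp at hy
      rcases hy with rfl | rfl | rfl
      · right
        rw [hL1, hLo _ (by omega), Finset.disjoint_singleton_right]
        exact hα'
      · simp
      · simp)
    (by
      have := Finset.card_le_three (a := 0) (b := N - 4) (c := N - 3)
      have := hLc (N - 2) (by omega)
      omega)
  have p9 := p8.close.mono (ν := M) (by omega)
  convert p9 using 1
  ext i
  simp
  omega

end Cycle

section Comap

variable {α β : Type*} [DecidableEq α] [DecidableEq β] {C : Type}

theorem Can.comap {G : SimpleGraph β} {H : SimpleGraph α} {L : β → Finset C} {L' : α → Finset C}
    {A : Finset β} {A' : Finset α} {μ : ℕ} (h : Can H L' A' μ ∅ ∅) (ψ : β → α) (hinj : Set.InjOn ψ A)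
    (hmap : ∀ x ∈ A, ψ x ∈ A') (hL : ∀ x ∈ A, L' (ψ x) = L x)
    (hadj : ∀ x ∈ A, ∀ y ∈ A, G.Adj x y → H.Adj (ψ x) (ψ y)) : Can G L A μ ∅ ∅ := by
  obtain ⟨c, h1, h2, -, -, h5⟩ := h
  simp only [Finset.union_empty] at h1 h2
  refine ⟨c ∘ ψ, ?_, ?_, by simp, by simp, fun col => (?_ : _ ≤ _).trans (h5 col)⟩
  · simp only [Finset.union_empty]
    exact fun x hx => hL x hx ▸ h1 _ (hmap x hx)
  · simp only [Finset.union_empty]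
    exact fun x hx y hy hxy => h2 _ (hmap x hx) _ (hmap y hy) (hadj x hx y hy hxy)
  · refine Finset.card_le_card_of_injOn ψ (fun x hx => ?_) (hinj.mono ?_)
    · rw [Finset.mem_coe, Finset.mem_filter] at hx ⊢
      exact ⟨hmap x hx.1, hx.2⟩
    · intro x hx
      exact (Finset.mem_filter.1 (Finset.mem_coe.1 hx)).1

theorem can_comap [Nonempty β] {G : SimpleGraph β} {H : SimpleGraph α} {L : β → Finset C} {k : ℕ}
    (hL : ∀ x, (L x).card = k) {A : Finset β} {A' : Finset α} {μ : ℕ} (ψ : β → α)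
    (hinj : Set.InjOn ψ A) (hmap : ∀ x ∈ A, ψ x ∈ A')
    (hadj : ∀ x ∈ A, ∀ y ∈ A, G.Adj x y → H.Adj (ψ x) (ψ y))
    (h : ∀ L' : α → Finset C, (∀ y, (L' y).card = k) → Can H L' A' μ ∅ ∅) : Can G L A μ ∅ ∅ :=
  (h (fun y => L (Function.invFunOn ψ A y)) (fun _ => hL _)).comap ψ hinj hmap
    (fun x hx => by rw [hinj.leftInvOn_invFunOn hx]) hadj

end Comap

section Cycle

variable {C : Type} {L : ℕ → Finset C} {N k : ℕ}

theorem can_cycle_four_of_eq {S : Finset C} (hS : S.card = 4) (hL : ∀ i < N, L i = S) {M : ℕ}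
    (hM : N ≤ M * 4) (hN : 6 ≤ N) (heven : N % 2 = 0) :
    Can (cyc N) L (Finset.range N) M ∅ ∅ := by
  obtain ⟨B, hB4, hB⟩ : ∃ B, B % 4 = 0 ∧ (N = B ∨ N = B + 6) := by
    rcases (by omega : N % 4 = 0 ∨ N % 4 = 2) with h | h
    · exact ⟨N, h, Or.inl rfl⟩
    · exact ⟨N - 6, by omega, Or.inr (by omega)⟩
  set p : ℕ → ℕ := fun i => if i < B then i % 4 else (i - B) % 3 with hp
  have hp4 : ∀ i, p i < 4 := fun i => by simp only [hp]; split_ifs <;> omega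
  set e := Finset.equivFinOfCardEq hS
  have hinj : ∀ i j, ((e.symm ⟨p i, hp4 i⟩ : S) : C) = (e.symm ⟨p j, hp4 j⟩ : S) → p i = p j := by
    intro i j h
    simpa using e.symm.injective (Subtype.ext h)
  refine ⟨fun i => (e.symm ⟨p i, hp4 i⟩ : S), ?_, ?_, by simp, by simp, fun col => ?_⟩
  · intro i hi
    simp only [Finset.union_empty, Finset.mem_range] at hi
    rw [hL i hi]
    exact (e.symm _).2
  · intro i hi j hj hadj h
    simp only [Finset.union_empty, Finset.mem_range] at hi hj
    rw [cyc_adj] at hadj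
    have := hinj i j h
    simp only [hp] at this
    split_ifs at this <;> omega
  · rw [← Finset.card_range M]
    refine Finset.card_le_card_of_injOn (fun i => if i < B then i / 4 else B / 4 + (i - B) / 3) ?_ ?_
    · intro i hi
      rw [Finset.mem_coe, Finset.mem_filter, Finset.mem_range] at hi
      rw [Finset.mem_coe, Finset.mem_range]
      dsimp only
      split_ifs <;> omega
    · intro i hi j hj hij
      rw [Finset.mem_coe, Finset.mem_filter, Finset.mem_range] at hi hj
      have := hinj i j (hi.2.trans hj.2.symm)
      simp only [hp] at this
      dsimp only at hij
      split_ifs at this hij <;> omega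

theorem can_cycle [Nonempty C] (hL : ∀ i, (L i).card = k) (hk : 4 ≤ k) {M : ℕ}
    (hM : N ≤ M * k) (hN : 6 ≤ N) (heven : N % 2 = 0) :
    Can (cyc N) L (Finset.range N) M ∅ ∅ := by
  rcases (by omega : k = 4 ∨ 5 ≤ k) with rfl | hk5
  swap
  · exact can_cycle_of_five_le hL hk5 hM (by omega)
  by_cases hc : ∀ i, i + 1 < N → L i = L (i + 1)
  · refine can_cycle_four_of_eq (hL 0) (fun i hi => ?_) hM hN heven
    induction i with
    | zero => rfl
    | succ i ih => rw [← hc i hi]; exact ih (by omega)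
  · push Not at hc
    obtain ⟨i, hi, hne⟩ := hc
    obtain ⟨t, ht⟩ : ∃ t, t + i + 2 = N := ⟨N - 2 - i, by omega⟩
    have h := can_cycle_four_of_ne (L := fun y => L (if t ≤ y then y - t else y + N - t)) (N := N)
      (fun y => hL _) hM hN heven (by
        rw [if_pos (by omega), if_pos (by omega)]
        rw [show N - 1 - t = i + 1 by omega, show N - 2 - t = i by omega]
        exact hne.symm)
    refine h.comap (fun x => if x + t < N then x + t else x + t - N) ?_ ?_ ?_ ?_
    · intro x hx y hy hxy
      rw [Finset.mem_coe, Finset.mem_range] at hx hy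
      dsimp only at hxy
      split_ifs at hxy <;> omega
    · intro x hx
      rw [Finset.mem_range] at hx ⊢
      split_ifs <;> omega
    · intro x hx
      rw [Finset.mem_range] at hx
      congr 1
      split_ifs <;> omega
    · intro x hx y hy hxy
      rw [Finset.mem_range] at hx hy
      rw [cyc_adj] at hxy ⊢
      split_ifs <;> omega

end Cycle

section Small

variable {C : Type} {L : Nd → Finset C} {n : ℕ → ℕ} {T Hs : Finset ℕ} {k : ℕ}

theorem can_of_one_path [Nonempty C] (hL : ∀ x, (L x).card = k) (hk : 3 ≤ k)
    (hn : ∀ i, i ∉ Hs → 3 ≤ n i) (hH : ∀ i ∈ Hs, n i = 1) (hTH : T ∪ Hs = {0}) {M : ℕ}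
    (hM : n 0 + 2 ≤ M * k) : Can (ndGraph n) L (verts n T Hs) M ∅ ∅ := by
  have hs : ∀ i j, s i j ∈ verts n T Hs → i = 0 ∧ 1 ≤ j ∧ j ≤ n 0 := by
    intro i j h
    have h0 : i ∈ T ∪ Hs → i = 0 := fun h => by rw [hTH] at h; simpa using h
    rcases mem_verts_s.1 h with h | h
    · obtain rfl := h0 (Finset.mem_union_right _ h.1)
      have := hH 0 h.1
      omega
    · obtain rfl := h0 (Finset.mem_union_left _ h.1)
      omega
  set ψ : Nd → ℕ := fun x => match x with
    | u => 0
    | w => n 0 + 1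
    | s _ j => j with hψ
  have hpos : ∀ a, a ≤ n 0 + 1 → ψ (pos n 0 a) = a := by
    intro a ha
    unfold pos
    split_ifs with h1 h2 <;> simp only [hψ] <;> omega
  have : Nonempty Nd := ⟨u⟩
  refine can_comap hL ψ ?_ (A' := Finset.range (n 0 + 2)) ?_ ?_ (H := cyc (n 0 + 4))
    fun L' hL' => can_path hL' hk hM (by omega)
  · intro x hx y hy hxy
    cases x with
    | u => cases y with
      | u => rfl
      | w => simp only [hψ] at hxy; omega
      | s i j => have := hs i j hy; simp only [hψ] at hxy; omega
    | w => cases y with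
      | u => simp only [hψ] at hxy; omega
      | w => rfl
      | s i j => have := hs i j hy; simp only [hψ] at hxy; omega
    | s i j =>
      have := hs i j hx
      cases y with
      | u => simp only [hψ] at hxy; omega
      | w => simp only [hψ] at hxy; omega
      | s i' j' =>
        have := hs i' j' hy
        simp only [hψ] at hxy
        rw [s.injEq]; omega
  · intro x hx
    rw [Finset.mem_range]
    cases x with
    | u => simp only [hψ]; omega
    | w => simp only [hψ]; omega
    | s i j => have := hs i j hx; simp only [hψ]; omega
  · intro x hx y hy hxy
    rcases hxy.2 with ⟨i, a, b, h1, h2, h3, h4, h5, rfl, rfl⟩ | ⟨i, j, h1, rfl, rfl⟩ |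
      ⟨i, j, h1, rfl, rfl⟩
    · by_cases hi : i = 0
      · subst hi
        rw [hpos a h4, hpos b h5, cyc_adj]
        omega
      · exfalso
        have hiH : i ∉ Hs := fun h => hi (by
          have : i ∈ T ∪ Hs := Finset.mem_union_right _ h
          rw [hTH] at this
          simpa using this)
        have := hn i hiH
        have key : ∀ a ≤ n i + 1, pos n i a ∈ verts n T Hs → a = 0 ∨ a = n i + 1 := by
          intro a ha hmem
          by_contra hcon
          rw [pos_eq_s (by omega) (by omega)] at hmem
          exact hi (hs i a hmem).1
        have := key a h4 hx
        have := key b h5 hy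
        omega
    · exact absurd ((hs _ _ hx).1.trans (hs _ _ hy).1.symm) h1
    · exact absurd ((hs _ _ hx).1.trans (hs _ _ hy).1.symm) h1

theorem can_of_two_paths [Nonempty C] (hL : ∀ x, (L x).card = k) (hk : 4 ≤ k)
    (hn : ∀ i, i ∉ Hs → 3 ≤ n i) (hH : ∀ i ∈ Hs, n i = 1) (hTH : T ∪ Hs = {0, 1})
    (hsum : 4 ≤ n 0 + n 1) (heven : (n 0 + n 1) % 2 = 0) {M : ℕ}
    (hM : n 0 + n 1 + 2 ≤ M * k) : Can (ndGraph n) L (verts n T Hs) M ∅ ∅ := by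
  have h01 : ∀ i, i ∈ T ∪ Hs → i = 0 ∨ i = 1 := fun i h => by rw [hTH] at h; simpa using h
  have hs : ∀ i j, s i j ∈ verts n T Hs → i = 0 ∧ 1 ≤ j ∧ j ≤ n 0 ∨ i = 1 ∧ 1 ≤ j ∧ j ≤ n 1 := by
    intro i j h
    rcases mem_verts_s.1 h with h | h
    · have := hH i h.1
      rcases h01 i (Finset.mem_union_right _ h.1) with rfl | rfl <;> omega
    · rcases h01 i (Finset.mem_union_left _ h.1) with rfl | rfl <;> omega
  set N := n 0 + n 1 + 2 with hN
  set ψ : Nd → ℕ := fun x => match x with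
    | u => 0
    | w => n 0 + 1
    | s i j => if i = 0 then j else N - j with hψ
  have hψu : ψ u = 0 := rfl
  have hψw : ψ w = n 0 + 1 := rfl
  have hψ0 : ∀ j, ψ (s 0 j) = j := fun j => rfl
  have hψ1 : ∀ j, ψ (s 1 j) = N - j := fun j => rfl
  have hpos0 : ∀ a, a ≤ n 0 + 1 → ψ (pos n 0 a) = a := by
    intro a ha
    unfold pos
    split_ifs with h1 h2
    · omega
    · exact hψ0 a
    · omega
  have hpos1 : ∀ a, a ≤ n 1 + 1 → a = 0 ∧ ψ (pos n 1 a) = 0 ∨ 1 ≤ a ∧ ψ (pos n 1 a) = N - a := by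
    intro a ha
    unfold pos
    split_ifs with h1 h2
    · omega
    · rw [hψ1]; omega
    · omega
  have : Nonempty Nd := ⟨u⟩
  refine can_comap hL ψ ?_ (A' := Finset.range N) ?_ ?_ (H := cyc N)
    fun L' hL' => can_cycle hL' hk hM (by omega) (by omega)
  · intro x hx y hy hxy
    cases x with
    | u => cases y with
      | u => rfl
      | w => omega
      | s i j => rcases hs i j hy with ⟨rfl, h⟩ | ⟨rfl, h⟩ <;> simp only [hψ0, hψ1, hψu] at hxy <;> omega
    | w => cases y with
      | u => omega
      | w => rfl
      | s i j => rcases hs i j hy with ⟨rfl, h⟩ | ⟨rfl, h⟩ <;> simp only [hψ0, hψ1, hψw] at hxy <;> omega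
    | s i j =>
      rcases hs i j hx with ⟨rfl, h⟩ | ⟨rfl, h⟩
      all_goals
        cases y with
        | u => simp only [hψ0, hψ1, hψu] at hxy; omega
        | w => simp only [hψ0, hψ1, hψw] at hxy; omega
        | s i' j' =>
          rw [s.injEq]
          rcases hs i' j' hy with ⟨rfl, h⟩ | ⟨rfl, h⟩ <;> simp only [hψ0, hψ1] at hxy <;> omega
  · intro x hx
    rw [Finset.mem_range]
    cases x with
    | u => omega
    | w => omega
    | s i j => rcases hs i j hx with ⟨rfl, h⟩ | ⟨rfl, h⟩ <;> simp only [hψ0, hψ1] <;> omega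
  · intro x hx y hy hxy
    rcases hxy.2 with ⟨i, a, b, h1, h2, h3, h4, h5, rfl, rfl⟩ | ⟨i, j, h1, rfl, rfl⟩ |
      ⟨i, j, h1, rfl, rfl⟩
    · by_cases hi : i = 0
      · subst hi
        rw [hpos0 a h4, hpos0 b h5, cyc_adj]
        omega
      by_cases hi1 : i = 1
      · subst hi1
        have := hpos1 a h4
        have := hpos1 b h5
        rw [cyc_adj]
        omega
      · exfalso
        have hiH : i ∉ Hs := fun h => by
          have := h01 i (Finset.mem_union_right _ h)
          omega
        have := hn i hiH
        have key : ∀ a ≤ n i + 1, pos n i a ∈ verts n T Hs → a = 0 ∨ a = n i + 1 := by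
          intro a ha hmem
          by_contra hcon
          rw [pos_eq_s (by omega) (by omega)] at hmem
          have := hs i a hmem
          omega
        have := key a h4 hx
        have := key b h5 hy
        omega
    · rcases hs _ _ hx with ⟨rfl, h⟩ | ⟨rfl, h⟩ <;> rcases hs _ _ hy with ⟨rfl, h'⟩ | ⟨rfl, h'⟩
      · exact absurd rfl h1
      · rw [hψ0, hψ1, cyc_adj]; omega
      · rw [hψ0, hψ1, cyc_adj]; omega
      · exact absurd rfl h1
    · rcases hs _ _ hx with ⟨rfl, h⟩ | ⟨rfl, h⟩ <;> rcases hs _ _ hy with ⟨rfl, h'⟩ | ⟨rfl, h'⟩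
      · exact absurd rfl h1
      · rw [hψ0, hψ1, cyc_adj]; omega
      · rw [hψ0, hψ1, cyc_adj]; omega
      · exact absurd rfl h1

end Small

section Model

variable {C : Type} {L : Nd → Finset C} {n : ℕ → ℕ} {k m : ℕ}

theorem card_verts {T Hs : Finset ℕ} (hTH : Disjoint T Hs) :
    (verts n T Hs).card = 2 + Hs.card + ∑ i ∈ T, n i := by
  have h1 : (R Hs 0 1).card = Hs.card := by simp [card_R]
  have h2 : (R T 0 n).card = ∑ i ∈ T, n i := by simp [card_R]
  rw [verts, Finset.card_union_of_disjoint, Finset.card_union_of_disjoint, h1, h2,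
    Finset.card_pair (by simp)]
  · simp
  · rw [Finset.disjoint_right]
    intro x hx
    obtain ⟨i, j, rfl, h, -⟩ := exists_of_mem_R hx
    simp only [Finset.mem_union, Finset.mem_insert, Finset.mem_singleton, reduceCtorEq, mem_R, false_or]
    exact fun h' => Finset.disjoint_left.1 hTH h h'.1

/-- The elements of all `m` paths. -/
noncomputable def allVerts (n : ℕ → ℕ) (m : ℕ) : Finset Nd :=
  verts n ((Finset.range m).filter fun i => n i ≠ 1) ((Finset.range m).filter fun i => n i = 1)

theorem mem_allVerts {i j : ℕ} : s i j ∈ allVerts n m ↔ i < m ∧ 1 ≤ j ∧ j ≤ n i := by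
  rw [allVerts, mem_verts_s, Finset.mem_filter, Finset.mem_filter, Finset.mem_range]
  omega

theorem can_allVerts [Nonempty C] (hL : ∀ x, (L x).card = k) (hm : 1 ≤ m) (hk : m + 2 ≤ k)
    (hodd : ∀ i, n i % 2 = 1) (hn : ∀ i, m ≤ i → 3 ≤ n i)
    (hone : ∀ i j, n i = 1 → n j = 1 → i = j) {M : ℕ} (hM : (allVerts n m).card ≤ M * k) :
    Can (ndGraph n) L (allVerts n m) M ∅ ∅ := by
  set T := (Finset.range m).filter fun i => n i ≠ 1 with hT
  set Hs := (Finset.range m).filter fun i => n i = 1 with hHs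
  have hTH : Disjoint T Hs := (Finset.disjoint_filter_filter_not _ _ _).symm
  have hcup : T ∪ Hs = Finset.range m := by
    rw [Finset.union_comm]
    exact Finset.filter_union_filter_not_eq _ _
  have hcard : T.card + Hs.card = m := by
    rw [← Finset.card_union_of_disjoint hTH, hcup, Finset.card_range]
  have hH : ∀ i ∈ Hs, n i = 1 := fun i hi => (Finset.mem_filter.1 hi).2
  have hn' : ∀ i, i ∉ Hs → 3 ≤ n i := by
    intro i hi
    have := hodd i
    rcases lt_or_ge i m with h | h
    · have : n i ≠ 1 := fun h' => hi (Finset.mem_filter.2 ⟨Finset.mem_range.2 h, h'⟩)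
      omega
    · exact hn i h
  have hH1 : Hs.card ≤ 1 :=
    Finset.card_le_one.2 fun i hi j hj => hone i j (hH i hi) (hH j hj)
  have hsum : 2 + Hs.card + ∑ i ∈ T, n i = 2 + ∑ i ∈ Finset.range m, n i := by
    rw [← hcup, Finset.sum_union hTH, Finset.sum_congr (s₁ := Hs) rfl hH]
    simp
    ring
  rw [allVerts, card_verts hTH] at hM
  rcases (by omega : m = 1 ∨ m = 2 ∨ 3 ≤ m) with h | h | h
  · subst h
    rw [hsum, Finset.sum_range_one] at hM
    exact can_of_one_path hL hk hn' hH hcup (by omega)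
  · subst h
    rw [hsum, Finset.sum_range_succ, Finset.sum_range_one] at hM
    have h0 := hodd 0
    have h1 := hodd 1
    have : ¬ (n 0 = 1 ∧ n 1 = 1) := fun h => absurd (hone 0 1 h.1 h.2) (by omega)
    exact can_of_two_paths hL hk hn' hH (by rw [hcup]; rfl) (by omega) (by omega) (by omega)
  · exact can_of_three_le hL hn' (fun i _ => hodd i) hH hTH hH1 (by omega) (by omega) hM

end Model

section Transfer

open ListEquitable

theorem pos_eq_pos {n : ℕ → ℕ} {i a i' a' : ℕ} (ha : a ≤ n i + 1) (ha' : a' ≤ n i' + 1)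
    (h : pos n i a = pos n i' a') :
    i = i' ∧ a = a' ∨ a = 0 ∧ a' = 0 ∨ a = n i + 1 ∧ a' = n i' + 1 := by
  unfold pos at h
  split_ifs at h with h1 h2 h3 h4 h5
  · omega
  · rw [s.injEq] at h; omega
  · omega

/-- The number of elements strictly between the ends of the `i`-th path. -/
def elems {m : ℕ} (l : Fin m → ℕ) (i : ℕ) : ℕ := if h : i < m then 2 * l ⟨i, h⟩ - 1 else 3

variable {m : ℕ} {l : Fin m → ℕ}

theorem elems_fin (i : Fin m) : elems l i = 2 * l i - 1 := by simp [elems]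

/-- The name of a vertex of the standard theta graph. -/
def vertNd : ThetaVertex l → Nd
  | .u => u
  | .w => w
  | .inner i j => s i (2 * (j + 1))

theorem vertNd_thetaPath (hl : ∀ i, 1 ≤ l i) {i : Fin m} {j : ℕ} (hj : j ≤ l i) :
    vertNd (thetaPath l i j) = pos (elems l) i (2 * j) := by
  have := elems_fin (l := l) i
  have := hl i
  unfold thetaPath
  split_ifs with h1 h2
  · simp [h1, vertNd]
  · rw [pos_eq_s (by omega) (by omega), vertNd]
    congr 1
    dsimp only
    omega
  · rw [pos_eq_w (by omega), vertNd]

theorem vertNd_injective : Function.Injective (vertNd (l := l)) := by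
  intro x y h
  cases x <;> cases y <;> simp only [vertNd, reduceCtorEq, s.injEq] at h ⊢
  case inner.inner i j i' j' =>
    obtain ⟨h1, h2⟩ := h
    obtain rfl := Fin.ext h1
    congr 1
    exact Fin.ext (by omega)

theorem thetaGraph_adj_iff (hl : ∀ i, 1 ≤ l i) {x y : ThetaVertex l} : (thetaGraph l).Adj x y ↔
    ∃ (i : Fin m) (j : ℕ), j < l i ∧ s(x, y) = s(thetaPath l i j, thetaPath l i (j + 1)) := by
  rw [thetaGraph, SimpleGraph.fromEdgeSet_adj]
  refine ⟨fun h => h.1, fun h => ⟨h, ?_⟩⟩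
  obtain ⟨i, j, hj, h⟩ := h
  rintro rfl
  have h1 : thetaPath l i j = thetaPath l i (j + 1) := by
    rw [Sym2.eq_iff] at h
    rcases h with ⟨h1, h2⟩ | ⟨h1, h2⟩ <;> rw [← h1, ← h2]
  have h2 := congrArg vertNd h1
  rw [vertNd_thetaPath hl hj.le, vertNd_thetaPath hl hj] at h2
  have := elems_fin (l := l) i
  rcases pos_eq_pos (by omega) (by omega) h2 with h | h | h <;> omega

variable {V : Type*} {G : SimpleGraph V} (e : G ≃g thetaGraph l)

theorem exists_path_of_edge (hl : ∀ i, 1 ≤ l i) (ed : G.edgeSet) : ∃ p : Fin m × ℕ, p.2 < l p.1 ∧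
    Sym2.map e (ed : Sym2 V) = s(thetaPath l p.1 p.2, thetaPath l p.1 (p.2 + 1)) := by
  obtain ⟨ed, hed⟩ := ed
  induction ed using Sym2.ind with
  | _ x y =>
    rw [SimpleGraph.mem_edgeSet, ← e.map_adj_iff, thetaGraph_adj_iff hl] at hed
    obtain ⟨i, j, hj, h⟩ := hed
    exact ⟨(i, j), hj, by simpa using h⟩

/-- The name of a vertex or edge of a theta graph. -/
noncomputable def elemNd (hl : ∀ i, 1 ≤ l i) : V ⊕ G.edgeSet → Nd
  | .inl v => vertNd (e v)
  | .inr ed => s (exists_path_of_edge e hl ed).choose.1 (2 * (exists_path_of_edge e hl ed).choose.2 + 1)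

theorem elemNd_inr (hl : ∀ i, 1 ≤ l i) (ed : G.edgeSet) : ∃ (i : Fin m) (j : ℕ), j < l i ∧
    Sym2.map e (ed : Sym2 V) = s(thetaPath l i j, thetaPath l i (j + 1)) ∧
    elemNd e hl (.inr ed) = s i (2 * j + 1) :=
  ⟨_, _, (exists_path_of_edge e hl ed).choose_spec.1, (exists_path_of_edge e hl ed).choose_spec.2, rfl⟩

theorem elemNd_inl (hl : ∀ i, 1 ≤ l i) (v : V) : elemNd e hl (.inl v) = vertNd (e v) := rfl

theorem vertNd_even {x : ThetaVertex l} {i j : ℕ} (h : vertNd x = s i j) : j % 2 = 0 := by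
  cases x <;> simp only [vertNd, reduceCtorEq, s.injEq] at h
  omega

theorem elemNd_injective (hl : ∀ i, 1 ≤ l i) : Function.Injective (elemNd e hl) := by
  rintro (v | ed) (v' | ed') h
  · rw [elemNd_inl, elemNd_inl] at h
    rw [e.injective (vertNd_injective h)]
  · obtain ⟨i, j, -, -, h2⟩ := elemNd_inr e hl ed'
    rw [elemNd_inl, h2] at h
    have := vertNd_even h
    omega
  · obtain ⟨i, j, -, -, h2⟩ := elemNd_inr e hl ed
    rw [elemNd_inl, h2] at h
    have := vertNd_even h.symm
    omega
  · obtain ⟨i, j, -, h1, h2⟩ := elemNd_inr e hl ed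
    obtain ⟨i', j', -, h1', h2'⟩ := elemNd_inr e hl ed'
    rw [h2, h2', s.injEq] at h
    obtain rfl := Fin.ext h.1
    obtain rfl : j = j' := by omega
    rw [← h1'] at h1
    exact congrArg Sum.inr (Subtype.ext (Sym2.map.injective e.injective h1))

/-- The vertices on an edge of the `i`-th path. -/
theorem vertNd_of_mem (hl : ∀ i, 1 ≤ l i) {v : V} {ed : Sym2 V} (hv : v ∈ ed) {i : Fin m} {j : ℕ}
    (hj : j < l i) (h : Sym2.map e ed = s(thetaPath l i j, thetaPath l i (j + 1))) :
    ∃ a, j ≤ a ∧ a ≤ j + 1 ∧ vertNd (e v) = pos (elems l) i (2 * a) := by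
  have h1 : e v ∈ Sym2.map e ed := Sym2.mem_map.2 ⟨v, hv, rfl⟩
  rw [h, Sym2.mem_iff] at h1
  rcases h1 with h1 | h1
  · exact ⟨j, le_rfl, by omega, by rw [h1, vertNd_thetaPath hl hj.le]⟩
  · exact ⟨j + 1, by omega, le_rfl, by rw [h1, vertNd_thetaPath hl hj]⟩

theorem elemNd_adj (hl : ∀ i, 1 ≤ l i) {x y : V ⊕ G.edgeSet} (h : (totalGraph G).Adj x y) :
    (ndGraph (elems l)).Adj (elemNd e hl x) (elemNd e hl y) := by
  have hvert : ∀ (v : V) (ed : G.edgeSet), v ∈ (ed : Sym2 V) →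
      NdRel (elems l) (elemNd e hl (.inl v)) (elemNd e hl (.inr ed)) := by
    intro v ed hv
    obtain ⟨i, j, hj, h1, h2⟩ := elemNd_inr e hl ed
    obtain ⟨a, ha1, ha2, ha⟩ := vertNd_of_mem e hl hv hj h1
    have := elems_fin (l := l) i
    rw [elemNd_inl, ha, h2]
    exact Or.inl ⟨i, 2 * a, 2 * j + 1, by omega, by omega, by omega, by omega, by omega, rfl,
      (pos_eq_s (by omega) (by omega)).symm⟩
  refine ⟨fun hxy => h.ne (elemNd_injective e hl hxy), ?_⟩
  rcases x with v | ed <;> rcases y with v' | ed'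
  · change G.Adj v v' at h
    rw [← e.map_adj_iff, thetaGraph_adj_iff hl] at h
    obtain ⟨i, j, hj, h⟩ := h
    have := elems_fin (l := l) i
    rw [elemNd_inl, elemNd_inl]
    rw [Sym2.eq_iff] at h
    rcases h with ⟨h1, h2⟩ | ⟨h1, h2⟩
    · rw [h1, h2, vertNd_thetaPath hl hj.le, vertNd_thetaPath hl hj]
      exact Or.inl ⟨i, 2 * j, 2 * (j + 1), by omega, by omega, by omega, by omega, by omega, rfl, rfl⟩
    · rw [h1, h2, vertNd_thetaPath hl hj.le, vertNd_thetaPath hl hj]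
      exact Or.inl ⟨i, 2 * (j + 1), 2 * j, by omega, by omega, by omega, by omega, by omega, rfl, rfl⟩
  · exact hvert v ed' h
  · have hne : elemNd e hl (.inl v') ≠ elemNd e hl (.inr ed) := fun h' =>
      by simpa using elemNd_injective e hl h'
    have hadj : (ndGraph (elems l)).Adj _ _ := ⟨hne, hvert v' ed h⟩
    exact hadj.symm.2
  · change G.lineGraph.Adj ed ed' at h
    rw [SimpleGraph.lineGraph_adj_iff_exists] at h
    obtain ⟨hne, v, hv, hv'⟩ := h
    obtain ⟨i, j, hj, h1, h2⟩ := elemNd_inr e hl ed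
    obtain ⟨i', j', hj', h1', h2'⟩ := elemNd_inr e hl ed'
    obtain ⟨a, ha1, ha2, ha⟩ := vertNd_of_mem e hl hv hj h1
    obtain ⟨a', ha1', ha2', ha'⟩ := vertNd_of_mem e hl hv' hj' h1'
    have e1 := elems_fin (l := l) i
    have e1' := elems_fin (l := l) i'
    rw [h2, h2']
    have hne' : ¬ ((i : ℕ) = i' ∧ j = j') := by
      rintro ⟨h3, rfl⟩
      obtain rfl := Fin.ext h3
      rw [← h1'] at h1
      exact hne (Subtype.ext (Sym2.map.injective e.injective h1))
    by_cases hii : (i : ℕ) = i'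
    · rw [← hii] at e1' ha' ⊢
      refine Or.inl ⟨i, 2 * j + 1, 2 * j' + 1, by omega, ?_, ?_, by omega, by omega,
        (pos_eq_s (by omega) (by omega)).symm, (pos_eq_s (by omega) (by omega)).symm⟩
      all_goals
        rcases pos_eq_pos (by omega) (by omega) (ha.symm.trans ha') with h | h | h <;> omega
    · rcases pos_eq_pos (by omega) (by omega) (ha.symm.trans ha') with h | h | h
      · exact absurd h.1 hii
      · exact Or.inr (Or.inl ⟨i, i', hii, by congr 1; omega, by congr 1; omega⟩)
      · exact Or.inr (Or.inr ⟨i, i', hii, by congr 1; omega, by congr 1; omega⟩)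

theorem elemNd_mem (hl : ∀ i, 1 ≤ l i) (x : V ⊕ G.edgeSet) : elemNd e hl x ∈ allVerts (elems l) m := by
  rcases x with v | ed
  · rw [elemNd_inl]
    cases hv : e v with
    | u => simp [vertNd, allVerts, verts]
    | w => simp [vertNd, allVerts, verts]
    | inner i j =>
      have := elems_fin (l := l) i
      have := j.2
      rw [vertNd, mem_allVerts]
      exact ⟨i.2, by omega, by omega⟩
  · obtain ⟨i, j, hj, -, h2⟩ := elemNd_inr e hl ed
    have := elems_fin (l := l) i
    rw [h2, mem_allVerts]
    exact ⟨i.2, by omega, by omega⟩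

theorem exists_elemNd_eq (hl : ∀ i, 1 ≤ l i) (hone : ∀ i j, elems l i = 1 → elems l j = 1 → i = j)
    {y : Nd} (hy : y ∈ allVerts (elems l) m) : ∃ x, elemNd e hl x = y := by
  cases y with
  | u => exact ⟨.inl (e.symm .u), by rw [elemNd_inl, RelIso.apply_symm_apply]; rfl⟩
  | w => exact ⟨.inl (e.symm .w), by rw [elemNd_inl, RelIso.apply_symm_apply]; rfl⟩
  | s i j =>
    rw [mem_allVerts] at hy
    obtain ⟨hi, hj1, hj2⟩ := hy
    lift i to Fin m using hi
    have e1 := elems_fin (l := l) i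
    have := hl i
    rcases Nat.even_or_odd' j with ⟨b, rfl | rfl⟩
    · refine ⟨.inl (e.symm (.inner i ⟨b - 1, by omega⟩)), ?_⟩
      rw [elemNd_inl, RelIso.apply_symm_apply, vertNd]
      congr 1
      dsimp only
      omega
    · have hb : b < l i := by omega
      have hadj : (thetaGraph l).Adj (thetaPath l i b) (thetaPath l i (b + 1)) :=
        (thetaGraph_adj_iff hl).2 ⟨i, b, hb, rfl⟩
      have hadj' : s(e.symm (thetaPath l i b), e.symm (thetaPath l i (b + 1))) ∈ G.edgeSet :=
        e.symm.map_adj_iff.2 hadj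
      refine ⟨.inr ⟨_, hadj'⟩, ?_⟩
      obtain ⟨i', j', hj', h1, h2⟩ := elemNd_inr e hl ⟨_, hadj'⟩
      have e1' := elems_fin (l := l) i'
      rw [h2]
      simp only [Sym2.map_mk, RelIso.apply_symm_apply] at h1
      have key : (i' : ℕ) = i ∧ j' = b := by
        rw [Sym2.eq_iff] at h1
        rcases h1 with ⟨h3, h4⟩ | ⟨h3, h4⟩
        · have h3 := congrArg vertNd h3
          have h4 := congrArg vertNd h4
          rw [vertNd_thetaPath hl (by omega), vertNd_thetaPath hl (by omega)] at h3 h4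
          have h3 := pos_eq_pos (by omega) (by omega) h3
          have h4 := pos_eq_pos (by omega) (by omega) h4
          by_cases hii : (i : ℕ) = i'
          · omega
          · exact absurd (hone i i' (by omega) (by omega)) hii
        · have h3 := congrArg vertNd h3
          have h4 := congrArg vertNd h4
          rw [vertNd_thetaPath hl (by omega), vertNd_thetaPath hl (by omega)] at h3 h4
          have h3 := pos_eq_pos (by omega) (by omega) h3
          have h4 := pos_eq_pos (by omega) (by omega) h4
          omega
      rw [key.1, key.2]

theorem elems_one (hmono : Monotone l) (hsimple : ∀ h : 1 < m, 2 ≤ l ⟨1, h⟩)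
    (i j : ℕ) (hi : elems l i = 1) (hj : elems l j = 1) : i = j := by
  have key : ∀ i, elems l i = 1 → i = 0 := by
    intro i hi
    by_contra hne
    rcases lt_or_ge i m with h | h
    · have h1 := elems_fin (l := l) ⟨i, h⟩
      have h2 := hsimple (by omega)
      have h3 := hmono (show (⟨1, by omega⟩ : Fin m) ≤ ⟨i, h⟩ from Fin.mk_le_mk.2 (by omega))
      dsimp only at h1
      omega
    · rw [elems, dif_neg (by omega)] at hi
      omega
  rw [key i hi, key j hj]

theorem isEquitablyChoosable_totalGraph [Fintype V] (e : G ≃g thetaGraph l) (hm : 1 ≤ m) (hl : ∀ i, 1 ≤ l i)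
    (hmono : Monotone l) (hsimple : ∀ h : 1 < m, 2 ≤ l ⟨1, h⟩) {k : ℕ} (hk : m + 2 ≤ k) :
    IsEquitablyChoosable (totalGraph G) k := by
  intro C L hL
  have : Fintype (V ⊕ G.edgeSet) := Fintype.ofFinite _
  have : Nonempty (V ⊕ G.edgeSet) := ⟨.inl (e.symm .u)⟩
  have : Nonempty C := by
    have : (L (.inl (e.symm .u))).Nonempty := Finset.card_pos.1 (by rw [hL]; omega)
    exact ⟨this.choose⟩
  have hone := elems_one hmono hsimple
  set M := ⌈(Nat.card (V ⊕ G.edgeSet) : ℚ) / (k : ℚ)⌉₊ with hM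
  have hcard : (allVerts (elems l) m).card ≤ Nat.card (V ⊕ G.edgeSet) := by
    rw [Nat.card_eq_fintype_card, ← Finset.card_univ]
    refine (Finset.card_le_card fun y hy => ?_).trans
      (Finset.card_image_le (s := Finset.univ) (f := elemNd e hl))
    obtain ⟨x, rfl⟩ := exists_elemNd_eq e hl hone hy
    exact Finset.mem_image_of_mem _ (Finset.mem_univ x)
  have hMk : Nat.card (V ⊕ G.edgeSet) ≤ M * k := by
    have h1 := Nat.le_ceil ((Nat.card (V ⊕ G.edgeSet) : ℚ) / (k : ℚ))
    rw [div_le_iff₀ (by exact_mod_cast (by omega : 0 < k))] at h1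
    exact_mod_cast h1
  have hcan : Can (totalGraph G) L Finset.univ M ∅ ∅ := by
    refine can_comap (k := k) hL (elemNd e hl) (elemNd_injective e hl).injOn
      (fun x _ => elemNd_mem e hl x) (fun x _ y _ h => elemNd_adj e hl h) fun L' hL' =>
      can_allVerts hL' hm hk (fun i => ?_) (fun i hi => ?_) hone (hcard.trans hMk)
    · unfold elems
      split_ifs with h
      · have := hl ⟨i, h⟩
        omega
      · rfl
    · rw [elems, dif_neg (by omega)]
  obtain ⟨c, h1, h2, -, -, h5⟩ := hcan
  simp only [Finset.union_empty, Finset.mem_univ, forall_const] at h1 h2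
  refine ⟨SimpleGraph.Coloring.mk c fun {x y} h => h2 x y h, h1, fun col => ?_⟩
  refine le_trans (le_of_eq ?_) (h5 col)
  rw [← Set.ncard_coe_finset]
  congr 1
  ext x
  simp only [Set.mem_ofPred_eq, Finset.coe_filter, Finset.mem_univ, true_and]
  rfl

theorem le_maxDegree [Fintype V] [DecidableRel G.Adj] (e : G ≃g thetaGraph l)
    (hl : ∀ i, 1 ≤ l i) (hmono : Monotone l) (hsimple : ∀ h : 1 < m, 2 ≤ l ⟨1, h⟩) : m ≤ G.maxDegree := by
  refine le_trans ?_ (G.degree_le_maxDegree (e.symm .u))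
  rw [← SimpleGraph.card_neighborFinset_eq_degree]
  refine (Finset.card_fin m).ge.trans ?_
  refine Finset.card_le_card_of_injOn (fun i => e.symm (thetaPath l i 1)) (fun i _ => ?_) ?_
  · rw [Finset.mem_coe, SimpleGraph.mem_neighborFinset, e.symm.map_adj_iff, thetaGraph_adj_iff hl]
    exact ⟨i, 0, hl i, by simp [thetaPath]⟩
  · intro i _ j _ hij
    have h := congrArg vertNd (e.symm.injective hij)
    rw [vertNd_thetaPath hl (hl i), vertNd_thetaPath hl (hl j)] at h
    have e1 := elems_fin (l := l) i
    have e2 := elems_fin (l := l) j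
    have h3 := hl i
    have h4 := hl j
    have h5 := pos_eq_pos (by omega) (by omega) h
    refine Fin.ext ?_
    rcases h5 with h | h | h
    · exact h.1
    · omega
    · exact elems_one hmono hsimple _ _ (by omega) (by omega)

end Transfer

end ThetaTotal

theorem mainTheorem1 {V : Type*} [Fintype V] (G : SimpleGraph V) [DecidableRel G.Adj]
    (m : ℕ) (hm : 1 ≤ m) (l : Fin m → ℕ) (hl : ∀ i, 1 ≤ l i) (hmono : Monotone l)
    (hsimple : ∀ h : 1 < m, 2 ≤ l ⟨1, h⟩) (hG : ListEquitable.IsTheta G l) :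
    (∀ k : ℕ, m + 2 ≤ k →
      ListEquitable.IsEquitablyChoosable (ListEquitable.totalGraph G) k) ∧
    ListEquitable.SatisfiesLETCC G := by
  obtain ⟨e⟩ := hG
  have h : ∀ k : ℕ, m + 2 ≤ k →
      ListEquitable.IsEquitablyChoosable (ListEquitable.totalGraph G) k := fun k hk =>
    ThetaTotal.isEquitablyChoosable_totalGraph e hm hl hmono hsimple hk
  refine ⟨h, fun k hk => h k ?_⟩
  have h1 : G.maxDegree + 2 ≤ k := by exact_mod_cast (le_max_right _ _).trans hk
  have := ThetaTotal.le_maxDegree e hl hmono hsimple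
  omega
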